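/- **Setting.** Let $X$ be a measurable space (for instance a second-countable locally compact Hausdorff space with its Borel $\sigma$-algebra) and $Y$ a real separable Hilbert space. Let $\mathcal H$ be a scalar-valued RKHS on $X$ with kernel $k$ such that $k(\cdot,t)$ is measurable for every $t$, with feature map $\phi(x)=k(x,\cdot)$, and let $\mathcal G$ be the vector-valued RKHS (vRKHS) of functions $X\to Y$ with kernel $K(x,t)=k(x,t)\,\mathrm{Id}_Y$; write $K_x y=K(\cdot,x)y$. Let $p_X,q_X$ be probability measures on $X$, let $p(dy\mid x)$ be a Markov kernel from $X$ to $Y$, and let $p(dx,dy)=p_X(dx)\,p(dy\mid x)$ be the source distribution. Put $C_X=\int \phi(x)\otimes\phi(x)\,dq_X(x)$ on $\mathcal H$. Assume: 1. $k(x,x)\le\kappa^2$ for all $x$. 2. $dq_X=\beta\,dp_X$ for a measurable $\beta:X\to[0,\infty)$ with $\beta\le b$, where $b>0$. 3. $\|y\|_Y\le M'$ for $p$-almost every $(x,y)$. 4. The regression function $f^*(x)=\int y\,p(dy\mid x)$ lies in $\mathcal G$ (that is, it agrees $q_X$-a.e. with an element of $\mathcal G$, also denoted $f^*$), $f^*=C_*\phi(\cdot)$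 for a bounded operator $C_*:\mathcal H\to Y$, and the Hölder source condition $C_*=C_o\,C_X^{\,r}$ holds for some $r>0$ and some Hilbert–Schmidt operator $C_o:\mathcal H\to Y$. 5. $\mathcal H$ has an orthonormal basis $(f_i)_{i\ge1}$ with $C_Xf_i=\mu_if_i$, $\mu_i>0$, and for some $a>1$ and constants $m_1,m_2>0$, $m_1i^{-a}\le\mu_i\le m_2i^{-a}$ for all $i\ge 1$. Let $s\ge b\kappa^2$ and let $g_\lambda:[0,s]\to\mathbb R$, $0<\lambda\le s$, be a regularization family: there are $D,B>0$ with $|\sigma g_\lambda(\sigma)|\le D$ and $|g_\lambda(\sigma)|\le B/\lambda$ for all $\sigma,\lambda\in(0,s]$. Let $\nu>0$ be its qualification, i.e. for some constant $\gamma_\nu$, $|1-\sigma g_\lambda(\sigma)|\,\sigma^\nu\le\gamma_\nu\lambda^\nu$ for all $\sigma,\lambda\in(0,s]$ (it does not matter whether $\nu$ is the largest such number). For a sample $\mathbf z=(x_i,y_i)_{i=1}^n$ drawn i.i.d. from $p$ define $$\widehat f_{\mathbf z,\lambda}=g_\lambda(T_{\mathbf z})\Big(\frac1n\sum_{i=1}^n\beta(x_i)K_{x_i}y_i\Big)\in\mathcal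 G,\qquad T_{\mathbf z}f=\frac1n\sum_{i=1}^n\beta(x_i)K_{x_i}f(x_i)\quad(f\in\mathcal G).$$ **Statement.** Choose $\lambda=\lambda_n=n^{-\frac{a}{2ar+a+1}}$. (i) If $0<r<\nu$, there is a constant $c_1>0$, independent of $n$ and $\delta$, such that for all $n\ge1$ with $\lambda_n\le s$ and all $\delta\in(0,1)$, with probability at least $1-\delta$, $$\big\|f^*-\widehat f_{\mathbf z,\lambda}\big\|_{\mathcal G}\le c_1\,n^{-\frac{ar}{2ar+a+1}}\log\frac2\delta .$$ (ii) If $0<r<\nu-\frac12$, there is a constant $c_2>0$, independent of $n$ and $\delta$, such that for all $n\ge1$ with $\lambda_n\le s$ and all $\delta\in(0,1)$, with probability at least $1-\delta$, $$\big\|f^*-\widehat f_{\mathbf z,\lambda}\big\|_{L_2(q_X,Y)}\le c_2\,n^{-\frac{2ar+a}{4ar+2a+2}}\log\frac2\delta .$$ -/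

import Mathlib

open MeasureTheory ProbabilityTheory

noncomputable section

namespace CovShift

/-- Functional calculus `g(T) = ∑_σ g(σ) P_σ` of a diagonalizable self-adjoint operator `T`, where
`P_σ` is the orthogonal projection onto the eigenspace `ker (T - σ I)`. The sum (in operator norm)
runs over all real `σ`; the terms in which `σ` is not an eigenvalue are zero. -/
def spectralFun {E : Type*} [NormedAddCommGroup E] [InnerProductSpace ℝ E] [CompleteSpace E]
    (g : ℝ → ℝ) (T : E →L[ℝ] E) : E →L[ℝ] E :=
  ∑' σ : ℝ, g σ •
    (T - σ • ContinuousLinearMap.id ℝ E).ker.starProjection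

/-- `T` is a Hilbert-Schmidt operator: the sums `∑ ‖T e‖²` over finite orthonormal systems are
bounded. -/
def IsHilbertSchmidt {E F : Type*} [NormedAddCommGroup E] [InnerProductSpace ℝ E]
    [NormedAddCommGroup F] [InnerProductSpace ℝ F] (T : E →L[ℝ] F) : Prop :=
  ∃ M : ℝ, ∀ S : Finset E, Orthonormal ℝ (fun v : S => (v : E)) → ∑ v ∈ S, ‖T v‖ ^ 2 ≤ M

/-- `g_λ : [0, s] → ℝ`, `0 < λ ≤ s`, is a regularization family (here `g l σ` is `g_λ(σ)`). -/
def IsRegularizationFamily (s : ℝ) (g : ℝ → ℝ → ℝ) : Prop :=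
  (∃ D > 0, ∀ l ∈ Set.Ioc 0 s, ∀ σ ∈ Set.Ioc 0 s, |σ * g l σ| ≤ D) ∧
  (∃ B > 0, ∀ l ∈ Set.Ioc 0 s, ∀ σ ∈ Set.Ioc 0 s, |g l σ| ≤ B / l)

/-- `ν > 0` is admissible in the definition of the qualification of `g`. The qualification is the
largest such `ν`, if there is one. -/
def HasQualification (s : ℝ) (g : ℝ → ℝ → ℝ) (ν : ℝ) : Prop :=
  0 < ν ∧ ∃ γ : ℝ, ∀ l ∈ Set.Ioc 0 s, ∀ σ ∈ Set.Ioc 0 s,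
    |1 - σ * g l σ| * σ ^ ν ≤ γ * l ^ ν

section Scalar

variable {X : Type*} (H : Type*) [NormedAddCommGroup H] [InnerProductSpace ℝ H] [CompleteSpace H]
  [RKHS ℝ H X ℝ]

/-- The scalar reproducing kernel `k(x, t)` of `H`. -/
def scalarKernel (x t : X) : ℝ := RKHS.kernel H x t 1

/-- The feature map `φ(x) = k(x, ·) ∈ H`. -/
def feature (x : X) : H := RKHS.kerFun H x 1

/-- The covariance operator `C_X = E_q [φ(x) ⊗ φ(x)]`. -/
def covOp [MeasurableSpace X] (qX : Measure X) : H →L[ℝ] H :=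
  ∫ x, InnerProductSpace.rankOne ℝ (feature H x) (feature H x) ∂qX

end Scalar

section Estimator

variable {X Y : Type*} [NormedAddCommGroup Y] [InnerProductSpace ℝ Y] [CompleteSpace Y]
  (G : Type*) [NormedAddCommGroup G] [InnerProductSpace ℝ G] [CompleteSpace G] [RKHS ℝ G X Y]

/-- `S* B S f = (1/n) ∑ β(x_i) K_{x_i} f(x_i)`; recall `K_x^* f = f(x)`. -/
def empOp (β : X → ℝ) {n : ℕ} (z : Fin n → X × Y) : G →L[ℝ] G :=
  (n : ℝ)⁻¹ • ∑ i, β (z i).1 •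
    (RKHS.kerFun G (z i).1 ∘L ContinuousLinearMap.adjoint (RKHS.kerFun G (z i).1))

/-- `S* B y = (1/n) ∑ β(x_i) K_{x_i} y_i`. -/
def empRhs (β : X → ℝ) {n : ℕ} (z : Fin n → X × Y) : G :=
  (n : ℝ)⁻¹ • ∑ i, β (z i).1 • RKHS.kerFun G (z i).1 (z i).2

/-- The estimator `f_{z,λ} = g_λ(S* B S) S* B y`. -/
def estimator (β : X → ℝ) (g : ℝ → ℝ → ℝ) (l : ℝ) {n : ℕ} (z : Fin n → X × Y) : G :=
  spectralFun (g l) (empOp G β z) (empRhs G β z)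

end Estimator

/-- The choice `λ = n^{-a/(2ar+a+1)}` of the regularization parameter (`a` is the exponent of the
eigenvalue decay). -/
def regParam (a r : ℝ) (n : ℕ) : ℝ := (n : ℝ) ^ (-(a / (2 * a * r + a + 1)))

end CovShift

end

set_option linter.unusedSectionVars false

noncomputable section

/-! Since the kernel is `k · Id`, the space `G` is the Hilbert tensor product of `H` and `Y`, and
the empirical operator acts as C_z ⊗ Id, with C_z the empirical covariance of the weighted features
w(x) = √β(x) φ(x). The weights turn C = C_X into the population covariance of w under the source
law. In an eigenbasis of C_z, with eigenvalues σ, the error f* - f̂ has coordinates (1 - σ g(σ)) f*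
- g(σ) N: a bias, and a filtered noise N = (1/n) ∑ w(x_t) ⊗ ε_t built from the bounded, centred
residuals ε = √β (y - f*). The error is measured after applying (C_z + λ)^τ, with τ = 0 for the norm
of `G` and τ = 1/2 for the L² norm.

Noise. Put L = log(6/δ). The key bound is ‖(C_z + λ)^(-1/2) N‖² ≲ L λ^(-1/a) / n, in the random
metric of the sample itself. It is a self-normalized inequality: along online ridge regression,
exp((energy - M² · leverage) / (2 M²)) is a supermartingale, M being a bound for ε, and the
accumulated leverage is at most log det(1 + C_z/λ). Concavity of the logarithm bounds this by log
det(1 + C/λ) plus the average of ‖(C + λ)^(-1/2) w(x_t)‖², both O(L λ^(-1/a)) under the eigenvalue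
decay. No comparison of C_z with C is needed here, so only one factor L appears; the L² bound spends
a second one in C ≤ K L (C_z + λ).

Bias. Each component of f* is C^r ξ, so (C_z + λ)^τ (1 - C_z g(C_z)) C^r should have norm ≲ √L
λ^(r+τ). Write r = m + ρ with m an integer and 0 < ρ ≤ 1. The Heinz inequality replaces C^ρ by (C_z
+ λ)^ρ, the m integer powers of C are exchanged for powers of C_z one at a time at the cost of ‖C -
C_z‖ ≲ √(L/n), and the qualification bounds what remains.

Balance. The choice of λ means 1/n = λ^(2r + 1 + 1/a), so the squared bias and the variance λ^(2τ-1)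
λ^(-1/a) / n are both of order λ^(2r+2τ). All of this is deterministic on a typical sample, and a
sample fails to be typical with probability at most 6 exp(-L) = δ. -/

namespace CovShift

/-! ### Iterated potentials over independent steps -/

section Fold

/-- The state reached from `s` after processing `z 0, …, z (n - 1)` with `step`. -/
def seqFold {S Z : Type*} (step : S → Z → S) : (n : ℕ) → S → (Fin n → Z) → S
  | 0, s, _ => s
  | n + 1, s, z => seqFold step n (step s (z 0)) (fun i => z i.succ)

theorem seqFold_add {Z K : Type*} [AddCommMonoid K] (X : Z → K) :
    ∀ (n : ℕ) (s : K) (z : Fin n → Z),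
      seqFold (fun s z => s + X z) n s z = s + ∑ i, X (z i)
  | 0, s, z => by simp [seqFold]
  | n + 1, s, z => by
      rw [seqFold, seqFold_add X n, Fin.sum_univ_succ, add_assoc]

variable {Z : Type*} [MeasurableSpace Z]

theorem lintegral_pi_succ (μ : Measure Z) [IsProbabilityMeasure μ] (n : ℕ)
    {f : (Fin (n + 1) → Z) → ENNReal} (hf : Measurable f) :
    ∫⁻ z, f z ∂Measure.pi (fun _ : Fin (n + 1) => μ) =
      ∫⁻ z₀, ∫⁻ w, f (Fin.cons z₀ w) ∂Measure.pi (fun _ : Fin n => μ) ∂μ := by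
  have h := (measurePreserving_piFinSuccAbove (fun _ : Fin (n + 1) => μ) 0).symm
  rw [← h.lintegral_comp hf, lintegral_prod]
  · simp [MeasurableEquiv.piFinSuccAbove_symm_apply, Fin.insertNthEquiv]
  · exact (hf.comp (MeasurableEquiv.measurable _)).aemeasurable

/-- If one step multiplies the expected value of `Φ` by at most `c`, then `n` independent steps
multiply it by at most `c ^ n`. -/
theorem lintegral_seqFold_le {S : Type*} (μ : Measure Z) [IsProbabilityMeasure μ]
    (step : S → Z → S) (Inv : S → Prop) (hInv : ∀ s z, Inv s → Inv (step s z))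
    (Φ : S → ENNReal) (c : ENNReal)
    (hmeas : ∀ n s, Inv s → Measurable fun z : Fin n → Z => Φ (seqFold step n s z))
    (hstep : ∀ s, Inv s → ∫⁻ z, Φ (step s z) ∂μ ≤ c * Φ s) :
    ∀ n s, Inv s → ∫⁻ z, Φ (seqFold step n s z) ∂Measure.pi (fun _ : Fin n => μ) ≤ c ^ n * Φ s
  | 0, s, _ => by simp [seqFold]
  | n + 1, s, hs => by
      rw [lintegral_pi_succ μ n (hmeas (n + 1) s hs)]
      have hm1 : Measurable fun z => Φ (step s z) := by
        have := (hmeas 1 s hs).comp (measurable_pi_lambda (fun z (_ : Fin 1) => z)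
          (fun _ => measurable_id))
        simpa [seqFold, Function.comp_def] using this
      calc _ ≤ ∫⁻ z₀, c ^ n * Φ (step s z₀) ∂μ := by
            refine lintegral_mono fun z₀ => ?_
            simpa [seqFold] using lintegral_seqFold_le μ step Inv hInv Φ c hmeas hstep n
              (step s z₀) (hInv s z₀ hs)
        _ ≤ c ^ n * (c * Φ s) := by
            rw [lintegral_const_mul _ hm1]
            gcongr
            exact hstep s hs
        _ = c ^ (n + 1) * Φ s := by ring

end Fold

/-! ### Bernstein's inequality in Hilbert space by Pinelis' cosh method -/

section Pinelis

/-- The series cosh √w = ∑ wⁿ / (2n)! has nonnegative coefficients, and each wⁿ is convex on [0, ∞).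
-/
theorem convexOn_cosh_sqrt : ConvexOn ℝ (Set.Ici 0) fun w : ℝ => Real.cosh √w := by
  have hs : ∀ w : ℝ, 0 ≤ w → HasSum (fun n : ℕ => w ^ n / ((2 * n).factorial : ℝ))
      (Real.cosh √w) := by
    intro w hw
    have := Real.hasSum_cosh √w
    simpa [pow_mul, Real.sq_sqrt hw] using this
  refine ⟨convex_Ici 0, fun x hx y hy a b ha hb hab => ?_⟩
  have hx : 0 ≤ x := hx
  have hy : 0 ≤ y := hy
  have hz : 0 ≤ a • x + b • y := by simp only [smul_eq_mul]; positivity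
  refine hasSum_le (fun n => ?_) (hs _ hz)
    (((hs x hx).mul_left a).add ((hs y hy).mul_left b))
  have := (convexOn_pow n).2 (Set.mem_Ici.2 hx) (Set.mem_Ici.2 hy) ha hb hab
  simp only [smul_eq_mul] at this ⊢
  calc _ ≤ (a * x ^ n + b * y ^ n) / ((2 * n).factorial : ℝ) := by gcongr
    _ = _ := by ring

theorem le_sinh_self {h : ℝ} (hh : 0 ≤ h) : h ≤ Real.sinh h := by
  exact Real.self_le_sinh_iff.2 hh

variable {K : Type*} [NormedAddCommGroup K] [InnerProductSpace ℝ K]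

/-- The coefficient `c(s) s` with which `cosh ‖s + x‖` is linearised at `s`. -/
def coshGrad (s : K) : K := (Real.sinh ‖s‖ / ‖s‖) • s

/-- With c the cosine of the angle between s and x, ‖s + x‖² is the convex combination of (‖s‖ -
‖x‖)² and (‖s‖ + ‖x‖)² with weights (1 ∓ c)/2. Convexity of cosh √w and the addition formulas give
cosh ‖s‖ cosh ‖x‖ + c sinh ‖s‖ sinh ‖x‖. The part of the last term linear in ‖x‖ is the inner
product; the excess sinh ‖x‖ - ‖x‖ goes into the remainder because c sinh ‖s‖ ≤ cosh ‖s‖. -/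
theorem cosh_norm_add_le (s x : K) :
    Real.cosh ‖s + x‖ ≤ Real.cosh ‖s‖ + inner ℝ (coshGrad s) x +
      Real.cosh ‖s‖ * (Real.exp ‖x‖ - 1 - ‖x‖) := by
  set p := ‖s‖ with hp
  set h := ‖x‖ with hh
  have hp0 : 0 ≤ p := norm_nonneg s
  have hh0 : 0 ≤ h := norm_nonneg x
  have hexp : Real.exp h = Real.cosh h + Real.sinh h := (Real.cosh_add_sinh h).symm
  have hsh : h ≤ Real.sinh h := le_sinh_self hh0
  have hsp : 0 ≤ Real.sinh p := Real.sinh_nonneg_iff.2 hp0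
  have hcp : 0 ≤ Real.cosh p := (Real.cosh_pos p).le
  by_cases hph : p * h = 0
  · rcases mul_eq_zero.1 hph with h0 | h0
    · have : s = 0 := norm_eq_zero.1 (hp ▸ h0)
      subst this
      simp only [zero_add, ← hh, h0, Real.cosh_zero, coshGrad, smul_zero, inner_zero_left]
      rw [hexp]; linarith
    · have : x = 0 := norm_eq_zero.1 (hh ▸ h0)
      subst this
      simp [h0, ← hp]
  have hp1 : 0 < p := lt_of_le_of_ne hp0 fun h => hph (by rw [← h]; simp)
  have hh1 : 0 < h := lt_of_le_of_ne hh0 fun h => hph (by rw [← h]; simp)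
  set c := inner ℝ s x / (p * h) with hc
  have hcabs : |c| ≤ 1 := by
    rw [hc, abs_div, abs_of_pos (mul_pos hp1 hh1)]
    exact div_le_one_of_le₀ (abs_real_inner_le_norm s x) (by positivity)
  obtain ⟨hc1, hc2⟩ := abs_le.1 hcabs
  have hin : inner ℝ s x = p * h * c := by rw [hc]; field_simp
  have hsq : ‖s + x‖ ^ 2 = (1 - c) / 2 * (p - h) ^ 2 + (1 + c) / 2 * (p + h) ^ 2 := by
    rw [norm_add_sq_real, hin]; ring
  have hconv := convexOn_cosh_sqrt.2 (Set.mem_Ici.2 (sq_nonneg (p - h)))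
    (Set.mem_Ici.2 (sq_nonneg (p + h))) (by linarith : 0 ≤ (1 - c) / 2)
    (by linarith : 0 ≤ (1 + c) / 2) (by ring)
  simp only [smul_eq_mul, ← hsq, Real.sqrt_sq (norm_nonneg (s + x)), Real.sqrt_sq_eq_abs,
    Real.cosh_abs] at hconv
  rw [Real.cosh_add, Real.cosh_sub] at hconv
  have hg : inner ℝ (coshGrad s) x = Real.sinh p * h * c := by
    rw [coshGrad, real_inner_smul_left, hin, ← hp]; field_simp
  rw [hg, hexp]
  have key : c * Real.sinh p * (Real.sinh h - h) ≤ Real.cosh p * (Real.sinh h - h) := by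
    have : c * Real.sinh p ≤ Real.cosh p := by
      calc c * Real.sinh p ≤ 1 * Real.sinh p := by gcongr
        _ ≤ Real.cosh p := by rw [one_mul]; exact (Real.sinh_lt_cosh p).le
    exact mul_le_mul_of_nonneg_right this (by linarith)
  nlinarith [hconv, key]

theorem exp_sub_one_sub_le_sq {x : ℝ} (h0 : 0 ≤ x) (h1 : x ≤ 1) :
    Real.exp x - 1 - x ≤ x ^ 2 := by
  have := Real.abs_exp_sub_one_sub_id_le (x := x) (by rw [abs_of_nonneg h0]; exact h1)
  exact (le_abs_self _).trans this

variable [CompleteSpace K] {Z : Type*} [MeasurableSpace Z]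

/-- The linear term of `cosh_norm_add_le` integrates to zero, and exp x - 1 - x ≤ x² on [0, 1]
leaves the factor 1 + v ≤ exp v. -/
theorem lintegral_cosh_norm_add_le (μ : Measure Z) [IsProbabilityMeasure μ] {X : Z → K}
    (hX : StronglyMeasurable X) {R v : ℝ} (hR : ∀ z, ‖X z‖ ≤ R) (hR1 : R ≤ 1)
    (h0 : ∫ z, X z ∂μ = 0) (hv : ∫ z, ‖X z‖ ^ 2 ∂μ ≤ v) (s : K) :
    ∫⁻ z, ENNReal.ofReal (Real.cosh ‖s + X z‖) ∂μ ≤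
      ENNReal.ofReal (Real.exp v) * ENNReal.ofReal (Real.cosh ‖s‖) := by
  have hXint : Integrable X μ :=
    Integrable.of_bound hX.aestronglyMeasurable R (Filter.Eventually.of_forall hR)
  have hX2 : Integrable (fun z => ‖X z‖ ^ 2) μ := by
    refine Integrable.of_bound (hX.norm.pow 2).aestronglyMeasurable (R ^ 2)
      (Filter.Eventually.of_forall fun z => ?_)
    rw [Real.norm_of_nonneg (by positivity)]
    exact pow_le_pow_left₀ (norm_nonneg _) (hR z) 2
  have hin : Integrable (fun z => inner ℝ (coshGrad s) (X z)) μ := hXint.const_inner _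
  have hbd : ∀ z, Real.cosh ‖s + X z‖ ≤
      Real.cosh ‖s‖ + inner ℝ (coshGrad s) (X z) + Real.cosh ‖s‖ * ‖X z‖ ^ 2 := by
    intro z
    refine (cosh_norm_add_le s (X z)).trans ?_
    have := exp_sub_one_sub_le_sq (norm_nonneg (X z)) ((hR z).trans hR1)
    have := mul_le_mul_of_nonneg_left this (Real.cosh_pos ‖s‖).le
    linarith
  have hint : Integrable (fun z => Real.cosh ‖s‖ + inner ℝ (coshGrad s) (X z) +
      Real.cosh ‖s‖ * ‖X z‖ ^ 2) μ := ((integrable_const _).add hin).add (hX2.const_mul _)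
  calc _ ≤ ∫⁻ z, ENNReal.ofReal (Real.cosh ‖s‖ + inner ℝ (coshGrad s) (X z) +
        Real.cosh ‖s‖ * ‖X z‖ ^ 2) ∂μ :=
        lintegral_mono fun z => ENNReal.ofReal_le_ofReal (hbd z)
    _ = ENNReal.ofReal (Real.cosh ‖s‖ * (1 + ∫ z, ‖X z‖ ^ 2 ∂μ)) := by
        rw [← ofReal_integral_eq_lintegral_ofReal hint
          (Filter.Eventually.of_forall fun z => (Real.cosh_pos _).le.trans (hbd z))]
        have e1 := integral_add (f := fun z => Real.cosh ‖s‖ + inner ℝ (coshGrad s) (X z))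
          ((integrable_const _).add hin) (hX2.const_mul (Real.cosh ‖s‖))
        have e2 := integral_add (μ := μ) (integrable_const (Real.cosh ‖s‖)) hin
        rw [e1, e2, integral_const_mul, integral_inner hXint, h0]
        simp
        ring_nf
    _ ≤ ENNReal.ofReal (Real.exp v * Real.cosh ‖s‖) := by
        refine ENNReal.ofReal_le_ofReal ?_
        rw [mul_comm]
        refine mul_le_mul_of_nonneg_right ?_ (Real.cosh_pos _).le
        linarith [Real.add_one_le_exp v]
    _ = _ := ENNReal.ofReal_mul (Real.exp_pos _).le

/-- Bernstein's inequality in a Hilbert space. -/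
theorem measure_norm_sum_ge_le (μ : Measure Z) [IsProbabilityMeasure μ] {X : Z → K}
    (hX : StronglyMeasurable X) {R v : ℝ} (hR : ∀ z, ‖X z‖ ≤ R)
    (h0 : ∫ z, X z ∂μ = 0) (hv : ∫ z, ‖X z‖ ^ 2 ∂μ ≤ v) {θ : ℝ} (hθ : 0 ≤ θ) (hθR : θ * R ≤ 1)
    (n : ℕ) (t : ℝ) :
    Measure.pi (fun _ : Fin n => μ) {z | t ≤ ‖∑ i, X (z i)‖} ≤
      ENNReal.ofReal (2 * Real.exp (-(θ * t) + n * θ ^ 2 * v)) := by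
  have hX' : StronglyMeasurable fun z => θ • X z := hX.const_smul θ
  have hmX : ∀ (n : ℕ) (s : K), StronglyMeasurable fun z : Fin n → Z =>
      s + ∑ i, θ • X (z i) := fun n s =>
    stronglyMeasurable_const.add (Finset.stronglyMeasurable_fun_sum _ fun i _ =>
      hX'.comp_measurable (measurable_pi_apply i))
  have hmeas : ∀ (n : ℕ) (s : K), Measurable fun z : Fin n → Z =>
      ENNReal.ofReal (Real.cosh ‖s + ∑ i, θ • X (z i)‖) := fun n s =>
    (Real.measurable_cosh.comp (hmX n s).norm.measurable).ennreal_ofReal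
  have hfold := lintegral_seqFold_le μ (fun s z => s + θ • X z) (fun _ : K => True)
    (fun _ _ _ => trivial) (fun s => ENNReal.ofReal (Real.cosh ‖s‖))
    (ENNReal.ofReal (Real.exp (θ ^ 2 * v)))
    (fun n s _ => by
      simp_rw [seqFold_add (fun z => θ • X z)]
      exact hmeas n s)
    (fun s _ => lintegral_cosh_norm_add_le μ hX' (R := θ * R)
      (fun z => by
        rw [norm_smul, Real.norm_of_nonneg hθ]; exact mul_le_mul_of_nonneg_left (hR z) hθ) hθR
      (by rw [integral_smul, h0, smul_zero])
      (by
        simp_rw [norm_smul, mul_pow, Real.norm_eq_abs, sq_abs]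
        rw [integral_const_mul]
        exact mul_le_mul_of_nonneg_left hv (sq_nonneg θ)) s) n 0 trivial
  simp_rw [seqFold_add (fun z => θ • X z)] at hfold
  -- Markov's inequality is applied to cosh u ≥ exp(u)/2, whence the factor 2 in the tail bound.
  set ε := ENNReal.ofReal (Real.exp (θ * t) / 2)
  have hε0 : 0 < Real.exp (θ * t) / 2 := by positivity
  have hsub : {z : Fin n → Z | t ≤ ‖∑ i, X (z i)‖} ⊆
      {z | ε ≤ ENNReal.ofReal (Real.cosh ‖(0 : K) + ∑ i, θ • X (z i)‖)} := by
    intro z hz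
    refine ENNReal.ofReal_le_ofReal ?_
    rw [zero_add, ← Finset.smul_sum, norm_smul, Real.norm_of_nonneg hθ, Real.cosh_eq]
    have : Real.exp (θ * t) ≤ Real.exp (θ * ‖∑ i, X (z i)‖) :=
      Real.exp_le_exp.2 (mul_le_mul_of_nonneg_left hz hθ)
    have := Real.exp_pos (-(θ * ‖∑ i, X (z i)‖))
    linarith
  refine (measure_mono hsub).trans ?_
  refine (meas_ge_le_lintegral_div (hmeas n 0).aemeasurable
    (ENNReal.ofReal_pos.2 hε0).ne' ENNReal.ofReal_ne_top).trans ?_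
  refine (ENNReal.div_le_div_right hfold _).trans ?_
  rw [norm_zero, Real.cosh_zero, ENNReal.ofReal_one, mul_one, ← ENNReal.ofReal_pow
    (Real.exp_pos _).le, ← ENNReal.ofReal_div_of_pos hε0]
  refine ENNReal.ofReal_le_ofReal (le_of_eq ?_)
  rw [← Real.exp_nat_mul, Real.exp_add, Real.exp_neg]
  field_simp

end Pinelis

/-! ### Operators diagonal in a Hilbert basis, and the Heinz inequality -/

section Diag

variable {H : Type*} [NormedAddCommGroup H] [InnerProductSpace ℝ H]

theorem countable_of_hilbertBasis [TopologicalSpace.SeparableSpace H] {ι : Type*}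
    (e : HilbertBasis ι ℝ H) : Countable ι := by
  have hdist : ∀ i j, i ≠ j → 1 < dist (e i) (e j) := by
    intro i j hij
    have h := e.orthonormal
    have h2 : dist (e i) (e j) ^ 2 = 2 := by
      rw [dist_eq_norm, norm_sub_sq_real, h.1, h.1, h.2 hij]; norm_num
    nlinarith [dist_nonneg (x := e i) (y := e j)]
  have := Set.PairwiseDisjoint.countable_of_isOpen (s := fun i => Metric.ball (e i) (1 / 2))
    (a := (Set.univ : Set ι))
    (fun i _ j _ hij => Metric.ball_disjoint_ball (by linarith [hdist i j hij]))
    (fun i _ => Metric.isOpen_ball) (fun i _ => ⟨e i, by simp⟩)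
  exact Set.countable_univ_iff.1 this

/-- `T` is diagonal in the Hilbert basis `e`, with diagonal `d`. -/
def IsDiag {ι : Type*} (e : HilbertBasis ι ℝ H) (d : ι → ℝ) (T : H →L[ℝ] H) : Prop :=
  ∀ i v, inner ℝ (e i) (T v) = d i * inner ℝ (e i) v

variable {ι : Type*} {e : HilbertBasis ι ℝ H}

theorem ext_inner_hilbertBasis (e : HilbertBasis ι ℝ H) {v w : H}
    (h : ∀ i, inner ℝ (e i) v = inner ℝ (e i) w) : v = w := by
  apply e.repr.injective
  ext i
  rw [e.repr_apply_apply, e.repr_apply_apply, h]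

theorem hasSum_inner_sq (e : HilbertBasis ι ℝ H) (v : H) :
    HasSum (fun i => inner ℝ (e i) v ^ 2) (‖v‖ ^ 2) := by
  have := e.hasSum_inner_mul_inner v v
  rw [real_inner_self_eq_norm_sq] at this
  refine this.congr_fun fun i => ?_
  rw [real_inner_comm v, sq]

/-- Powers, square roots and inverse square roots of C and C_z are all produced in this way from
their diagonals. -/
theorem exists_isDiag (e : HilbertBasis ι ℝ H) (d : ι → ℝ) {K : ℝ} (hK : ∀ i, |d i| ≤ K) :
    ∃ T : H →L[ℝ] H, IsDiag e d T := by
  have hmem : ∀ v : H, Memℓp (fun i => d i * inner ℝ (e i) v) 2 := by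
    intro v
    refine memℓp_gen ?_
    simp only [ENNReal.toReal_ofNat, Real.rpow_two, Real.norm_eq_abs, sq_abs, mul_pow]
    refine ((hasSum_inner_sq e v).summable.mul_left (K ^ 2)).of_nonneg_of_le
      (fun i => by positivity) fun i => ?_
    refine mul_le_mul_of_nonneg_right ?_ (sq_nonneg _)
    rw [← sq_abs]
    exact pow_le_pow_left₀ (abs_nonneg _) (hK i) 2
  let f : H → H := fun v => e.repr.symm ⟨_, hmem v⟩
  have hf : ∀ i v, inner ℝ (e i) (f v) = d i * inner ℝ (e i) v := by
    intro i v
    rw [← e.repr_apply_apply]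
    simp [f]
  let L : H →ₗ[ℝ] H :=
    { toFun := f
      map_add' := fun v w => ext_inner_hilbertBasis e fun i => by
        rw [hf, inner_add_right, inner_add_right, hf, hf]; ring
      map_smul' := fun c v => ext_inner_hilbertBasis e fun i => by
        rw [hf, inner_smul_right, RingHom.id_apply, inner_smul_right, hf]; ring }
  refine ⟨L.mkContinuous |K| fun v => ?_, hf⟩
  refine abs_le_of_sq_le_sq' ?_ (by positivity) |>.2
  rw [mul_pow, sq_abs]
  refine hasSum_le (fun i => ?_) (hasSum_inner_sq e (L v)) ((hasSum_inner_sq e v).mul_left (K ^ 2))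
  change inner ℝ (e i) (f v) ^ 2 ≤ _
  rw [hf, mul_pow]
  refine mul_le_mul_of_nonneg_right ?_ (sq_nonneg _)
  rw [← sq_abs]
  exact pow_le_pow_left₀ (abs_nonneg _) (hK i) 2

namespace IsDiag

variable {d d' : ι → ℝ} {T T' : H →L[ℝ] H}

theorem hasSum_sq (h : IsDiag e d T) (v : H) :
    HasSum (fun i => d i ^ 2 * inner ℝ (e i) v ^ 2) (‖T v‖ ^ 2) := by
  refine (hasSum_inner_sq e (T v)).congr_fun fun i => ?_
  rw [h, mul_pow]

theorem inner_left (h : IsDiag e d T) (v w : H) : inner ℝ (T v) w = inner ℝ v (T w) := by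
  have h1 := e.hasSum_inner_mul_inner (T v) w
  have h2 := e.hasSum_inner_mul_inner v (T w)
  refine h1.unique (h2.congr_fun fun i => ?_)
  rw [h, real_inner_comm, h, real_inner_comm v]; ring

theorem hasSum_inner (h : IsDiag e d T) (v : H) :
    HasSum (fun i => d i * inner ℝ (e i) v ^ 2) (inner ℝ (T v) v) := by
  rw [h.inner_left]
  refine (e.hasSum_inner_mul_inner v (T v)).congr_fun fun i => ?_
  rw [h, real_inner_comm v]; ring

theorem apply_basis (h : IsDiag e d T) (i : ι) : T (e i) = d i • e i := by
  classical
  refine ext_inner_hilbertBasis e fun j => ?_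
  rw [h, inner_smul_right, orthonormal_iff_ite.1 e.orthonormal]
  split_ifs with hij
  · rw [hij]
  · simp

theorem of_apply_basis (hT : ∀ v w, inner ℝ (T v) w = inner ℝ v (T w))
    (h : ∀ i, T (e i) = d i • e i) : IsDiag e d T := fun i v => by
  rw [← hT, h, real_inner_smul_left]

theorem norm_le_norm (h : IsDiag e d T) (h' : IsDiag e d' T') {K : ℝ} (hK : 0 ≤ K)
    (hd : ∀ i, |d i| ≤ K * |d' i|) (v : H) : ‖T v‖ ≤ K * ‖T' v‖ := by
  refine abs_le_of_sq_le_sq' ?_ (by positivity) |>.2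
  rw [mul_pow]
  refine hasSum_le (fun i => ?_) (h.hasSum_sq v) ((h'.hasSum_sq v).mul_left (K ^ 2))
  rw [← mul_assoc, ← mul_pow K]
  refine mul_le_mul_of_nonneg_right ?_ (sq_nonneg (inner ℝ (e i) v))
  rw [← sq_abs, ← sq_abs (K * d' i), abs_mul, abs_of_nonneg hK]
  exact pow_le_pow_left₀ (abs_nonneg _) (hd i) 2

theorem norm_le (h : IsDiag e d T) {K : ℝ} (hK : 0 ≤ K) (hd : ∀ i, |d i| ≤ K) (v : H) :
    ‖T v‖ ≤ K * ‖v‖ := by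
  have h1 : IsDiag e (fun _ => (1 : ℝ)) (ContinuousLinearMap.id ℝ H) := fun i v => by simp
  have hd' : ∀ i, |d i| ≤ K * |(1 : ℝ)| := fun i => by simpa using hd i
  simpa using h.norm_le_norm h1 hK hd' v

theorem comp (h : IsDiag e d T) (h' : IsDiag e d' T') :
    IsDiag e (fun i => d i * d' i) (T ∘L T') := fun i v => by
  rw [ContinuousLinearMap.comp_apply, h, h', mul_assoc]

theorem add_smul_id (h : IsDiag e d T) (c : ℝ) :
    IsDiag e (fun i => d i + c) (T + c • ContinuousLinearMap.id ℝ H) := fun i v => by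
  simp only [add_apply, smul_apply,
    ContinuousLinearMap.id_apply, inner_add_right, inner_smul_right, h i v]
  ring

theorem eq_of_eq (h : IsDiag e d T) (h' : IsDiag e d' T') (hd : ∀ i, d i = d' i) (v : H) :
    T v = T' v := ext_inner_hilbertBasis e fun i => by rw [h, h', hd]

end IsDiag

theorem summable_resolvent (e : HilbertBasis ι ℝ H) (a : ι → ℝ) {s : ℝ} (hs : 0 < s) (v : H) :
    Summable fun i => a i ^ 2 / (s + a i ^ 2) * inner ℝ (e i) v ^ 2 := by
  refine (hasSum_inner_sq e v).summable.of_nonneg_of_le (fun i => by positivity) fun i => ?_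
  exact mul_le_of_le_one_left (sq_nonneg _) (div_le_one_of_le₀ (by linarith) (by positivity))

/-- The variational formula for `⟨A² (A² + s)⁻¹ v, v⟩` shows that it is monotone in `A²`. -/
theorem tsum_resolvent_le {ι' : Type*} {e' : HilbertBasis ι' ℝ H} {a : ι → ℝ} {b : ι' → ℝ}
    {A B : H →L[ℝ] H} (hA : IsDiag e a A) (hB : IsDiag e' b B)
    (hAB : ∀ v, ‖A v‖ ≤ ‖B v‖) {s : ℝ} (hs : 0 < s) (v : H) :
    ∑' i, a i ^ 2 / (s + a i ^ 2) * inner ℝ (e i) v ^ 2 ≤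
      ∑' j, b j ^ 2 / (s + b j ^ 2) * inner ℝ (e' j) v ^ 2 := by
  have hle1 : ∀ x : ℝ, |x ^ 2 / (s + x ^ 2)| ≤ 1 := fun x => by
    rw [abs_of_nonneg (by positivity)]
    exact div_le_one_of_le₀ (by linarith) (by positivity)
  -- The formula is s⟨B²(B² + s)⁻¹v, v⟩ = min over y of ‖B(v - y)‖² + s‖y‖², attained at y = B²(B² +
  -- s)⁻¹v. The same y is a competitor in the problem for A.
  obtain ⟨P, hP⟩ := exists_isDiag e' (fun j => b j ^ 2 / (s + b j ^ 2)) (fun j => hle1 (b j))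
  set y := P v with hy
  have hsA : HasSum (fun i => s * (a i ^ 2 / (s + a i ^ 2) * inner ℝ (e i) v ^ 2))
      (s * ∑' i, a i ^ 2 / (s + a i ^ 2) * inner ℝ (e i) v ^ 2) := 
    (summable_resolvent e a hs v).hasSum.mul_left s
  have hsB : HasSum (fun j => s * (b j ^ 2 / (s + b j ^ 2) * inner ℝ (e' j) v ^ 2))
      (s * ∑' j, b j ^ 2 / (s + b j ^ 2) * inner ℝ (e' j) v ^ 2) :=
    (summable_resolvent e' b hs v).hasSum.mul_left s
  have hterm : ∀ i, s * (a i ^ 2 / (s + a i ^ 2) * inner ℝ (e i) v ^ 2) ≤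
      a i ^ 2 * inner ℝ (e i) (v - y) ^ 2 + s * inner ℝ (e i) y ^ 2 := fun i => by
      rw [inner_sub_right]
      have hpos : 0 < s + a i ^ 2 := by positivity
      have : a i ^ 2 * (inner ℝ (e i) v - inner ℝ (e i) y) ^ 2 + s * inner ℝ (e i) y ^ 2 -
          s * (a i ^ 2 / (s + a i ^ 2) * inner ℝ (e i) v ^ 2) =
          ((s + a i ^ 2) * inner ℝ (e i) y - a i ^ 2 * inner ℝ (e i) v) ^ 2 / (s + a i ^ 2) := by
        field_simp; ring
      have h3 : 0 ≤ ((s + a i ^ 2) * inner ℝ (e i) y - a i ^ 2 * inner ℝ (e i) v) ^ 2 /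
        (s + a i ^ 2) := by positivity
      linarith
  have h1 := hasSum_le hterm hsA
    ((hA.hasSum_sq (v - y)).add ((hasSum_inner_sq e y).mul_left s))
  have h2 : HasSum (fun j => s * (b j ^ 2 / (s + b j ^ 2) * inner ℝ (e' j) v ^ 2))
      (‖B (v - y)‖ ^ 2 + s * ‖y‖ ^ 2) := by
    refine ((hB.hasSum_sq (v - y)).add ((hasSum_inner_sq e' y).mul_left s)).congr_fun fun j => ?_
    have hpos : 0 < s + b j ^ 2 := by positivity
    rw [inner_sub_right, hy, hP]
    field_simp
    ring
  have h3 : ‖A (v - y)‖ ^ 2 ≤ ‖B (v - y)‖ ^ 2 := pow_le_pow_left₀ (norm_nonneg _) (hAB _) 2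
  have h4 := h2.unique hsB
  have : s * ∑' i, a i ^ 2 / (s + a i ^ 2) * inner ℝ (e i) v ^ 2 ≤
      s * ∑' j, b j ^ 2 / (s + b j ^ 2) * inner ℝ (e' j) v ^ 2 := by linarith
  exact le_of_mul_le_mul_left this hs

/-- The integral representation of x ↦ x^θ, 0 < θ < 1, is applied to x = c_i² and summed over i by
Tonelli. It writes ‖T v‖² as a positive superposition of the resolvent forms compared in
`tsum_resolvent_le`, which is all that Heinz needs. -/
theorem ofReal_norm_rpow_sq [Countable ι] {f : HilbertBasis ι ℝ H} {c : ι → ℝ} {T : H →L[ℝ] H}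
    {θ : ℝ} (hθ0 : 0 < θ) (hθ1 : θ < 1) (hc : ∀ i, 0 ≤ c i)
    (hT : IsDiag f (fun i => c i ^ θ) T) {m : Measure ℝ}
    (hm : ∀ x ∈ Set.Ici (0 : ℝ), IntegrableOn (fun t => θ.rpowIntegrand₀₁ t x) (Set.Ioi 0) m ∧
      x ^ θ = ∫ t in Set.Ioi 0, θ.rpowIntegrand₀₁ t x ∂m) (v : H) :
    ENNReal.ofReal (‖T v‖ ^ 2) = ∫⁻ t in Set.Ioi 0, ENNReal.ofReal (t ^ (θ - 1) *
      ∑' i, c i ^ 2 / (t + c i ^ 2) * inner ℝ (f i) v ^ 2) ∂m := by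
  have hcongr : ∀ t ∈ Set.Ioi (0 : ℝ), ENNReal.ofReal (t ^ (θ - 1) *
      ∑' i, c i ^ 2 / (t + c i ^ 2) * inner ℝ (f i) v ^ 2) =
      ∑' i, ENNReal.ofReal (Real.rpowIntegrand₀₁ θ t (c i ^ 2)) *
        ENNReal.ofReal (inner ℝ (f i) v ^ 2) := by
    intro t ht
    have ht : 0 < t := ht
    have hsm := summable_resolvent f c ht v
    rw [← tsum_mul_left, ENNReal.ofReal_tsum_of_nonneg (fun i => by positivity)
      (hsm.mul_left _)]
    refine tsum_congr fun i => ?_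
    rw [← ENNReal.ofReal_mul (Real.rpowIntegrand₀₁_nonneg hθ0 ht.le (sq_nonneg _)),
      Real.rpowIntegrand₀₁_eq_pow_div ⟨hθ0, hθ1⟩ ht.le (sq_nonneg _)]
    congr 1
    ring
  rw [setLIntegral_congr_fun measurableSet_Ioi hcongr, lintegral_tsum, ← (hT.hasSum_sq v).tsum_eq,
    ENNReal.ofReal_tsum_of_nonneg (fun i => by positivity) (hT.hasSum_sq v).summable]
  · refine tsum_congr fun i => ?_
    obtain ⟨hint, heq⟩ := hm (c i ^ 2) (sq_nonneg (c i))
    rw [lintegral_mul_const'' _ hint.aestronglyMeasurable.aemeasurable.ennreal_ofReal,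
      ← ofReal_integral_eq_lintegral_ofReal hint, ← heq, ← ENNReal.ofReal_mul (by positivity)]
    · congr 2
      rw [← Real.rpow_natCast, ← Real.rpow_natCast, ← Real.rpow_mul (hc i),
        ← Real.rpow_mul (hc i), mul_comm]
    · filter_upwards [ae_restrict_mem measurableSet_Ioi] with t ht
      exact Real.rpowIntegrand₀₁_nonneg hθ0 (le_of_lt ht) (sq_nonneg _)
  · intro i
    obtain ⟨hint, -⟩ := hm (c i ^ 2) (sq_nonneg (c i))
    exact hint.aestronglyMeasurable.aemeasurable.ennreal_ofReal.mul_const _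

/-- The Heinz inequality for operators that are diagonal in Hilbert bases. -/
theorem norm_rpow_le_norm_rpow [TopologicalSpace.SeparableSpace H] {ι' : Type*}
    {e' : HilbertBasis ι' ℝ H} {a : ι → ℝ} {b : ι' → ℝ} {A B A' B' : H →L[ℝ] H} {θ : ℝ}
    (hθ0 : 0 < θ) (hθ1 : θ ≤ 1) (ha : ∀ i, 0 ≤ a i) (hb : ∀ j, 0 ≤ b j)
    (hA : IsDiag e a A) (hB : IsDiag e' b B)
    (hA' : IsDiag e (fun i => a i ^ θ) A') (hB' : IsDiag e' (fun j => b j ^ θ) B')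
    (hAB : ∀ v, ‖A v‖ ≤ ‖B v‖) (v : H) : ‖A' v‖ ≤ ‖B' v‖ := by
  rcases hθ1.eq_or_lt with rfl | hθ1
  · rw [hA'.eq_of_eq hA (by simp), hB'.eq_of_eq hB (by simp)]; exact hAB v
  have := countable_of_hilbertBasis e
  have := countable_of_hilbertBasis e'
  obtain ⟨m, hm⟩ := Real.exists_measure_rpow_eq_integral_rpowIntegrand₀₁
    (Set.mem_Ioo.2 ⟨hθ0, hθ1⟩)
  have hle : ENNReal.ofReal (‖A' v‖ ^ 2) ≤ ENNReal.ofReal (‖B' v‖ ^ 2) := by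
    rw [ofReal_norm_rpow_sq hθ0 hθ1 ha hA' hm, ofReal_norm_rpow_sq hθ0 hθ1 hb hB' hm]
    refine setLIntegral_mono' measurableSet_Ioi fun t ht => ENNReal.ofReal_le_ofReal ?_
    exact mul_le_mul_of_nonneg_left (tsum_resolvent_le hA hB hAB ht v)
      (Real.rpow_nonneg (le_of_lt ht) _)
  rw [ENNReal.ofReal_le_ofReal_iff (by positivity)] at hle
  exact abs_le_of_sq_le_sq' hle (norm_nonneg _) |>.2

end Diag

/-! ### Evaluation of `spectralFun` on eigenvectors -/

section Spectral

variable {E : Type*} [NormedAddCommGroup E] [InnerProductSpace ℝ E] [CompleteSpace E]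

/-- By symmetry the eigenspaces of all other eigenvalues are orthogonal to v, so one term survives.
Summability is an assumption because a divergent `tsum` has the default value 0. -/
theorem inner_spectralFun {g : ℝ → ℝ} {T : E →L[ℝ] E}
    (hs : Summable fun σ : ℝ => g σ • (T - σ • ContinuousLinearMap.id ℝ E).ker.starProjection)
    (hT : ∀ v w, inner ℝ (T v) w = inner ℝ v (T w)) {v : E} {σ : ℝ} (hv : T v = σ • v) (x : E) :
    inner ℝ v (spectralFun g T x) = g σ * inner ℝ v x := by
  have hker : ∀ (τ : ℝ) (w : E), w ∈ (T - τ • ContinuousLinearMap.id ℝ E).ker ↔ T w = τ • w :=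
    fun τ w => by simp [sub_eq_zero]
  have h1 := (hs.hasSum.mapL (ContinuousLinearMap.apply ℝ E x)).mapL (innerSL ℝ v)
  refine h1.unique ?_
  have : HasSum (fun τ : ℝ => if τ = σ then g σ * inner ℝ v x else 0) (g σ * inner ℝ v x) := by
    simpa using hasSum_ite_eq σ (g σ * inner ℝ v x)
  refine this.congr_fun fun τ => ?_
  simp only [ContinuousLinearMap.apply_apply, smul_apply, innerSL_apply_apply,
    inner_smul_right]
  split_ifs with hτ
  · subst hτ
    rw [← Submodule.inner_starProjection_left_eq_right,
      Submodule.starProjection_eq_self_iff.2 ((hker τ v).2 hv)]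
  · have hmem := (hker τ _).1 (Submodule.starProjection_apply_mem
      (T - τ • ContinuousLinearMap.id ℝ E).ker x)
    have := hT v ((T - τ • ContinuousLinearMap.id ℝ E).ker.starProjection x)
    rw [hv, hmem, inner_smul_left, inner_smul_right] at this
    have h0 : (σ - τ) * inner ℝ v ((T - τ • ContinuousLinearMap.id ℝ E).ker.starProjection x)
        = 0 := by
      simp only [RCLike.conj_to_real] at this
      linarith
    rcases mul_eq_zero.1 h0 with h | h
    · exact absurd (sub_eq_zero.1 h).symm hτ
    · rw [h, mul_zero]

theorem summable_spectralFun {g : ℝ → ℝ} {T : E →L[ℝ] E} (s : Finset ℝ)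
    (hs : ∀ σ v, T v = σ • v → v ≠ 0 → σ ∈ s) :
    Summable fun σ : ℝ => g σ • (T - σ • ContinuousLinearMap.id ℝ E).ker.starProjection := by
  refine summable_of_ne_finset_zero (s := s) fun σ hσ => ?_
  have : (T - σ • ContinuousLinearMap.id ℝ E).ker = ⊥ := by
    refine (Submodule.eq_bot_iff _).2 fun v hv => by_contra fun h0 => hσ (hs σ v ?_ h0)
    simpa [sub_eq_zero] using hv
  have h0 : (T - σ • ContinuousLinearMap.id ℝ E).ker.starProjection = 0 := by
    ext x
    have hx := Submodule.starProjection_apply_mem (T - σ • ContinuousLinearMap.id ℝ E).ker x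
    exact (Submodule.eq_bot_iff _).1 this _ hx
  rw [h0, smul_zero]

end Spectral

/-! ### Finite rank operators and their determinants -/

section FiniteRank

variable {H : Type*} [NormedAddCommGroup H] [InnerProductSpace ℝ H]

/-- Matrix determinant lemma for a rank one update `v ↦ V v + ⟪w, v⟫ w`. -/
theorem det_add_rankOne {E : Type*} [NormedAddCommGroup E] [InnerProductSpace ℝ E]
    [FiniteDimensional ℝ E] {V V' : E →ₗ[ℝ] E} {w r : E} (hr : V r = w)
    (hV' : ∀ v, V' v = V v + inner ℝ w v • w) :
    LinearMap.det V' = LinearMap.det V * (1 + inner ℝ w r) := by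
  -- Since w = V r, the update factors as V (1 + ⟪w, ·⟫ r), and a transvection has determinant 1 +
  -- ⟪w, r⟫.
  have : V' = V ∘ₗ LinearMap.transvection (innerₛₗ ℝ w) r := by
    ext v
    simp [LinearMap.transvection, hV', hr]
  rw [this, LinearMap.det_comp, LinearMap.transvection.det]
  simp

/-- A finite rank operator `∑ w_t ⊗ w_t` is diagonal in a Hilbert basis, finitely many elements of
which span the range. -/
theorem exists_hilbertBasis_of_sum_rankOne [CompleteSpace H] {n : ℕ} (w : Fin n → H)
    (T : H →L[ℝ] H) (hT : ∀ v, T v = ∑ t, inner ℝ (w t) v • w t) (c : ℝ) :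
    ∃ (s : Set H) (e : HilbertBasis s ℝ H) (σ : s → ℝ) (F : Finset s),
      IsDiag e σ T ∧ (∀ i, 0 ≤ σ i) ∧ (∀ i ∉ F, σ i = 0) ∧
      Module.finrank ℝ (Submodule.span ℝ (Set.range w)) = F.card ∧
      ∀ V : Submodule.span ℝ (Set.range w) →ₗ[ℝ] Submodule.span ℝ (Set.range w),
        (∀ v, (V v : H) = c • (v : H) + T v) → LinearMap.det V = ∏ i ∈ F, (c + σ i) := by
  classical
  set E := Submodule.span ℝ (Set.range w) with hE
  have hfd : FiniteDimensional ℝ E := FiniteDimensional.span_of_finite ℝ (Set.finite_range w)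
  have hw : ∀ t, w t ∈ E := fun t => Submodule.subset_span ⟨t, rfl⟩
  have hTE : ∀ v, T v ∈ E := fun v => by
    rw [hT]; exact Submodule.sum_mem _ fun t _ => Submodule.smul_mem _ _ (hw t)
  have hTs : ∀ v v', inner ℝ (T v) v' = inner ℝ v (T v') := fun v v' => by
    simp only [hT, sum_inner, inner_sum, real_inner_smul_left, real_inner_smul_right]
    exact Finset.sum_congr rfl fun t _ => by rw [real_inner_comm v]; ring
  have hTp : ∀ v, 0 ≤ inner ℝ v (T v) := fun v => by
    simp only [hT, inner_sum, real_inner_smul_right]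
    exact Finset.sum_nonneg fun t _ => by rw [real_inner_comm v]; exact mul_self_nonneg _
  -- The span of the w_t is invariant under T; diagonalizing c + T there gives eigenvalues `a j`,
  -- and `a j - c` for T.
  let V₀ : E →ₗ[ℝ] E := c • LinearMap.id + (T.toLinearMap.codRestrict E hTE) ∘ₗ E.subtype
  have hV₀ : ∀ v : E, (V₀ v : H) = c • (v : H) + T v := fun v => rfl
  have hsymm : V₀.IsSymmetric := fun v v' => by
    rw [Submodule.coe_inner, Submodule.coe_inner, hV₀, hV₀, inner_add_left, inner_add_right,
      real_inner_smul_left, real_inner_smul_right, hTs]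
  set d := Module.finrank ℝ E with hd
  set b := hsymm.eigenvectorBasis hd.symm with hb
  set a := hsymm.eigenvalues hd.symm with ha
  have hbT : ∀ j, T (b j) = (a j - c) • (b j : H) := fun j => by
    have h1 : V₀ (b j) = a j • b j := hsymm.apply_eigenvectorBasis hd.symm j
    have h2 := congrArg (Subtype.val) h1
    rw [hV₀] at h2
    rw [sub_smul, ← Submodule.coe_smul, ← h1, hV₀]
    abel
  have hbon : Orthonormal ℝ fun j => (b j : H) :=
    b.orthonormal.comp_linearIsometry E.subtypeₗᵢ
  have hinj : Function.Injective fun j => (b j : H) := hbon.linearIndependent.injective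
  -- The added basis vectors are orthogonal to every w_t, so T annihilates them.
  obtain ⟨s, e, hs, he⟩ := (Orthonormal.exists_hilbertBasis_extension
    (s := Set.range fun j => (b j : H)) (𝕜 := ℝ)
    ((orthonormal_subtype_range hinj).2 hbon))
  let ι : Fin d → s := fun j => ⟨b j, hs ⟨j, rfl⟩⟩
  have hιinj : Function.Injective ι := fun i j hij => by
    have h : (ι i : H) = ι j := by rw [hij]
    exact hinj h
  have heι : ∀ j, e (ι j) = b j := fun j => by rw [he]
  let F : Finset s := Finset.univ.image ι
  let σ : s → ℝ := fun i => inner ℝ (e i) (T (e i))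
  have hTe : ∀ i, T (e i) = σ i • e i := by
    intro i
    by_cases hi : i ∈ F
    · obtain ⟨j, -, rfl⟩ := Finset.mem_image.1 hi
      simp only [σ, heι, hbT, real_inner_smul_right, real_inner_self_eq_norm_sq, hbon.1 j]
      simp
    · have hperp : ∀ j, inner ℝ (b j : H) (e i) = 0 := fun j => by
        rw [← heι]
        exact e.orthonormal.2 fun h => hi (Finset.mem_image.2 ⟨j, Finset.mem_univ _, h⟩)
      have h0 : T (e i) = 0 := by
        rw [hT]
        refine Finset.sum_eq_zero fun t _ => ?_
        have hwt := congrArg Subtype.val (b.sum_repr ⟨w t, hw t⟩)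
        simp only [Submodule.coe_sum, Submodule.coe_smul] at hwt
        have : inner ℝ (w t) (e i) = 0 := by
          rw [← hwt, sum_inner]
          exact Finset.sum_eq_zero fun j _ => by rw [real_inner_smul_left, hperp, mul_zero]
        rw [this, zero_smul]
      simp [σ, h0]
  refine ⟨s, e, σ, F, IsDiag.of_apply_basis hTs hTe, fun i => hTp _, fun i hi => ?_, ?_, ?_⟩
  · have hperp : ∀ j, inner ℝ (b j : H) (e i) = 0 := fun j => by
      rw [← heι]
      exact e.orthonormal.2 fun h => hi (Finset.mem_image.2 ⟨j, Finset.mem_univ _, h⟩)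
    have hwt := congrArg Subtype.val (b.sum_repr ⟨T (e i), hTE _⟩)
    simp only [Submodule.coe_sum, Submodule.coe_smul] at hwt
    simp only [σ]
    rw [← hwt, inner_sum]
    exact Finset.sum_eq_zero fun j _ => by
      rw [real_inner_smul_right, real_inner_comm, hperp, mul_zero]
  · rw [Finset.card_image_of_injective _ hιinj, Finset.card_univ, Fintype.card_fin]
  · intro V hV
    have : V = V₀ := LinearMap.ext fun v => Subtype.ext (by rw [hV, hV₀])
    rw [this, hsymm.det_eq_prod_eigenvalues hd.symm, Finset.prod_image (fun i _ j _ h => hιinj h)]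
    refine Finset.prod_congr rfl fun j _ => ?_
    simp only [σ, heι, hbT, real_inner_smul_right, real_inner_self_eq_norm_sq, hbon.1 j]
    simp [ha]

end FiniteRank

/-! ### Online ridge regression: inverse updates, energy and leverage -/

section SelfNormalized

variable {H Y G : Type*} [NormedAddCommGroup H] [InnerProductSpace ℝ H] [CompleteSpace H]
  [NormedAddCommGroup Y] [InnerProductSpace ℝ Y] [CompleteSpace Y]
  [NormedAddCommGroup G] [InnerProductSpace ℝ G] [CompleteSpace G]

/-- State of online ridge regression: the inverse `R` of the regularized Gram operator on `H`, the
corresponding operator `RG` on `G = H ⊗ Y`, the right-hand side `S` and the accumulated leverage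
scores `P`. -/
structure RidgeState (H G : Type*) [NormedAddCommGroup H] [InnerProductSpace ℝ H]
    [NormedAddCommGroup G] [InnerProductSpace ℝ G] where
  R : H →L[ℝ] H
  RG : G →L[ℝ] G
  S : G
  P : ℝ

namespace RidgeState

/-- Sherman-Morrison update with the observation `(w, ε)`. -/
def step (J : H →L[ℝ] Y →L[ℝ] G) (s : RidgeState H G) (z : H × Y) : RidgeState H G where
  R := s.R - (1 + inner ℝ z.1 (s.R z.1))⁻¹ •
    InnerProductSpace.rankOne ℝ (s.R z.1) (s.R z.1)
  RG := s.RG - (1 + inner ℝ z.1 (s.R z.1))⁻¹ •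
    (J (s.R z.1) ∘L ContinuousLinearMap.adjoint (J (s.R z.1)))
  S := s.S + J z.1 z.2
  P := s.P + inner ℝ z.1 (s.R z.1) / (1 + inner ℝ z.1 (s.R z.1))

/-- `s.R` is the inverse of the symmetric operator `V ≥ c`, and `s.RG` acts as `s.R ⊗ Id`. -/
structure IsInverse (J : H →L[ℝ] Y →L[ℝ] G) (c : ℝ) (V : H →L[ℝ] H) (s : RidgeState H G) :
    Prop where
  symm : ∀ v v', inner ℝ (V v) v' = inner ℝ v (V v')
  coercive : ∀ v, c * ‖v‖ ^ 2 ≤ inner ℝ (V v) v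
  inv : ∀ v, V (s.R v) = v
  lift : ∀ h y, s.RG (J h y) = J (s.R h) y
  symmG : ∀ v v', inner ℝ (s.RG v) v' = inner ℝ v (s.RG v')

variable {J : H →L[ℝ] Y →L[ℝ] G} {c : ℝ} {V : H →L[ℝ] H} {s : RidgeState H G}

theorem IsInverse.symmR (h : IsInverse J c V s) (v v' : H) :
    inner ℝ (s.R v) v' = inner ℝ v (s.R v') := by
  conv_lhs => rw [← h.inv v']
  rw [← h.symm, h.inv]

theorem IsInverse.inner_nonneg (h : IsInverse J c V s) (hc : 0 < c) (w : H) :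
    0 ≤ inner ℝ w (s.R w) := by
  have := h.coercive (s.R w)
  rw [h.inv] at this
  exact le_trans (by positivity) this

theorem IsInverse.injective (h : IsInverse J c V s) (hc : 0 < c) : Function.Injective V := by
  refine (injective_iff_map_eq_zero V).2 fun v hv => ?_
  have := h.coercive v
  rw [hv, inner_zero_left] at this
  have h2 : ‖v‖ ^ 2 ≤ 0 := by
    by_contra hcon
    push Not at hcon
    nlinarith
  exact norm_eq_zero.1 (pow_eq_zero_iff two_ne_zero |>.1 (le_antisymm h2 (sq_nonneg _)))

variable (hJ : ∀ h h' y y', inner ℝ (J h y) (J h' y') = inner ℝ h h' * inner ℝ y y')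

include hJ in
theorem adjoint_apply_tensor (h h' : H) (y : Y) :
    ContinuousLinearMap.adjoint (J h) (J h' y) = inner ℝ h h' • y := by
  refine ext_inner_left ℝ fun v => ?_
  rw [ContinuousLinearMap.adjoint_inner_right, hJ, real_inner_smul_right]

include hJ in
theorem IsInverse.step (h : IsInverse J c V s) (hc : 0 < c) (z : H × Y) :
    IsInverse J c (V + InnerProductSpace.rankOne ℝ z.1 z.1) (s.step J z) := by
  have hq : 0 < 1 + inner ℝ z.1 (s.R z.1) := by linarith [h.inner_nonneg hc z.1]
  refine ⟨fun v v' => ?_, fun v => ?_, fun v => ?_, fun x y => ?_, fun v v' => ?_⟩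
  · simp only [add_apply, InnerProductSpace.rankOne_apply, inner_add_left, inner_add_right,
      real_inner_smul_left, real_inner_smul_right, h.symm]
    rw [real_inner_comm v]; ring
  · simp only [add_apply, InnerProductSpace.rankOne_apply, inner_add_left, real_inner_smul_left]
    linarith [h.coercive v, mul_self_nonneg (inner ℝ z.1 v)]
  · simp only [RidgeState.step, add_apply, sub_apply, smul_apply, map_sub, map_smul,
      InnerProductSpace.rankOne_apply, h.inv, ← h.symmR z.1 v]
    have : inner ℝ (s.R z.1) v • z.1 = (1 + inner ℝ z.1 (s.R z.1))⁻¹ •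
        inner ℝ (s.R z.1) v • (z.1 + inner ℝ z.1 (s.R z.1) • z.1) := by
      rw [smul_add, smul_smul, smul_add, smul_smul, smul_smul, ← add_smul]
      congr 1
      field_simp
    rw [smul_smul] at this ⊢
    rw [← this]
    simp
  · simp only [RidgeState.step, sub_apply, smul_apply, h.lift, map_sub, map_smul,
      ContinuousLinearMap.comp_apply, InnerProductSpace.rankOne_apply, adjoint_apply_tensor hJ]
  · simp only [RidgeState.step, sub_apply, smul_apply, inner_sub_left, inner_sub_right,
      real_inner_smul_left, real_inner_smul_right, ContinuousLinearMap.comp_apply, h.symmG,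
      ← ContinuousLinearMap.adjoint_inner_right (J (s.R z.1)),
      ContinuousLinearMap.adjoint_inner_left]

/-- The self-normalized quantity `⟪S, (V ⊗ Id)⁻¹ S⟫`. -/
def energy (s : RidgeState H G) : ℝ := inner ℝ s.S (s.RG s.S)

include hJ in
-- With q the leverage and u the current prediction at the new input, the numerator holds a term
-- linear in the noise, a negative ‖u‖² that will pay for the exponential moment of the linear term,
-- and q‖ε‖², which the increment q/(1 + q) of `P` compensates.
theorem energy_step (h : IsInverse J c V s) (hc : 0 < c) (z : H × Y) :
    (s.step J z).energy = s.energy +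
      (2 * inner ℝ z.2 (ContinuousLinearMap.adjoint (J (s.R z.1)) s.S) -
        ‖ContinuousLinearMap.adjoint (J (s.R z.1)) s.S‖ ^ 2 +
        inner ℝ z.1 (s.R z.1) * ‖z.2‖ ^ 2) / (1 + inner ℝ z.1 (s.R z.1)) := by
  have hq : 0 < 1 + inner ℝ z.1 (s.R z.1) := by linarith [h.inner_nonneg hc z.1]
  set u := ContinuousLinearMap.adjoint (J (s.R z.1)) s.S with hu
  set q := inner ℝ z.1 (s.R z.1) with hqd
  have h1 : inner ℝ (J z.1 z.2) (s.RG s.S) = inner ℝ z.2 u := by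
    rw [← h.symmG, h.lift, hu, ContinuousLinearMap.adjoint_inner_right]
  have h1' : inner ℝ s.S (s.RG (J z.1 z.2)) = inner ℝ z.2 u := by
    rw [← h.symmG, real_inner_comm, h1]
  have h2 : inner ℝ (J z.1 z.2) (s.RG (J z.1 z.2)) = q * ‖z.2‖ ^ 2 := by
    rw [h.lift, hJ, real_inner_self_eq_norm_sq]
  have h3 : ContinuousLinearMap.adjoint (J (s.R z.1)) (s.S + J z.1 z.2) = u + q • z.2 := by
    rw [map_add, adjoint_apply_tensor hJ, ← hu, hqd, real_inner_comm]
  have h4 : inner ℝ (s.S + J z.1 z.2) ((J (s.R z.1)) (ContinuousLinearMap.adjoint (J (s.R z.1))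
      (s.S + J z.1 z.2))) = ‖u‖ ^ 2 + 2 * q * inner ℝ z.2 u + q ^ 2 * ‖z.2‖ ^ 2 := by
    rw [← ContinuousLinearMap.adjoint_inner_left, h3, real_inner_self_eq_norm_sq,
      norm_add_sq_real, real_inner_smul_right, norm_smul, mul_pow, Real.norm_eq_abs, sq_abs,
      real_inner_comm]
    ring
  simp only [energy, RidgeState.step, sub_apply, smul_apply, ContinuousLinearMap.comp_apply,
    inner_sub_right, real_inner_smul_right]
  rw [h4, map_add, inner_add_left, inner_add_right, inner_add_right, h1, h1', h2, ← hqd]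
  field_simp
  ring

/-- The initial state with regularization parameter `c`. -/
def init (H G : Type*) [NormedAddCommGroup H] [InnerProductSpace ℝ H]
    [NormedAddCommGroup G] [InnerProductSpace ℝ G] (c : ℝ) : RidgeState H G where
  R := c⁻¹ • ContinuousLinearMap.id ℝ H
  RG := c⁻¹ • ContinuousLinearMap.id ℝ G
  S := 0
  P := 0

theorem isInverse_init (J : H →L[ℝ] Y →L[ℝ] G) (hc : 0 < c) :
    IsInverse J c (c • ContinuousLinearMap.id ℝ H) (init H G c) := by
  refine ⟨fun v v' => ?_, fun v => ?_, fun v => ?_, fun x y => ?_, fun v v' => ?_⟩ <;>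
  simp [init, real_inner_smul_left, real_inner_smul_right, hc.ne', smul_smul]

variable {Z : Type*} {obs : Z → H × Y}

include hJ in
theorem IsInverse.seqFold (hc : 0 < c) : ∀ (n : ℕ) {V : H →L[ℝ] H} {s : RidgeState H G}
    (_ : IsInverse J c V s) (z : Fin n → Z),
    IsInverse J c (V + ∑ i, InnerProductSpace.rankOne ℝ (obs (z i)).1 (obs (z i)).1)
      (seqFold (fun s z => s.step J (obs z)) n s z)
  | 0, V, s, h, z => by simpa [CovShift.seqFold] using h
  | n + 1, V, s, h, z => by
      rw [Fin.sum_univ_succ, ← add_assoc]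
      exact IsInverse.seqFold hc n (h.step hJ hc (obs (z 0))) _

theorem S_seqFold : ∀ (n : ℕ) (s : RidgeState H G) (z : Fin n → Z),
    (seqFold (fun s z => s.step J (obs z)) n s z).S = s.S + ∑ i, J (obs (z i)).1 (obs (z i)).2
  | 0, s, z => by simp [CovShift.seqFold]
  | n + 1, s, z => by
      rw [Fin.sum_univ_succ, ← add_assoc]
      exact S_seqFold n _ _

include hJ in
/-- Elliptical potential lemma. -/
theorem P_seqFold_le (hc : 0 < c) (E : Submodule ℝ H) [FiniteDimensional ℝ E] :
    ∀ (n : ℕ) {V : H →L[ℝ] H} {s : RidgeState H G} (_ : IsInverse J c V s) (z : Fin n → Z)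
      (_ : ∀ i, (obs (z i)).1 ∈ E) (VE VE' : E →ₗ[ℝ] E) (_ : ∀ v, (VE v : H) = V v)
      (_ : ∀ v, (VE' v : H) = V v + ∑ i, inner ℝ (obs (z i)).1 (v : H) • (obs (z i)).1)
      (_ : 0 < LinearMap.det VE),
      0 < LinearMap.det VE' ∧
      (CovShift.seqFold (fun s z => s.step J (obs z)) n s z).P ≤
        s.P + (Real.log (LinearMap.det VE') - Real.log (LinearMap.det VE))
  | 0, V, s, h, z, hz, VE, VE', hVE, hVE', hdet => by
      have : VE' = VE := LinearMap.ext fun v => Subtype.ext (by rw [hVE, hVE']; simp)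
      simp [CovShift.seqFold, this, hdet]
  | n + 1, V, s, h, z, hz, VE, VE', hVE, hVE', hdet => by
      set w := (obs (z 0)).1 with hw
      have hwE : w ∈ E := hz 0
      have hinj : Function.Injective VE := fun a b hab => Subtype.ext
        (h.injective hc (by rw [← hVE, ← hVE, hab]))
      -- Determinants live on the finite-dimensional `E`; injectivity of V identifies the preimage
      -- of w in `E` with `s.R w`.
      obtain ⟨r, hr⟩ := (LinearMap.injective_iff_surjective.1 hinj) ⟨w, hwE⟩
      have hrR : (r : H) = s.R w := h.injective hc (by
        rw [← hVE, hr, h.inv])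
      let VE₁ : E →ₗ[ℝ] E := VE + (LinearMap.toSpanSingleton ℝ E ⟨w, hwE⟩) ∘ₗ
        (innerₛₗ ℝ (⟨w, hwE⟩ : E))
      have hVE₁ : ∀ v, VE₁ v = VE v + inner ℝ (⟨w, hwE⟩ : E) v • (⟨w, hwE⟩ : E) := fun v => by
        simp [VE₁]
      have hd := det_add_rankOne hr hVE₁
      rw [Submodule.coe_inner, hrR] at hd
      have hq := h.inner_nonneg hc w
      have hdet₁ : 0 < LinearMap.det VE₁ := by rw [hd]; positivity
      obtain ⟨hpos, hP⟩ := P_seqFold_le hc E n (h.step hJ hc (obs (z 0))) (fun i => z i.succ)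
        (fun i => hz i.succ) VE₁ VE'
        (fun v => by
          rw [hVE₁, Submodule.coe_add, hVE]; simp [← hw])
        (fun v => by
          rw [hVE', Fin.sum_univ_succ, add_apply, InnerProductSpace.rankOne_apply, add_assoc])
        hdet₁
      refine ⟨hpos, hP.trans ?_⟩
      -- The determinant is multiplied by 1 + q, and q/(1 + q) ≤ log(1 + q), so the leverage scores
      -- are dominated by a telescoping sum of log-determinants.
      have hlog : inner ℝ w (s.R w) / (1 + inner ℝ w (s.R w)) ≤
          Real.log (1 + inner ℝ w (s.R w)) := by
        have h0 : 0 < 1 + inner ℝ w (s.R w) := by linarith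
        refine le_trans (le_of_eq ?_) (Real.one_sub_inv_le_log_of_pos h0)
        field_simp
        ring
      rw [hd, Real.log_mul hdet.ne' (by positivity)]
      simp only [RidgeState.step, ← hw]
      linarith

end RidgeState
end SelfNormalized

namespace RidgeState

/-! ### Strong measurability of the random ridge states -/

section Measurability

variable {H Y G : Type*} [NormedAddCommGroup H] [InnerProductSpace ℝ H] [CompleteSpace H]
  [NormedAddCommGroup Y] [InnerProductSpace ℝ Y] [CompleteSpace Y]
  [NormedAddCommGroup G] [InnerProductSpace ℝ G] [CompleteSpace G]

/-- All components of the random state `s` are strongly measurable. -/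
structure IsMeasurable {P : Type*} [MeasurableSpace P] (s : P → RidgeState H G) : Prop where
  R : StronglyMeasurable fun p => (s p).R
  RG : StronglyMeasurable fun p => (s p).RG
  S : StronglyMeasurable fun p => (s p).S
  P : StronglyMeasurable fun p => (s p).P

theorem stronglyMeasurable_clm_apply {P E F : Type*} [MeasurableSpace P] [NormedAddCommGroup E]
    [NormedSpace ℝ E] [NormedAddCommGroup F] [NormedSpace ℝ F] {T : P → E →L[ℝ] F} {v : P → E}
    (hT : StronglyMeasurable T) (hv : StronglyMeasurable v) :
    StronglyMeasurable fun p => T p (v p) :=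
  (isBoundedBilinearMap_apply (𝕜 := ℝ) (E := E) (F := F)).continuous.comp_stronglyMeasurable
    (hT.prodMk hv)

variable {P : Type*} [MeasurableSpace P] {s : P → RidgeState H G}

theorem IsMeasurable.step (J : H →L[ℝ] Y →L[ℝ] G) (hs : IsMeasurable s) {z : P → H × Y}
    (hz : StronglyMeasurable z) : IsMeasurable fun p => (s p).step J (z p) := by
  have h1 : StronglyMeasurable fun p => (z p).1 := continuous_fst.comp_stronglyMeasurable hz
  have h2 : StronglyMeasurable fun p => (z p).2 := continuous_snd.comp_stronglyMeasurable hz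
  have hr : StronglyMeasurable fun p => (s p).R (z p).1 := stronglyMeasurable_clm_apply hs.R h1
  have hq : StronglyMeasurable fun p => inner ℝ (z p).1 ((s p).R (z p).1) := h1.inner hr
  have hq' : StronglyMeasurable fun p => (1 + inner ℝ (z p).1 ((s p).R (z p).1))⁻¹ :=
    (hq.measurable.const_add 1).inv.stronglyMeasurable
  have hJr : StronglyMeasurable fun p => J ((s p).R (z p).1) :=
    J.continuous.comp_stronglyMeasurable hr
  refine ⟨?_, ?_, ?_, ?_⟩
  · refine hs.R.sub (hq'.smul ?_)
    have hc : Continuous fun v : H => InnerProductSpace.rankOne ℝ v v :=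
      isBoundedBilinearMap_apply.continuous.comp
        ((InnerProductSpace.rankOne ℝ (E := H) (F := H)).continuous.prodMk continuous_id)
    exact hc.comp_stronglyMeasurable hr
  · refine hs.RG.sub (hq'.smul ?_)
    have hc : Continuous fun T : Y →L[ℝ] G => T ∘L ContinuousLinearMap.adjoint T :=
      isBoundedBilinearMap_comp.continuous.comp
        (continuous_id.prodMk (ContinuousLinearMap.adjoint (𝕜 := ℝ) (E := Y) (F := G)).continuous)
    exact hc.comp_stronglyMeasurable hJr
  · exact hs.S.add (stronglyMeasurable_clm_apply
      (J.continuous.comp_stronglyMeasurable h1) h2)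
  · exact hs.P.add (hq.measurable.div (hq.measurable.const_add 1)).stronglyMeasurable

theorem IsMeasurable.seqFold {Z : Type*} [MeasurableSpace Z] (J : H →L[ℝ] Y →L[ℝ] G)
    {obs : Z → H × Y} (hobs : StronglyMeasurable obs) : ∀ (n : ℕ) {s : P → RidgeState H G}
    (_ : IsMeasurable s) {z : P → Fin n → Z} (_ : Measurable z),
    IsMeasurable fun p => CovShift.seqFold (fun s z => s.step J (obs z)) n (s p) (z p)
  | 0, _, hs, _, _ => hs
  | n + 1, s, hs, z, hz => by
      have hz0 : StronglyMeasurable fun p => obs (z p 0) :=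
        hobs.comp_measurable ((measurable_pi_apply 0).comp hz)
      exact IsMeasurable.seqFold J hobs n (hs.step J hz0)
        (measurable_pi_lambda _ fun i => (measurable_pi_apply i.succ).comp hz)

theorem IsMeasurable.energy (hs : IsMeasurable s) :
    StronglyMeasurable fun p => (s p).energy :=
  hs.S.inner (stronglyMeasurable_clm_apply hs.RG hs.S)

end Measurability

/-! ### The exponential supermartingale and self-normalized concentration -/

section Supermartingale

variable {H Y G : Type*} [NormedAddCommGroup H] [InnerProductSpace ℝ H] [CompleteSpace H]
  [NormedAddCommGroup Y] [InnerProductSpace ℝ Y] [CompleteSpace Y]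
  [NormedAddCommGroup G] [InnerProductSpace ℝ G] [CompleteSpace G]
  {X Ω : Type*} [MeasurableSpace X] [MeasurableSpace Ω]

/-- Hoeffding's lemma for the inner product with a bounded centered vector. -/
theorem lintegral_exp_inner_le {m : Measure Ω} [IsProbabilityMeasure m] {ε : Ω → Y}
    (hε : StronglyMeasurable ε) {M : ℝ} (hM : ∀ᵐ ω ∂m, ‖ε ω‖ ≤ M) (h0 : ∫ ω, ε ω ∂m = 0)
    (u : Y) (t : ℝ) :
    ∫⁻ ω, ENNReal.ofReal (Real.exp (t * inner ℝ (ε ω) u)) ∂m ≤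
      ENNReal.ofReal (Real.exp (M ^ 2 * ‖u‖ ^ 2 * t ^ 2 / 2)) := by
  have hint : Integrable ε m := Integrable.of_bound hε.aestronglyMeasurable M hM
  have hmeas : AEMeasurable (fun ω => inner ℝ (ε ω) u) m :=
    (hε.inner stronglyMeasurable_const).measurable.aemeasurable
  have hsub := hasSubgaussianMGF_of_mem_Icc_of_integral_eq_zero (a := -(M * ‖u‖)) (b := M * ‖u‖)
    hmeas (by
      filter_upwards [hM] with ω hω
      rw [Set.mem_Icc, ← abs_le]
      exact (abs_real_inner_le_norm _ _).trans
        (mul_le_mul_of_nonneg_right hω (norm_nonneg u)))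
    (by
      simp_rw [real_inner_comm u]
      rw [integral_inner hint, h0, inner_zero_right])
  rw [← ofReal_integral_eq_lintegral_ofReal (hsub.integrable_exp_mul t)
    (Filter.Eventually.of_forall fun ω => (Real.exp_pos _).le)]
  refine ENNReal.ofReal_le_ofReal ((hsub.mgf_le t).trans (le_of_eq ?_))
  congr 2
  push_cast
  rw [Real.norm_eq_abs, div_pow, sq_abs]
  ring

variable {J : H →L[ℝ] Y →L[ℝ] G} {c : ℝ} {V : H →L[ℝ] H} {s : RidgeState H G}
  (hJ : ∀ h h' y y', inner ℝ (J h y) (J h' y') = inner ℝ h h' * inner ℝ y y')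

/-- The exponential supermartingale. -/
def expEnergy (M : ℝ) (s : RidgeState H G) : ENNReal :=
  ENNReal.ofReal (Real.exp ((s.energy - M ^ 2 * s.P) / (2 * M ^ 2)))

include hJ in
-- The input w is fixed and only the noise is averaged. In `energy_step`, ‖ε‖² ≤ M² cancels the
-- quadratic term against the growth of `P`, and Hoeffding's lemma for the linear term costs no more
-- than the available -‖u‖².
theorem lintegral_expEnergy_step_le (hs : IsInverse J c V s) (hc : 0 < c) {m : Measure Ω}
    [IsProbabilityMeasure m] {ε : Ω → Y} (hε : StronglyMeasurable ε) {M : ℝ} (hM0 : 0 < M)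
    (hM : ∀ᵐ ω ∂m, ‖ε ω‖ ≤ M) (h0 : ∫ ω, ε ω ∂m = 0) (w : H) :
    ∫⁻ ω, expEnergy M (s.step J (w, ε ω)) ∂m ≤ expEnergy M s := by
  set u := ContinuousLinearMap.adjoint (J (s.R w)) s.S with hu
  set q := inner ℝ w (s.R w) with hq
  have hq0 : 0 ≤ q := hs.inner_nonneg hc w
  have hq1 : 0 < 1 + q := by linarith
  -- The coefficient of ⟪ε, u⟫ once the energy increment is divided by 2M².
  set t := (M ^ 2 * (1 + q))⁻¹ with ht
  have ht0 : 0 < t := by positivity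
  set K := ENNReal.ofReal (Real.exp ((s.energy - M ^ 2 * s.P) / (2 * M ^ 2) -
    ‖u‖ ^ 2 * t / 2)) with hK
  have hbd : ∀ᵐ ω ∂m, expEnergy M (s.step J (w, ε ω)) ≤
      K * ENNReal.ofReal (Real.exp (t * inner ℝ (ε ω) u)) := by
    filter_upwards [hM] with ω hω
    rw [hK, ← ENNReal.ofReal_mul (Real.exp_pos _).le, ← Real.exp_add]
    refine ENNReal.ofReal_le_ofReal (Real.exp_le_exp.2 ?_)
    rw [energy_step hJ hs hc]
    simp only [RidgeState.step, ← hu, ← hq]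
    have h1 : ‖ε ω‖ ^ 2 ≤ M ^ 2 := pow_le_pow_left₀ (norm_nonneg _) hω 2
    have h2 : (s.energy + (2 * inner ℝ (ε ω) u - ‖u‖ ^ 2 + q * ‖ε ω‖ ^ 2) / (1 + q) -
        M ^ 2 * (s.P + q / (1 + q))) / (2 * M ^ 2) =
        (s.energy - M ^ 2 * s.P) / (2 * M ^ 2) - ‖u‖ ^ 2 * t / 2 + t * inner ℝ (ε ω) u -
          q * (M ^ 2 - ‖ε ω‖ ^ 2) * t / 2 := by
      rw [ht]; field_simp; ring
    have h3 : 0 ≤ q * (M ^ 2 - ‖ε ω‖ ^ 2) * t / 2 := by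
      have : 0 ≤ M ^ 2 - ‖ε ω‖ ^ 2 := by linarith
      positivity
    linarith
  refine (lintegral_mono_ae hbd).trans ?_
  rw [lintegral_const_mul _ ((hε.inner stronglyMeasurable_const).measurable.const_mul
    t).exp.ennreal_ofReal]
  refine (mul_le_mul_right (lintegral_exp_inner_le hε hM h0 u t) K).trans ?_
  rw [hK, ← ENNReal.ofReal_mul (Real.exp_pos _).le, ← Real.exp_add]
  refine ENNReal.ofReal_le_ofReal (Real.exp_le_exp.2 ?_)
  -- M² t = 1/(1 + q), so Hoeffding's M²‖u‖²t²/2 is absorbed by ‖u‖²t/2.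
  have h1 : M ^ 2 * t ≤ 1 := by
    rw [ht, mul_inv, ← mul_assoc, mul_inv_cancel₀ (by positivity), one_mul]
    exact inv_le_one_of_one_le₀ (by linarith)
  have h2 : M ^ 2 * ‖u‖ ^ 2 * t ^ 2 / 2 ≤ ‖u‖ ^ 2 * t / 2 := by
    have := mul_le_mul_of_nonneg_right h1 (by positivity : 0 ≤ ‖u‖ ^ 2 * t / 2)
    nlinarith [this]
  linarith

include hJ in
/-- Self-normalized concentration: with probability at least `1 - exp (-L)` the energy is at most
`M² (P + 2 L)`. -/
theorem measure_energy_gt_le (pX : Measure X) [IsProbabilityMeasure pX] (cond : Kernel X Ω)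
    [IsMarkovKernel cond] {w : X → H} (hw : StronglyMeasurable w) {ε : X × Ω → Y}
    (hε : StronglyMeasurable ε) {M : ℝ} (hM0 : 0 < M)
    (hM : ∀ᵐ x ∂pX, (∀ᵐ y ∂cond x, ‖ε (x, y)‖ ≤ M) ∧ ∫ y, ε (x, y) ∂cond x = 0)
    (hc : 0 < c) (n : ℕ) (L : ℝ) :
    Measure.pi (fun _ : Fin n => pX ⊗ₘ cond)
      {z | M ^ 2 * ((seqFold (fun s z => s.step J (w z.1, ε z)) n (init H G c) z).P + 2 * L) <
        (seqFold (fun s z => s.step J (w z.1, ε z)) n (init H G c) z).energy} ≤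
      ENNReal.ofReal (Real.exp (-L)) := by
  have hobs : StronglyMeasurable fun z : X × Ω => (w z.1, ε z) :=
    (hw.comp_measurable measurable_fst).prodMk hε
  have hmP : ∀ {P : Type _} [MeasurableSpace P] {s : P → RidgeState H G},
      IsMeasurable s → Measurable fun p => expEnergy M (s p) := fun hs =>
    (((hs.energy.measurable.sub (hs.P.measurable.const_mul _)).div_const _).exp).ennreal_ofReal
  have hconst : ∀ {P : Type _} [MeasurableSpace P] (s : RidgeState H G),
      IsMeasurable fun _ : P => s := fun s =>
    ⟨stronglyMeasurable_const, stronglyMeasurable_const, stronglyMeasurable_const,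
      stronglyMeasurable_const⟩
  have hmeas : ∀ (n : ℕ) (s : RidgeState H G), Measurable fun z : Fin n → X × Ω =>
      expEnergy M (seqFold (fun s z => s.step J (w z.1, ε z)) n s z) := fun n s =>
    hmP (IsMeasurable.seqFold (P := Fin n → X × Ω) J hobs n (hconst s) measurable_id)
  -- The growth factor per step is 1. The invariant that the state inverts some coercive V is what
  -- makes the one-step estimate applicable; disintegrating `pX ⊗ₘ cond` freezes the input.
  have hfold := lintegral_seqFold_le (pX ⊗ₘ cond) (fun s z => s.step J (w z.1, ε z))
    (fun s => ∃ V, IsInverse J c V s)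
    (fun s z ⟨V, hV⟩ => ⟨_, hV.step hJ hc _⟩) (expEnergy M) 1 (fun n s _ => hmeas n s)
    (fun s ⟨V, hV⟩ => by
      rw [Measure.lintegral_compProd (hmP ((hconst s).step J hobs)), one_mul]
      calc _ ≤ ∫⁻ _, expEnergy M s ∂pX := by
            refine lintegral_mono_ae ?_
            filter_upwards [hM] with x hx
            exact lintegral_expEnergy_step_le hJ hV hc
              (hε.comp_measurable measurable_prodMk_left) hM0 hx.1 hx.2 (w x)
        _ = expEnergy M s := by simp)
    n (init H G c) ⟨_, isInverse_init J hc⟩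
  have hinit : expEnergy M (init H G c) = 1 := by simp [expEnergy, energy, init]
  rw [hinit, one_pow, one_mul] at hfold
  have hsub : {z : Fin n → X × Ω | M ^ 2 *
      ((seqFold (fun s z => s.step J (w z.1, ε z)) n (init H G c) z).P + 2 * L) <
        (seqFold (fun s z => s.step J (w z.1, ε z)) n (init H G c) z).energy} ⊆
      {z | ENNReal.ofReal (Real.exp L) ≤
        expEnergy M (seqFold (fun s z => s.step J (w z.1, ε z)) n (init H G c) z)} := by
    intro z hz
    refine ENNReal.ofReal_le_ofReal (Real.exp_le_exp.2 ?_)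
    rw [le_div_iff₀ (by positivity)]
    rw [Set.mem_ofPred_eq] at hz
    linarith
  refine (measure_mono hsub).trans ?_
  refine (meas_ge_le_lintegral_div (hmeas n _).aemeasurable
    (ENNReal.ofReal_pos.2 (Real.exp_pos L)).ne' ENNReal.ofReal_ne_top).trans ?_
  refine (ENNReal.div_le_div_right hfold _).trans ?_
  rw [Real.exp_neg, ENNReal.ofReal_inv_of_pos (Real.exp_pos L), one_div]

end Supermartingale

end RidgeState

/-! ### Features, their measurability, and the covariance operator -/

section Feature

variable {X H : Type*} [NormedAddCommGroup H] [InnerProductSpace ℝ H] [CompleteSpace H]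
  [RKHS ℝ H X ℝ]

theorem inner_feature (x : X) (h : H) : inner ℝ (feature H x) h = h x := by
  rw [feature, RKHS.kerFun_inner]
  simp

theorem feature_apply (x t : X) : (feature H t : H) x = scalarKernel H x t := by
  rw [feature, RKHS.kerFun_apply, scalarKernel]

theorem norm_feature_sq (x : X) : ‖feature H x‖ ^ 2 = scalarKernel H x x := by
  rw [← real_inner_self_eq_norm_sq, inner_feature, feature_apply]

variable (X H) in
/-- The linear map `(X →₀ ℝ) → H`, `c ↦ ∑ c x • φ(x)`. -/
def featureComb : (X →₀ ℝ) →ₗ[ℝ] H := Finsupp.linearCombination ℝ (feature H)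

variable (X H) in
theorem denseRange_featureComb : DenseRange (featureComb X H) := by
  have h := RKHS.kerFun_dense (𝕜 := ℝ) (X := X) (V := ℝ) H
  have hr : Set.range (featureComb X H) =
      (Submodule.span ℝ {RKHS.kerFun H x v | (x : X) (v : ℝ)} : Set H) := by
    rw [featureComb, ← LinearMap.coe_range, Finsupp.range_linearCombination]
    congr 1
    refine le_antisymm (Submodule.span_mono ?_) (Submodule.span_le.2 ?_)
    · rintro _ ⟨x, rfl⟩
      exact ⟨x, 1, rfl⟩
    · rintro _ ⟨x, v, rfl⟩
      have : RKHS.kerFun H x v = v • feature H x := by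
        rw [feature, ← map_smul, smul_eq_mul, mul_one]
      rw [this]
      exact Submodule.smul_mem _ _ (Submodule.subset_span ⟨x, rfl⟩)
  rw [DenseRange, hr, dense_iff_closure_eq, ← Submodule.topologicalClosure_coe, h]
  rfl

/-- Two continuous linear maps that agree on the features are equal. -/
theorem clm_ext_feature {F : Type*} [NormedAddCommGroup F] [NormedSpace ℝ F] {A B : H →L[ℝ] F}
    (h : ∀ x : X, A (feature H x) = B (feature H x)) : A = B := by
  have h1 : A.toLinearMap ∘ₗ featureComb X H = B.toLinearMap ∘ₗ featureComb X H := by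
    refine Finsupp.lhom_ext fun x c => ?_
    simp [featureComb, h]
  exact DFunLike.coe_injective ((denseRange_featureComb X H).equalizer A.continuous B.continuous
    (funext fun c => LinearMap.congr_fun h1 c))

/-- Finite kernel combinations are measurable and dense, and convergence in an RKHS implies
pointwise convergence. -/
theorem measurable_eval [MeasurableSpace X]
    (hk : ∀ t : X, Measurable fun x => scalarKernel H x t) (h : H) :
    Measurable fun x : X => h x := by
  have hcl := mem_closure_iff_seq_limit.1 ((denseRange_featureComb X H) h)
  obtain ⟨u, hu, hlim⟩ := hcl
  refine measurable_of_tendsto_metrizable (f := fun n x => (u n) x) (fun n => ?_)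
    (tendsto_pi_nhds.2 fun x => ?_)
  · obtain ⟨c, hc⟩ := hu n
    rw [← hc]
    have : (fun x : X => (featureComb X H c) x) = fun x =>
        ∑ t ∈ c.support, c t * scalarKernel H x t := by
      funext x
      rw [← inner_feature, featureComb, Finsupp.linearCombination_apply, Finsupp.sum, inner_sum]
      refine Finset.sum_congr rfl fun t _ => ?_
      rw [real_inner_smul_right, inner_feature, feature_apply]
    rw [this]
    exact Finset.measurable_sum _ fun t _ => (hk t).const_mul _
  · exact ((RKHS.continuous_eval (𝕜 := ℝ) (H := H) x).tendsto h).comp hlim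

/-- The partial sums of the expansion in the countable basis have measurable coefficients ⟪f_i,
φ(x)⟫ = f_i(x), and they converge pointwise. -/
theorem stronglyMeasurable_feature [MeasurableSpace X] (f : HilbertBasis ℕ ℝ H)
    (hk : ∀ t : X, Measurable fun x => scalarKernel H x t) :
    StronglyMeasurable fun x : X => feature H x := by
  refine stronglyMeasurable_of_tendsto (u := Filter.atTop)
    (f := fun n x => ∑ i ∈ Finset.range n, inner ℝ (f i) (feature H x) • f i) (fun n => ?_)
    (tendsto_pi_nhds.2 fun x => ?_)
  · refine Finset.stronglyMeasurable_fun_sum _ fun i _ => StronglyMeasurable.smul_const ?_ _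
    simp_rw [real_inner_comm, inner_feature]
    exact (measurable_eval hk (f i)).stronglyMeasurable
  · have := (f.hasSum_repr (feature H x)).tendsto_sum_nat
    simpa only [f.repr_apply_apply] using this

/-- `⟪h, C_X h'⟫ = ∫ ⟪φ, h⟫ ⟪φ, h'⟫ dq`. -/
theorem inner_covOp [MeasurableSpace X] (f : HilbertBasis ℕ ℝ H)
    (hk : ∀ t : X, Measurable fun x => scalarKernel H x t) {κ : ℝ}
    (hκ : ∀ x : X, scalarKernel H x x ≤ κ ^ 2) (q : Measure X) [IsProbabilityMeasure q] (h h' : H) :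
    inner ℝ h (covOp H q h') = ∫ x, inner ℝ h (feature H x) * inner ℝ (feature H x) h' ∂q := by
  have hint : Integrable (fun x : X =>
      InnerProductSpace.rankOne ℝ (feature H x) (feature H x)) q := by
    refine Integrable.of_bound (C := κ ^ 2) ?_ (Filter.Eventually.of_forall fun x => ?_)
    · have hc : Continuous fun v : H => InnerProductSpace.rankOne ℝ v v :=
        isBoundedBilinearMap_apply.continuous.comp
          ((InnerProductSpace.rankOne ℝ (E := H) (F := H)).continuous.prodMk continuous_id)
      exact (hc.comp_stronglyMeasurable (stronglyMeasurable_feature f hk)).aestronglyMeasurable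
    · rw [InnerProductSpace.norm_rankOne, ← sq, norm_feature_sq]
      exact hκ x
  rw [covOp, ContinuousLinearMap.integral_apply hint]
  have := integral_inner (𝕜 := ℝ) (hint.apply_continuousLinearMap h') h
  rw [← this]
  refine integral_congr_ae (Filter.Eventually.of_forall fun x => ?_)
  simp only [InnerProductSpace.rankOne_apply, real_inner_smul_right]
  ring

theorem covOp_symm [MeasurableSpace X] (f : HilbertBasis ℕ ℝ H)
    (hk : ∀ t : X, Measurable fun x => scalarKernel H x t) {κ : ℝ}
    (hκ : ∀ x : X, scalarKernel H x x ≤ κ ^ 2) (q : Measure X) [IsProbabilityMeasure q] (h h' : H) :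
    inner ℝ (covOp H q h) h' = inner ℝ h (covOp H q h') := by
  rw [real_inner_comm, inner_covOp f hk hκ, inner_covOp f hk hκ]
  refine integral_congr_ae (Filter.Eventually.of_forall fun x => ?_)
  simp only [real_inner_comm (feature H x)]
  ring

end Feature

/-! ### The vRKHS as a tensor product -/

section Tensor

variable {X Y H G : Type*} [NormedAddCommGroup Y] [InnerProductSpace ℝ Y] [CompleteSpace Y]
  [NormedAddCommGroup H] [InnerProductSpace ℝ H] [CompleteSpace H] [RKHS ℝ H X ℝ]
  [NormedAddCommGroup G] [InnerProductSpace ℝ G] [CompleteSpace G] [RKHS ℝ G X Y]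

/-- The Gram matrix of the vectors K_x y is ‖y‖² times that of the features, so φ(x) ↦ K_x y is
bounded on the span of the features and extends to `H`. -/
theorem inner_linearCombination_kerFun
    (hG : ∀ x t : X, RKHS.kernel G x t = scalarKernel H x t • ContinuousLinearMap.id ℝ Y)
    (y : Y) (c : X →₀ ℝ) :
    ‖Finsupp.linearCombination ℝ (fun x => RKHS.kerFun G x y) c‖ ≤ ‖y‖ * ‖featureComb X H c‖ := by
  refine abs_le_of_sq_le_sq' ?_ (by positivity) |>.2
  rw [mul_pow, ← real_inner_self_eq_norm_sq, ← real_inner_self_eq_norm_sq (featureComb X H c),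
    featureComb, Finsupp.linearCombination_apply, Finsupp.linearCombination_apply]
  simp only [Finsupp.sum, sum_inner, inner_sum, real_inner_smul_left, real_inner_smul_right,
    Finset.mul_sum]
  refine le_of_eq (Finset.sum_congr rfl fun x _ => Finset.sum_congr rfl fun t _ => ?_)
  rw [RKHS.kerFun_inner, RKHS.kerFun_apply, hG, inner_feature, feature_apply]
  simp only [smul_apply, ContinuousLinearMap.id_apply, real_inner_smul_right,
    real_inner_self_eq_norm_sq]
  ring

/-- `h ↦ h ⊗ y` for fixed `y`. -/
def tensorRight (H : Type*) {X Y : Type*} (G : Type*) [NormedAddCommGroup Y] [InnerProductSpace ℝ Y]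
    [CompleteSpace Y] [NormedAddCommGroup H] [InnerProductSpace ℝ H] [CompleteSpace H]
    [RKHS ℝ H X ℝ] [NormedAddCommGroup G] [InnerProductSpace ℝ G] [CompleteSpace G] [RKHS ℝ G X Y]
    (y : Y) : H →L[ℝ] G :=
  (Finsupp.linearCombination ℝ (fun x => RKHS.kerFun G x y)).extendOfNorm (featureComb X H)

variable (hG : ∀ x t : X, RKHS.kernel G x t = scalarKernel H x t • ContinuousLinearMap.id ℝ Y)

include hG in
theorem tensorRight_feature (y : Y) (x : X) :
    tensorRight H G y (feature H x) = RKHS.kerFun G x y := by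
  have h := LinearMap.extendOfNorm_eq (denseRange_featureComb X H)
    ⟨‖y‖, inner_linearCombination_kerFun hG y⟩ (Finsupp.single x 1)
  simpa [featureComb, tensorRight] using h

include hG in
theorem tensorRight_apply (y : Y) (h : H) (x : X) : tensorRight H G y h x = h x • y := by
  have : (ContinuousLinearMap.adjoint (RKHS.kerFun G x)) ∘L tensorRight H G y =
      (innerSL ℝ (feature H x)).smulRight y := by
    refine clm_ext_feature (X := X) fun t => ?_
    simp only [ContinuousLinearMap.comp_apply, tensorRight_feature hG, RKHS.adjoint_kerFun,
      ContinuousLinearMap.smulRight_apply, innerSL_apply_apply, inner_feature, feature_apply,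
      RKHS.kerFun_apply, hG, smul_apply, ContinuousLinearMap.id_apply]
  have h1 := DFunLike.congr_fun this h
  simpa only [ContinuousLinearMap.comp_apply, RKHS.adjoint_kerFun,
      ContinuousLinearMap.smulRight_apply, innerSL_apply_apply, inner_feature] using h1

include hG in
theorem norm_tensorRight_apply_le (y : Y) (h : H) : ‖tensorRight H G y h‖ ≤ ‖y‖ * ‖h‖ :=
  LinearMap.norm_extendOfNorm_apply_le (denseRange_featureComb X H) ‖y‖
    (inner_linearCombination_kerFun hG y) h

include hG in
/-- If the kernel of `G` is `k · Id`, then `G = H ⊗ Y`. -/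
theorem exists_tensor : ∃ J : H →L[ℝ] Y →L[ℝ] G,
    (∀ h y x, J h y x = h x • y) ∧ (∀ x y, J (feature H x) y = RKHS.kerFun G x y) ∧
    ∀ h h' y y', inner ℝ (J h y) (J h' y') = inner ℝ h h' * inner ℝ y y' := by
  let J : H →L[ℝ] Y →L[ℝ] G := LinearMap.mkContinuous₂
    (LinearMap.mk₂ ℝ (fun (h : H) (y : Y) => tensorRight H G y h)
      (fun h h' y => map_add _ _ _) (fun c h y => map_smul _ _ _)
      (fun h y y' => RKHS.ext fun x => by
        simp [tensorRight_apply hG])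
      (fun c h y => RKHS.ext fun x => by
        simp only [tensorRight_apply hG, RKHS.coe_smul, Pi.smul_apply, smul_comm c])) 1
    (fun h y => by
      rw [one_mul, mul_comm]; exact norm_tensorRight_apply_le hG y h)
  have hJ1 : ∀ h y x, J h y x = h x • y := fun h y x => tensorRight_apply hG y h x
  have hJ2 : ∀ x y, J (feature H x) y = RKHS.kerFun G x y := fun x y => tensorRight_feature hG y x
  refine ⟨J, hJ1, hJ2, fun h h' y y' => ?_⟩
  -- Both sides are continuous and linear in the first tensor factor, so features suffice; there the
  -- reproducing property of `G` evaluates the left side.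
  have : (innerSL ℝ (J h' y')) ∘L J.flip y = inner ℝ y y' • innerSL ℝ h' := by
    refine clm_ext_feature (X := X) fun t => ?_
    simp only [ContinuousLinearMap.comp_apply, ContinuousLinearMap.flip_apply, innerSL_apply_apply,
      hJ2, RKHS.inner_kerFun, hJ1, smul_apply, real_inner_smul_left]
    rw [← inner_feature, real_inner_comm y, real_inner_comm h', smul_eq_mul]
    ring
  have h1 := DFunLike.congr_fun this h
  simp only [ContinuousLinearMap.comp_apply, ContinuousLinearMap.flip_apply, innerSL_apply_apply,
      smul_apply, smul_eq_mul] at h1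
  rw [real_inner_comm, h1, real_inner_comm h]
  ring

end Tensor

/-! ### Components in `H` of elements of `G` -/

section Components

variable {X Y H G : Type*} [NormedAddCommGroup Y] [InnerProductSpace ℝ Y] [CompleteSpace Y]
  [NormedAddCommGroup H] [InnerProductSpace ℝ H] [CompleteSpace H] [RKHS ℝ H X ℝ]
  [NormedAddCommGroup G] [InnerProductSpace ℝ G] [CompleteSpace G] [RKHS ℝ G X Y]

/-- The component of `F ∈ G = H ⊗ Y` in direction `y`, i.e. the function `⟪F(·), y⟫ ∈ H`. -/
def component (J : H →L[ℝ] Y →L[ℝ] G) (y : Y) : G →L[ℝ] H :=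
  ContinuousLinearMap.adjoint (J.flip y)

variable {J : H →L[ℝ] Y →L[ℝ] G}

theorem inner_component (y : Y) (h : H) (F : G) :
    inner ℝ h (component J y F) = inner ℝ (J h y) F := by
  rw [component, ContinuousLinearMap.adjoint_inner_right, ContinuousLinearMap.flip_apply]

variable (hJk : ∀ x y, J (feature H x) y = RKHS.kerFun G x y)
  (hJ : ∀ h h' y y', inner ℝ (J h y) (J h' y') = inner ℝ h h' * inner ℝ y y')

include hJk in
theorem component_apply (y : Y) (F : G) (x : X) :
    inner ℝ (feature H x) (component J y F) = inner ℝ y (F x) := by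
  rw [inner_component, hJk, RKHS.kerFun_inner]

include hJk hJ in
-- Completeness: an F orthogonal to all products has zero components along every u_k, so each value
-- F(x) vanishes.
theorem exists_tensorBasis {ι κ : Type*} (e : HilbertBasis ι ℝ H) (u : HilbertBasis κ ℝ Y) :
    ∃ B : HilbertBasis (κ × ι) ℝ G, ∀ p, B p = J (e p.2) (u p.1) := by
  classical
  have hon : Orthonormal ℝ fun p : κ × ι => J (e p.2) (u p.1) := by
    rw [orthonormal_iff_ite]
    intro p p'
    rw [hJ, orthonormal_iff_ite.1 e.orthonormal, orthonormal_iff_ite.1 u.orthonormal]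
    simp only [Prod.ext_iff]
    split_ifs <;> simp_all
  refine ⟨HilbertBasis.mkOfOrthogonalEqBot hon ((Submodule.eq_bot_iff _).2 fun F hF => ?_),
    fun p => by rw [HilbertBasis.coe_mkOfOrthogonalEqBot]⟩
  have h1 : ∀ k i, inner ℝ (J (e i) (u k)) F = 0 := fun k i =>
    Submodule.inner_right_of_mem_orthogonal
      (Submodule.subset_span (Set.mem_range_self (k, i))) hF
  have h2 : ∀ k, component J (u k) F = 0 := fun k =>
    ext_inner_hilbertBasis e fun i => by rw [inner_component, h1, inner_zero_right]
  refine RKHS.ext fun x => ext_inner_hilbertBasis u fun k => ?_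
  rw [← component_apply hJk, h2, inner_zero_right]
  simp

include hJk hJ in
-- Parseval in the product basis, summed along fibres. It reduces estimates in `G` to estimates in
-- `H`, one component at a time.
theorem hasSum_norm_component_sq {ι κ : Type*} (e : HilbertBasis ι ℝ H) (u : HilbertBasis κ ℝ Y)
    (F : G) : HasSum (fun k => ‖component J (u k) F‖ ^ 2) (‖F‖ ^ 2) := by
  obtain ⟨B, hB⟩ := exists_tensorBasis hJk hJ e u
  refine (hasSum_inner_sq B F).prod_fiberwise fun k => ?_
  refine (hasSum_inner_sq e (component J (u k) F)).congr_fun fun i => ?_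
  rw [hB, inner_component]

/-- The `L²(q)` norm in terms of the components. -/
theorem eLpNorm_le_of_component {κ : Type*} [Countable κ] [MeasurableSpace X]
    (hJk : ∀ x y, J (feature H x) y = RKHS.kerFun G x y)
    (f : HilbertBasis ℕ ℝ H) (u : HilbertBasis κ ℝ Y)
    (hk : ∀ t : X, Measurable fun x => scalarKernel H x t) {c : ℝ}
    (hc : ∀ x : X, scalarKernel H x x ≤ c ^ 2) (q : Measure X) [IsProbabilityMeasure q] (F : G)
    {b : κ → ℝ} {B : ℝ}
    (hb : ∀ k, inner ℝ (component J (u k) F) (covOp H q (component J (u k) F)) ≤ b k)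
    (hB : HasSum b (B ^ 2)) (hB0 : 0 ≤ B) :
    eLpNorm (fun x => F x) 2 q ≤ ENNReal.ofReal B := by
  have hm : ∀ k, Measurable fun x : X => (component J (u k) F) x := fun k => measurable_eval hk _
  have hpos : ∀ k, 0 ≤ inner ℝ (component J (u k) F) (covOp H q (component J (u k) F)) := by
    intro k
    rw [inner_covOp f hk hc]
    exact integral_nonneg fun x => by
      rw [real_inner_comm]; exact mul_self_nonneg _
  have hint : ∀ k, Integrable (fun x : X => (component J (u k) F) x ^ 2) q := by
    intro k
    refine Integrable.of_bound (C := (|c| * ‖component J (u k) F‖) ^ 2)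
      ((hm k).pow_const 2).aestronglyMeasurable (Filter.Eventually.of_forall fun x => ?_)
    rw [Real.norm_of_nonneg (sq_nonneg _), ← sq_abs]
    refine pow_le_pow_left₀ (abs_nonneg _) ?_ 2
    rw [← inner_feature]
    refine (abs_real_inner_le_norm _ _).trans (mul_le_mul_of_nonneg_right ?_ (norm_nonneg _))
    exact abs_le_of_sq_le_sq' (by rw [norm_feature_sq, sq_abs]; exact hc x) (abs_nonneg _) |>.2
  -- Parseval in `Y` at each x, then Tonelli; the integral of a squared component is its covariance
  -- form.
  have hsum : ∀ x, ‖F x‖ₑ ^ (2 : ℝ) = ∑' k, ENNReal.ofReal ((component J (u k) F) x ^ 2) := by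
    intro x
    have h1 := hasSum_inner_sq u (F x)
    have h2 : HasSum (fun k => (component J (u k) F) x ^ 2) (‖F x‖ ^ 2) := by
      refine h1.congr_fun fun k => ?_
      rw [← inner_feature, component_apply hJk]
    rw [← ENNReal.ofReal_tsum_of_nonneg (fun k => sq_nonneg _) h2.summable, h2.tsum_eq,
      ← ofReal_norm, ENNReal.ofReal_rpow_of_nonneg (norm_nonneg _) (by norm_num)]
    norm_num
  rw [eLpNorm_eq_lintegral_rpow_enorm_toReal (by norm_num) (by norm_num)]
  simp only [ENNReal.toReal_ofNat, hsum]
  rw [lintegral_tsum fun k => ((hm k).pow_const 2).ennreal_ofReal.aemeasurable]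
  have hle : ∑' k, ∫⁻ x, ENNReal.ofReal ((component J (u k) F) x ^ 2) ∂q ≤
      ENNReal.ofReal (B ^ 2) := by
    rw [← hB.tsum_eq, ENNReal.ofReal_tsum_of_nonneg (fun k => (hpos k).trans (hb k)) hB.summable]
    refine ENNReal.tsum_le_tsum fun k => ?_
    rw [← ofReal_integral_eq_lintegral_ofReal (hint k)
      (Filter.Eventually.of_forall fun x => sq_nonneg _)]
    refine ENNReal.ofReal_le_ofReal (le_trans (le_of_eq ?_) (hb k))
    rw [inner_covOp f hk hc]
    refine integral_congr_ae (Filter.Eventually.of_forall fun x => ?_)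
    simp only [real_inner_comm (feature H x), inner_feature, sq]
  calc _ ≤ (ENNReal.ofReal (B ^ 2)) ^ (1 / 2 : ℝ) := by gcongr
    _ = ENNReal.ofReal B := by
      rw [ENNReal.ofReal_rpow_of_nonneg (sq_nonneg _) (by norm_num), ← Real.sqrt_eq_rpow,
        Real.sqrt_sq hB0]

end Components

/-! ### Empirical covariance and its log-determinant -/

section EmpiricalCovariance

variable {H : Type*} [NormedAddCommGroup H] [InnerProductSpace ℝ H]

/-- The empirical covariance operator `(1/n) ∑ w_t ⊗ w_t`. -/
def empCov {n : ℕ} (w : Fin n → H) : H →L[ℝ] H :=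
  (n : ℝ)⁻¹ • ∑ t, InnerProductSpace.rankOne ℝ (w t) (w t)

theorem empCov_apply {n : ℕ} (w : Fin n → H) (v : H) :
    empCov w v = (n : ℝ)⁻¹ • ∑ t, inner ℝ (w t) v • w t := by
  simp only [empCov, smul_apply, sum_apply, InnerProductSpace.rankOne_apply]

theorem inner_empCov {n : ℕ} (w : Fin n → H) (v v' : H) :
    inner ℝ v (empCov w v') = (n : ℝ)⁻¹ * ∑ t, inner ℝ (w t) v * inner ℝ (w t) v' := by
  rw [empCov_apply, real_inner_smul_right, inner_sum]
  congr 1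
  refine Finset.sum_congr rfl fun t _ => ?_
  rw [real_inner_smul_right, real_inner_comm v]
  ring

theorem inner_eq_zero_of_empCov {n : ℕ} (hn : 1 ≤ n) (w : Fin n → H) {e : H}
    (he : empCov w e = 0) (t : Fin n) : inner ℝ (w t) e = 0 := by
  have h := inner_empCov w e e
  rw [he, inner_zero_right] at h
  have hn' : (n : ℝ)⁻¹ ≠ 0 := by positivity
  have h2 := (mul_eq_zero.1 h.symm).resolve_left hn'
  have h3 := (Finset.sum_eq_zero_iff_of_nonneg (fun t _ => mul_self_nonneg _)).1 h2 t
    (Finset.mem_univ t)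
  exact mul_self_eq_zero.1 h3

/-- The tangent to log at m + l lies above the graph; the negative term -m/(m + l) is dropped. -/
theorem log_one_add_div_le {l m s : ℝ} (hl : 0 < l) (hm : 0 ≤ m) (hs : 0 ≤ s) :
    Real.log (1 + s / l) ≤ Real.log (1 + m / l) + s / (m + l) := by
  have hml : 0 < m + l := by linarith
  have e1 : 1 + s / l = (1 + m / l) * ((s + l) / (m + l)) := by field_simp; ring
  have hpos : 0 < (s + l) / (m + l) := by positivity
  rw [e1, Real.log_mul (by positivity) hpos.ne']
  have := Real.log_le_sub_one_of_pos hpos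
  have e2 : (s + l) / (m + l) - 1 = s / (m + l) - m / (m + l) := by field_simp; ring
  have : 0 ≤ m / (m + l) := by positivity
  linarith

/-- The log-determinant of `1 + C_z / l` is controlled by that of `1 + C / l`. -/
theorem sum_log_le {n : ℕ} {w : Fin n → H} {ι : Type*} {e : HilbertBasis ι ℝ H}
    {σ : ι → ℝ} (hσ0 : ∀ i, 0 ≤ σ i) (hσ : IsDiag e σ (empCov w)) (F : Finset ι)
    {κ : Type*} {f : HilbertBasis κ ℝ H} {μ : κ → ℝ} (hμ : ∀ j, 0 ≤ μ j) {l : ℝ} (hl : 0 < l)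
    {ℓ : ℝ} (hℓ : HasSum (fun j => Real.log (1 + μ j / l)) ℓ) {D : H →L[ℝ] H}
    (hD : IsDiag f (fun j => (√(μ j + l))⁻¹) D) :
    ∑ i ∈ F, Real.log (1 + σ i / l) ≤ ℓ + (n : ℝ)⁻¹ * ∑ t, ‖D (w t)‖ ^ 2 := by
  -- Each logarithm is spread over the basis f with weights ⟪f_j, e_i⟫² of sum 1. For every j the
  -- tangent inequality is then used at m = μ_j, so no common eigenbasis is required.
  have h1 : HasSum (fun j => ∑ i ∈ F, Real.log (1 + σ i / l) * inner ℝ (f j) (e i) ^ 2)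
      (∑ i ∈ F, Real.log (1 + σ i / l)) := by
    refine hasSum_sum fun i _ => ?_
    have := (hasSum_inner_sq f (e i)).mul_left (Real.log (1 + σ i / l))
    rwa [e.orthonormal.1, one_pow, mul_one] at this
  have h2 : HasSum (fun j => (n : ℝ)⁻¹ * ∑ t, (√(μ j + l))⁻¹ ^ 2 * inner ℝ (f j) (w t) ^ 2)
      ((n : ℝ)⁻¹ * ∑ t, ‖D (w t)‖ ^ 2) :=
    (hasSum_sum fun t _ => hD.hasSum_sq (w t)).mul_left _
  refine hasSum_le (fun j => ?_) h1 (hℓ.add h2)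
  have hml : 0 < μ j + l := by linarith [hμ j]
  -- Bessel bounds the weight of log(1 + μ_j/l), and the partial spectral sum of ⟪f_j, C_z f_j⟫
  -- bounds the weight of 1/(μ_j + l).
  have h3 : ∑ i ∈ F, inner ℝ (f j) (e i) ^ 2 ≤ 1 := by
    have := sum_le_hasSum F (fun i _ => sq_nonneg _) (hasSum_inner_sq e (f j))
    rw [f.orthonormal.1, one_pow] at this
    simpa only [real_inner_comm] using this
  have h4 : ∑ i ∈ F, σ i * inner ℝ (f j) (e i) ^ 2 ≤
      (n : ℝ)⁻¹ * ∑ t, inner ℝ (f j) (w t) ^ 2 := by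
    have := sum_le_hasSum F (fun i _ => mul_nonneg (hσ0 i) (sq_nonneg _)) (hσ.hasSum_inner (f j))
    rw [real_inner_comm, inner_empCov] at this
    simpa only [real_inner_comm, ← sq] using this
  have hlog : 0 ≤ Real.log (1 + μ j / l) := Real.log_nonneg (by
    have := div_nonneg (hμ j) hl.le; linarith)
  calc ∑ i ∈ F, Real.log (1 + σ i / l) * inner ℝ (f j) (e i) ^ 2
      ≤ ∑ i ∈ F, (Real.log (1 + μ j / l) * inner ℝ (f j) (e i) ^ 2 +
          (μ j + l)⁻¹ * (σ i * inner ℝ (f j) (e i) ^ 2)) := by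
        refine Finset.sum_le_sum fun i _ => ?_
        have := mul_le_mul_of_nonneg_right (log_one_add_div_le hl (hμ j) (hσ0 i))
          (sq_nonneg (inner ℝ (f j) (e i)))
        refine this.trans (le_of_eq ?_)
        ring
    _ = Real.log (1 + μ j / l) * ∑ i ∈ F, inner ℝ (f j) (e i) ^ 2 +
          (μ j + l)⁻¹ * ∑ i ∈ F, σ i * inner ℝ (f j) (e i) ^ 2 := by
        rw [Finset.sum_add_distrib, Finset.mul_sum, Finset.mul_sum]
    _ ≤ Real.log (1 + μ j / l) * 1 + (μ j + l)⁻¹ *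
          ((n : ℝ)⁻¹ * ∑ t, inner ℝ (f j) (w t) ^ 2) := by
        gcongr
    _ = _ := by
        rw [mul_one, inv_pow, Real.sq_sqrt hml.le, ← Finset.mul_sum]
        ring

end EmpiricalCovariance

/-! ### Spectral form of the final ridge state -/

section Ridge

variable {H Y G : Type*} [NormedAddCommGroup H] [InnerProductSpace ℝ H] [CompleteSpace H]
  [NormedAddCommGroup Y] [InnerProductSpace ℝ Y] [CompleteSpace Y]
  [NormedAddCommGroup G] [InnerProductSpace ℝ G] [CompleteSpace G]
  {J : H →L[ℝ] Y →L[ℝ] G}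
  (hJ : ∀ h h' y y', inner ℝ (J h y) (J h' y') = inner ℝ h h' * inner ℝ y y')
  {Z : Type*} {obs : Z → H × Y}

include hJ in
/-- Spectral description of the final state of online ridge regression. -/
theorem exists_spectral_ridge {n : ℕ} (hn : 1 ≤ n) (z : Fin n → Z) {l : ℝ} (hl : 0 < l) :
    ∃ (s : Set H) (e : HilbertBasis s ℝ H) (σ : s → ℝ) (F : Finset s),
      IsDiag e σ (empCov fun t => (obs (z t)).1) ∧ (∀ i, 0 ≤ σ i) ∧ (∀ i ∉ F, σ i = 0) ∧
      (seqFold (fun s z => s.step J (obs z)) n (RidgeState.init H G (n * l)) z).P ≤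
        ∑ i ∈ F, Real.log (1 + σ i / l) ∧
      ∀ {κ : Type _} (u : κ → Y) (B : HilbertBasis (κ × s) ℝ G),
        (∀ p, B p = J (e p.2) (u p.1)) →
        HasSum (fun p : κ × s => inner ℝ (J (e p.2) (u p.1))
            ((n : ℝ)⁻¹ • ∑ t, J (obs (z t)).1 (obs (z t)).2) ^ 2 / (σ p.2 + l))
          ((n : ℝ)⁻¹ *
            (seqFold (fun s z => s.step J (obs z)) n (RidgeState.init H G (n * l)) z).energy) := by
  have hn0 : (0 : ℝ) < n := by exact_mod_cast hn
  have hc : 0 < n * l := by positivity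
  set w : Fin n → H := fun t => (obs (z t)).1 with hw
  have hT : ∀ v, ((n : ℝ) • empCov w) v = ∑ t, inner ℝ (w t) v • w t := fun v => by
    rw [smul_apply, empCov_apply, smul_smul, mul_inv_cancel₀ hn0.ne', one_smul]
  -- The ridge state inverts n C_z + n l, so the eigenvalues τ are n times those of C_z.
  obtain ⟨s, e, τ, F, hτ, hτ0, hτF, hcard, hdet⟩ :=
    exists_hilbertBasis_of_sum_rankOne w ((n : ℝ) • empCov w) hT (n * l)
  set st := seqFold (fun s z => s.step J (obs z)) n (RidgeState.init H G (n * l)) z with hst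
  have hinv := (RidgeState.isInverse_init (H := H) (G := G) J hc).seqFold (obs := obs) hJ hc n z
  rw [← hst] at hinv
  refine ⟨s, e, fun i => τ i / n, F, fun i v => ?_, fun i => div_nonneg (hτ0 i) hn0.le,
    fun i hi => by simp only [hτF i hi, zero_div], ?_, fun u B hB => ?_⟩
  · have := hτ i v
    rw [smul_apply, real_inner_smul_right] at this
    rw [div_mul_eq_mul_div, ← this, mul_div_cancel_left₀ _ hn0.ne']
  · set E := Submodule.span ℝ (Set.range w) with hE
    have hfd : FiniteDimensional ℝ E :=
      FiniteDimensional.span_of_finite ℝ (Set.finite_range w)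
    have hTE : ∀ v, ((n : ℝ) • empCov w) v ∈ E := fun v => by
      rw [hT]
      exact Submodule.sum_mem _ fun t _ => Submodule.smul_mem _ _ (Submodule.subset_span ⟨t, rfl⟩)
    let VE : E →ₗ[ℝ] E := (n * l) • LinearMap.id
    let VE' : E →ₗ[ℝ] E := (n * l) • LinearMap.id +
      (((n : ℝ) • empCov w).toLinearMap.codRestrict E hTE) ∘ₗ E.subtype
    have hVE' : ∀ v : E, (VE' v : H) = (n * l) • (v : H) + ((n : ℝ) • empCov w) v := fun v => rfl
    have hdVE : LinearMap.det VE = (n * l) ^ F.card := by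
      rw [LinearMap.det_smul, LinearMap.det_id, mul_one, hcard]
    have hP := (RidgeState.P_seqFold_le (obs := obs) hJ hc E n
      (RidgeState.isInverse_init (H := H) (G := G) J hc) z
      (fun t => Submodule.subset_span ⟨t, rfl⟩) VE VE' (fun v => by simp [VE])
      (fun v => by rw [hVE', hT]; simp [hw]) (by rw [hdVE]; positivity)).2
    rw [← hst] at hP
    refine hP.trans (le_of_eq ?_)
    have hpos : ∀ i, 0 < n * l + τ i := fun i => by linarith [hτ0 i]
    rw [hdet VE' hVE', hdVE, Real.log_prod (fun i _ => (hpos i).ne'), Real.log_pow]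
    simp only [RidgeState.init, zero_add]
    have h2 : (F.card : ℝ) * Real.log (n * l) = ∑ i ∈ F, Real.log (n * l) := by
      rw [Finset.sum_const, nsmul_eq_mul]
    rw [h2, ← Finset.sum_sub_distrib]
    refine Finset.sum_congr rfl fun i _ => ?_
    rw [← Real.log_div (hpos i).ne' hc.ne']
    congr 1
    field_simp
  -- The inverse is diagonal with entries 1/(n l + τ_i), so the energy divided by n is the squared
  -- norm of N = S/n weighted by 1/(σ + l).
  · have hR : ∀ i, st.R (e i) = (n * l + τ i)⁻¹ • e i := fun i => by
      have hpos : 0 < n * l + τ i := by linarith [hτ0 i]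
      refine hinv.injective hc ?_
      rw [hinv.inv, map_smul]
      have h1 : (∑ t, InnerProductSpace.rankOne ℝ (obs (z t)).1 (obs (z t)).1) (e i) =
          τ i • e i := by
        rw [← hτ.apply_basis i, hT, sum_apply]
        rfl
      rw [add_apply, h1, smul_apply, ContinuousLinearMap.id_apply, ← add_smul, smul_smul,
        inv_mul_cancel₀ hpos.ne', one_smul]
    have hS : st.S = ∑ t, J (obs (z t)).1 (obs (z t)).2 := by
      rw [hst, RidgeState.S_seqFold]
      simp [RidgeState.init]
    have h1 := (B.hasSum_inner_mul_inner st.S (st.RG st.S)).mul_left ((n : ℝ)⁻¹)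
    refine h1.congr_fun fun p => ?_
    have hpos : 0 < n * l + τ p.2 := by linarith [hτ0 p.2]
    have hpos' : 0 < τ p.2 / n + l := by have := div_nonneg (hτ0 p.2) hn0.le; linarith
    rw [hB, ← hinv.symmG, hinv.lift, hR, map_smul, smul_apply, real_inner_smul_left,
      real_inner_smul_right, ← hS, real_inner_comm st.S]
    have h3 : τ p.2 / n + l = (n * l + τ p.2) / n := by field_simp; ring
    have hne := hpos.ne'
    rw [h3]
    field_simp

end Ridge

/-! ### The estimator in the eigenbasis of the empirical covariance -/

section Sample

variable {X Y H G : Type*} [NormedAddCommGroup Y] [InnerProductSpace ℝ Y] [CompleteSpace Y]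
  [NormedAddCommGroup H] [InnerProductSpace ℝ H] [CompleteSpace H] [RKHS ℝ H X ℝ]
  [NormedAddCommGroup G] [InnerProductSpace ℝ G] [CompleteSpace G] [RKHS ℝ G X Y]

/-- The weighted feature `√β(x) φ(x)`. -/
def wFeature (H : Type*) {X : Type*} [NormedAddCommGroup H] [InnerProductSpace ℝ H]
    [CompleteSpace H] [RKHS ℝ H X ℝ] (β : X → ℝ) (x : X) : H := √(β x) • feature H x

/-- The weighted residual `√β(x) (y - f(x))`. -/
def wResidual (β : X → ℝ) (F : G) (z : X × Y) : Y := √(β z.1) • (z.2 - F z.1)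

variable {J : H →L[ℝ] Y →L[ℝ] G} (hJx : ∀ h y x, J h y x = h x • y)
  (hJk : ∀ x y, J (feature H x) y = RKHS.kerFun G x y)
  (hJ : ∀ h h' y y', inner ℝ (J h y) (J h' y') = inner ℝ h h' * inner ℝ y y')
  {β : X → ℝ} (hβ : ∀ x, 0 ≤ β x) {n : ℕ} (z : Fin n → X × Y)

include hβ in
theorem inner_wFeature_mul (x : X) (h h' : H) :
    inner ℝ (wFeature H β x) h * inner ℝ (wFeature H β x) h' = β x * (h x * h' x) := by
  rw [wFeature, real_inner_smul_left, real_inner_smul_left, inner_feature, inner_feature]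
  calc _ = (√(β x) * √(β x)) * (h x * h' x) := by ring
    _ = _ := by rw [Real.mul_self_sqrt (hβ x)]

include hβ in
theorem norm_wFeature_sq (x : X) : ‖wFeature H β x‖ ^ 2 = β x * scalarKernel H x x := by
  rw [wFeature, norm_smul, mul_pow, Real.norm_eq_abs, sq_abs, Real.sq_sqrt (hβ x),
    norm_feature_sq]

theorem empOp_apply (F : G) : empOp G β z F =
    (n : ℝ)⁻¹ • ∑ i, β (z i).1 • RKHS.kerFun G (z i).1 (F (z i).1) := by
  simp only [empOp, smul_apply, sum_apply, ContinuousLinearMap.comp_apply, RKHS.adjoint_kerFun]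

theorem empOp_symm (F F' : G) : inner ℝ (empOp G β z F) F' = inner ℝ F (empOp G β z F') := by
  simp only [empOp_apply, real_inner_smul_left, real_inner_smul_right, sum_inner, inner_sum,
    RKHS.kerFun_inner, RKHS.inner_kerFun]

include hβ hJx hJk in
theorem empOp_tensor (h : H) (y : Y) :
    empOp G β z (J h y) = J (empCov (fun t => wFeature H β (z t).1) h) y := by
  rw [empOp_apply, empCov_apply]
  simp only [map_smul, map_sum, smul_apply, sum_apply]
  congr 1
  refine Finset.sum_congr rfl fun t _ => ?_
  rw [hJx, wFeature, map_smul, map_smul, smul_apply, hJk, real_inner_smul_left, inner_feature,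
    smul_smul, smul_smul, mul_right_comm, Real.mul_self_sqrt (hβ _)]

include hβ hJx hJk in
theorem component_empOp (F : G) (y : Y) :
    component J y (empOp G β z F) =
      empCov (fun t => wFeature H β (z t).1) (component J y F) := by
  refine ext_inner_left ℝ fun h => ?_
  rw [inner_component, ← empOp_symm, empOp_tensor hJx hJk hβ, ← inner_component, real_inner_comm,
    inner_empCov, inner_empCov]
  congr 1
  exact Finset.sum_congr rfl fun t _ => mul_comm _ _

include hβ hJk in
theorem empRhs_sub_empOp (F : G) : empRhs G β z - empOp G β z F =
    (n : ℝ)⁻¹ • ∑ t, J (wFeature H β (z t).1) (wResidual β F (z t)) := by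
  rw [empOp_apply, empRhs, ← smul_sub, ← Finset.sum_sub_distrib]
  congr 1
  refine Finset.sum_congr rfl fun t _ => ?_
  rw [← smul_sub, ← map_sub, wFeature, wResidual, map_smul, map_smul, smul_apply, smul_smul,
    Real.mul_self_sqrt (hβ _), hJk]

variable {ι κ : Type*} {e : HilbertBasis ι ℝ H} {σ : ι → ℝ} {F : Finset ι}
  (hσ : IsDiag e σ (empCov fun t => wFeature H β (z t).1)) (hF : ∀ i ∉ F, σ i = 0)

include hβ hJx hJk hJ hσ hF in
theorem inner_component_estimator (u : HilbertBasis κ ℝ Y) (g : ℝ → ℝ → ℝ) (l : ℝ) (y : Y)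
    (i : ι) : inner ℝ (e i) (component J y (estimator G β g l z)) =
      g l (σ i) * inner ℝ (e i) (component J y (empRhs G β z)) := by
  classical
  have heig : ∀ y i, empOp G β z (J (e i) y) = σ i • J (e i) y := fun y i => by
    rw [empOp_tensor hJx hJk hβ, hσ.apply_basis, map_smul, smul_apply]
  obtain ⟨B, hB⟩ := exists_tensorBasis hJk hJ e u
  -- The product basis diagonalizes the empirical operator, whose eigenvalues are among 0 and the
  -- σ_i with i in F. So the series defining the filter has finitely many nonzero terms.
  have hs := summable_spectralFun (g := g l) (T := empOp G β z) (insert 0 (F.image σ))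
    (fun τ v hv hv0 => by
      obtain ⟨p, hp⟩ : ∃ p, inner ℝ (B p) v ≠ 0 := by
        by_contra hcon
        push Not at hcon
        exact hv0 (ext_inner_hilbertBasis B fun p => by rw [hcon, inner_zero_right])
      have h1 := empOp_symm (β := β) z (B p) v
      rw [hv, hB, heig, real_inner_smul_left, real_inner_smul_right, ← hB] at h1
      have h2 := mul_right_cancel₀ hp h1
      rw [← h2]
      by_cases hpF : p.2 ∈ F
      · exact Finset.mem_insert_of_mem (Finset.mem_image_of_mem _ hpF)
      · rw [hF _ hpF]; exact Finset.mem_insert_self _ _)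
  rw [inner_component, estimator, inner_spectralFun hs (empOp_symm z) (heig y i),
    inner_component]

include hβ hJx hJk hJ hσ hF in
/-- Bias-variance decomposition of the error in the eigenbasis of the empirical covariance. -/
theorem inner_component_error (u : HilbertBasis κ ℝ Y) (g : ℝ → ℝ → ℝ) (l : ℝ) (f : G) (y : Y)
    (i : ι) : inner ℝ (e i) (component J y (f - estimator G β g l z)) =
      (1 - σ i * g l (σ i)) * inner ℝ (e i) (component J y f) -
      g l (σ i) * inner ℝ (J (e i) y)
        ((n : ℝ)⁻¹ • ∑ t, J (wFeature H β (z t).1) (wResidual β f (z t))) := by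
  have h1 := congrArg (fun v => inner ℝ (e i) (component J y v))
    (empRhs_sub_empOp hJk hβ z f)
  simp only [map_sub, inner_sub_right, component_empOp hJx hJk hβ, hσ i] at h1
  rw [inner_component y (e i) ((n : ℝ)⁻¹ • _)] at h1
  rw [map_sub, inner_sub_right, inner_component_estimator hJx hJk hJ hβ z hσ hF u, ← h1]
  ring

include hJ hσ in
-- A null vector of C_z is orthogonal to every w_t. This is needed because nothing bounds the filter
-- at 0: its estimates hold only on (0, s].
theorem inner_noise_eq_zero (hn : 1 ≤ n) (f : G) (y : Y) {i : ι} (hi : σ i = 0) :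
    inner ℝ (J (e i) y)
        ((n : ℝ)⁻¹ • ∑ t, J (wFeature H β (z t).1) (wResidual β f (z t))) = 0 := by
  have h0 : empCov (fun t => wFeature H β (z t).1) (e i) = 0 := by
    rw [hσ.apply_basis, hi, zero_smul]
  rw [real_inner_smul_right, inner_sum]
  refine mul_eq_zero_of_right _ (Finset.sum_eq_zero fun t _ => ?_)
  rw [hJ, real_inner_comm, inner_eq_zero_of_empCov hn _ h0 t, zero_mul]

end Sample

/-! ### Concentration of the empirical covariance -/

section Concentration

variable {Z : Type*} [MeasurableSpace Z] (μ : Measure Z) [IsProbabilityMeasure μ]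

/-- Chernoff bound for sums of bounded nonnegative variables. -/
theorem measure_sum_gt_le {φ : Z → ℝ} (hφ : Measurable φ) {B m : ℝ} (hB : 0 < B)
    (h0 : ∀ z, 0 ≤ φ z) (hφB : ∀ z, φ z ≤ B) (hm : ∫ z, φ z ∂μ ≤ m) (n : ℕ) (L : ℝ) :
    Measure.pi (fun _ : Fin n => μ) {z | 2 * n * m + B * L < ∑ i, φ (z i)} ≤
      ENNReal.ofReal (Real.exp (-L)) := by
  have hint : Integrable φ μ := Integrable.of_bound (C := B) hφ.aestronglyMeasurable
    (Filter.Eventually.of_forall fun z => by rw [Real.norm_of_nonneg (h0 z)]; exact hφB z)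
  have hmeas : ∀ (n : ℕ) (s : ℝ), Measurable fun z : Fin n → Z =>
      ENNReal.ofReal (Real.exp ((s + ∑ i, φ (z i)) / B)) := fun n s =>
    (((Finset.measurable_sum _ fun i _ => hφ.comp (measurable_pi_apply i)).const_add
      s).div_const B).exp.ennreal_ofReal
  have hfold := lintegral_seqFold_le μ (fun s z => s + φ z) (fun _ : ℝ => True)
    (fun _ _ _ => trivial) (fun s => ENNReal.ofReal (Real.exp (s / B)))
    (ENNReal.ofReal (Real.exp (2 * m / B)))
    (fun n s _ => by simp_rw [seqFold_add φ]; exact hmeas n s)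
    (fun s _ => by
      -- On [0, 1] one has exp x ≤ 1 + x + x² ≤ 1 + 2x, which is the origin of the factor 2 before
      -- the mean.
      have hpt : ∀ z, Real.exp ((s + φ z) / B) ≤ Real.exp (s / B) * (1 + 2 * (φ z / B)) := by
        intro z
        have h1 : 0 ≤ φ z / B := div_nonneg (h0 z) hB.le
        have h2 : φ z / B ≤ 1 := div_le_one_of_le₀ (hφB z) hB.le
        have h3 := exp_sub_one_sub_le_sq h1 h2
        rw [add_div, Real.exp_add]
        exact mul_le_mul_of_nonneg_left (by nlinarith) (Real.exp_pos _).le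
      have hint2 : Integrable (fun z => Real.exp (s / B) * (1 + 2 * (φ z / B))) μ :=
        ((integrable_const 1).add ((hint.div_const B).const_mul 2)).const_mul _
      calc ∫⁻ z, ENNReal.ofReal (Real.exp ((s + φ z) / B)) ∂μ
          ≤ ∫⁻ z, ENNReal.ofReal (Real.exp (s / B) * (1 + 2 * (φ z / B))) ∂μ :=
            lintegral_mono fun z => ENNReal.ofReal_le_ofReal (hpt z)
        _ = ENNReal.ofReal (∫ z, Real.exp (s / B) * (1 + 2 * (φ z / B)) ∂μ) :=
            (ofReal_integral_eq_lintegral_ofReal hint2 (Filter.Eventually.of_forall fun z =>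
              (Real.exp_pos _).le.trans (hpt z))).symm
        _ ≤ ENNReal.ofReal (Real.exp (2 * m / B) * Real.exp (s / B)) := by
            refine ENNReal.ofReal_le_ofReal ?_
            rw [integral_const_mul, mul_comm]
            refine mul_le_mul_of_nonneg_right ?_ (Real.exp_pos _).le
            rw [integral_add (integrable_const 1) ((hint.div_const B).const_mul 2),
              integral_const_mul, integral_div]
            simp only [integral_const, probReal_univ, smul_eq_mul, mul_one]
            have h4 := Real.add_one_le_exp (2 * m / B)
            have h5 : (∫ z, φ z ∂μ) / B ≤ m / B := by gcongr
            have h6 : 2 * m / B = 2 * (m / B) := by ring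
            linarith
        _ = _ := ENNReal.ofReal_mul (Real.exp_pos _).le) n 0 trivial
  simp_rw [seqFold_add φ] at hfold
  rw [zero_div, Real.exp_zero, ENNReal.ofReal_one, mul_one] at hfold
  have hpos := Real.exp_pos ((2 * n * m + B * L) / B)
  have hsub : {z : Fin n → Z | 2 * n * m + B * L < ∑ i, φ (z i)} ⊆
      {z | ENNReal.ofReal (Real.exp ((2 * n * m + B * L) / B)) ≤
        ENNReal.ofReal (Real.exp ((0 + ∑ i, φ (z i)) / B))} := by
    intro z hz
    rw [Set.mem_ofPred_eq] at hz
    refine ENNReal.ofReal_le_ofReal (Real.exp_le_exp.2 ?_)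
    rw [zero_add]
    gcongr
  refine (measure_mono hsub).trans ?_
  refine (meas_ge_le_lintegral_div (hmeas n 0).aemeasurable
    (ENNReal.ofReal_pos.2 hpos).ne' ENNReal.ofReal_ne_top).trans ?_
  refine (ENNReal.div_le_div_right hfold _).trans ?_
  rw [← ENNReal.ofReal_pow (Real.exp_pos _).le, ← ENNReal.ofReal_div_of_pos hpos,
    ← Real.exp_nat_mul, ← Real.exp_sub]
  refine ENNReal.ofReal_le_ofReal (Real.exp_le_exp.2 (le_of_eq ?_))
  field_simp
  ring

variable {H : Type*} [NormedAddCommGroup H] [InnerProductSpace ℝ H]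

open scoped TensorProduct in
/-- Bernstein inequality for the empirical covariance operator. -/
theorem measure_covariance_dev_le {v : Z → H} (hv : StronglyMeasurable v) {R τ : ℝ}
    (hR : ∀ z, ‖v z‖ ^ 2 ≤ R) (hτ : ∫ z, ‖v z‖ ^ 2 ∂μ ≤ τ) {θ : ℝ} (hθ : 0 ≤ θ)
    (hθR : θ * (2 * R) ≤ 1) (n : ℕ) (t : ℝ) :
    Measure.pi (fun _ : Fin n => μ) {z | ∃ h h', t * (‖h‖ * ‖h'‖) <
        |∑ i, inner ℝ h (v (z i)) * inner ℝ h' (v (z i)) -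
          n * ∫ z, inner ℝ h (v z) * inner ℝ h' (v z) ∂μ|} ≤
      ENNReal.ofReal (2 * Real.exp (-(θ * t) + n * θ ^ 2 * (R * τ))) := by
  -- Rank one operators are treated as vectors v ⊗ v in the completed Hilbert tensor square, where
  -- ‖v ⊗ v‖ = ‖v‖² and pairing with h ⊗ h' yields the bilinear form. Hilbert space Bernstein then
  -- controls all h, h' at once.
  let K := UniformSpace.Completion (H ⊗[ℝ] H)
  let V : Z → K := fun z => ((v z ⊗ₜ[ℝ] v z : H ⊗[ℝ] H) : K)
  have hVm : StronglyMeasurable V := by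
    have hc : Continuous fun x : H => ((x ⊗ₜ[ℝ] x : H ⊗[ℝ] H) : K) :=
      (UniformSpace.Completion.continuous_coe _).comp
        (TensorProduct.continuous_tmul.comp (continuous_id.prodMk continuous_id))
    exact hc.comp_stronglyMeasurable hv
  have hVn : ∀ z, ‖V z‖ = ‖v z‖ ^ 2 := fun z => by
    refine (UniformSpace.Completion.norm_coe (v z ⊗ₜ[ℝ] v z : H ⊗[ℝ] H)).trans ?_
    rw [TensorProduct.norm_tmul, sq]
  have hVi : ∀ h h' z, inner ℝ ((h ⊗ₜ[ℝ] h' : H ⊗[ℝ] H) : K) (V z) =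
      inner ℝ h (v z) * inner ℝ h' (v z) := fun h h' z => by
    simp only [V, UniformSpace.Completion.inner_coe, TensorProduct.inner_tmul]
  have hVint : Integrable V μ := Integrable.of_bound (C := R) hVm.aestronglyMeasurable
    (Filter.Eventually.of_forall fun z => by rw [hVn]; exact hR z)
  set m := ∫ z, V z ∂μ with hm
  have hmn : ‖m‖ ≤ R := by
    have := norm_integral_le_of_norm_le_const (μ := μ) (f := V) (C := R)
      (Filter.Eventually.of_forall fun z => by rw [hVn]; exact hR z)
    simpa using this
  have hsqint : Integrable (fun z => ‖V z‖ ^ 2) μ := by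
    refine Integrable.of_bound (C := R ^ 2) (hVm.norm.measurable.pow_const 2).aestronglyMeasurable
      (Filter.Eventually.of_forall fun z => ?_)
    rw [Real.norm_of_nonneg (sq_nonneg _)]
    exact pow_le_pow_left₀ (norm_nonneg _) (by rw [hVn]; exact hR z) 2
  have hvint : Integrable (fun z => ‖v z‖ ^ 2) μ :=
    hVint.norm.congr (Filter.Eventually.of_forall hVn)
  obtain ⟨z₀⟩ : Nonempty Z := μ.nonempty_of_neZero
  have hR0 : 0 ≤ R := (sq_nonneg _).trans (hR z₀)
  -- The variance is at most the second moment E‖v‖⁴ ≤ R E‖v‖².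
  have hvar : ∫ z, ‖V z - m‖ ^ 2 ∂μ ≤ R * τ := by
    have h1 : ∀ z, ‖V z - m‖ ^ 2 = ‖V z‖ ^ 2 - 2 * inner ℝ m (V z) + ‖m‖ ^ 2 := fun z => by
      rw [norm_sub_sq_real, real_inner_comm]
    have hii : Integrable (fun z => 2 * inner ℝ m (V z)) μ :=
      (hVint.const_inner m).const_mul 2
    have hsub : Integrable (fun z => ‖V z‖ ^ 2 - 2 * inner ℝ m (V z)) μ := hsqint.sub hii
    simp_rw [h1]
    rw [integral_add hsub (integrable_const _), integral_sub hsqint hii,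
      integral_const_mul, integral_inner hVint, ← hm, real_inner_self_eq_norm_sq]
    simp only [integral_const, probReal_univ, smul_eq_mul, one_mul]
    have h2 : ∫ z, ‖V z‖ ^ 2 ∂μ ≤ R * ∫ z, ‖v z‖ ^ 2 ∂μ := by
      rw [← integral_const_mul]
      refine integral_mono hsqint (hvint.const_mul R) fun z => ?_
      simp only [hVn, sq (‖v z‖ ^ 2)]
      exact mul_le_mul_of_nonneg_right (hR z) (sq_nonneg _)
    have h3 : R * ∫ z, ‖v z‖ ^ 2 ∂μ ≤ R * τ := mul_le_mul_of_nonneg_left hτ hR0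
    nlinarith [sq_nonneg ‖m‖]
  have key := measure_norm_sum_ge_le μ (X := fun z => V z - m) (hVm.sub stronglyMeasurable_const)
    (R := 2 * R) (fun z => (norm_sub_le _ _).trans (by
      have := hVn z; have := hR z; linarith))
    (by rw [integral_sub hVint (integrable_const _), ← hm]; simp) hvar hθ hθR n t
  refine (measure_mono ?_).trans key
  rintro z ⟨h, h', hz⟩
  rw [Set.mem_ofPred_eq]
  have e1 : inner ℝ ((h ⊗ₜ[ℝ] h' : H ⊗[ℝ] H) : K) (∑ i, (V (z i) - m)) =
      ∑ i, inner ℝ h (v (z i)) * inner ℝ h' (v (z i)) -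
          n * ∫ z, inner ℝ h (v z) * inner ℝ h' (v z) ∂μ := by
    simp only [inner_sum, inner_sub_right, hVi, Finset.sum_sub_distrib, Finset.sum_const,
      Finset.card_univ, Fintype.card_fin]
    rw [← Nat.cast_smul_eq_nsmul ℝ, real_inner_smul_right, hm, ← integral_inner hVint]
    simp only [hVi]
  rw [← e1] at hz
  have h2 := abs_real_inner_le_norm ((h ⊗ₜ[ℝ] h' : H ⊗[ℝ] H) : K) (∑ i, (V (z i) - m))
  rw [UniformSpace.Completion.norm_coe, TensorProduct.norm_tmul, mul_comm (‖h‖ * ‖h'‖)] at h2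
  by_contra hlt
  have := mul_le_mul_of_nonneg_right (not_le.1 hlt).le
    (mul_nonneg (norm_nonneg h) (norm_nonneg h'))
  linarith

variable {w : Z → H} (hw : StronglyMeasurable w) {R : ℝ} (hR : ∀ z, ‖w z‖ ^ 2 ≤ R)
  {C : H →L[ℝ] H} (hC : ∀ h h', ∫ z, inner ℝ h (w z) * inner ℝ h' (w z) ∂μ = inner ℝ h (C h'))
  {f : HilbertBasis ℕ ℝ H} {m : ℕ → ℝ} (hm : ∀ j, 0 ≤ m j) (hCm : IsDiag f m C)

include hw hR hC hCm in
-- This is E‖D w‖² = tr(D C D); for D = (C + l)^(-1/2) the value is the effective dimension.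
theorem integral_norm_sq_diag {D : H →L[ℝ] H} {d : ℕ → ℝ} (hD : IsDiag f d D) {N : ℝ}
    (hN : HasSum (fun j => d j ^ 2 * m j) N) : ∫ z, ‖D (w z)‖ ^ 2 ∂μ = N := by
  have hm1 : ∀ h, StronglyMeasurable fun z => inner ℝ h (w z) := fun h =>
    stronglyMeasurable_const.inner hw
  have hint : ∀ j, Integrable (fun z => d j ^ 2 * inner ℝ (f j) (w z) ^ 2) μ := by
    intro j
    refine Integrable.const_mul (Integrable.of_bound (C := R)
      ((hm1 (f j)).measurable.pow_const 2).aestronglyMeasurable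
      (Filter.Eventually.of_forall fun z => ?_)) _
    rw [Real.norm_of_nonneg (sq_nonneg _)]
    refine le_trans ?_ (hR z)
    rw [← sq_abs]
    refine pow_le_pow_left₀ (abs_nonneg _) ?_ 2
    simpa [f.orthonormal.1] using abs_real_inner_le_norm (f j) (w z)
  have hval : ∀ j, ∫ z, d j ^ 2 * inner ℝ (f j) (w z) ^ 2 ∂μ = d j ^ 2 * m j := by
    intro j
    have := hC (f j) (f j)
    rw [hCm, real_inner_self_eq_norm_sq, f.orthonormal.1, one_pow, mul_one] at this
    rw [integral_const_mul]
    simp only [sq (inner ℝ (f j) _), this]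
  have key := hasSum_integral_of_summable_integral_norm hint (by
    refine hN.summable.congr fun j => ?_
    rw [← hval j]
    refine integral_congr_ae (Filter.Eventually.of_forall fun z => ?_)
    exact (Real.norm_of_nonneg (by positivity)).symm)
  simp only [hval] at key
  rw [hN.unique key]
  refine integral_congr_ae (Filter.Eventually.of_forall fun z => ?_)
  exact ((hD.hasSum_sq (w z)).tsum_eq).symm

include hw hR hC hm hCm in
/-- With high probability, `C ≤ 2 C_z + l`. -/
theorem measure_covariance_gt_le {l N L : ℝ} (hl : 0 < l) {n : ℕ} (hn : 1 ≤ n)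
    (hN : HasSum (fun j => m j / (m j + l)) N) (hR0 : 0 < R)
    (hL : 16 * R * (1 + N) * L ≤ n * l) :
    Measure.pi (fun _ : Fin n => μ) {z | ∃ h, 2 * inner ℝ h (empCov (fun i => w (z i)) h) +
        l * ‖h‖ ^ 2 < inner ℝ h (C h)} ≤ ENNReal.ofReal (2 * Real.exp (-L)) := by
  have hml : ∀ j, 0 < m j + l := fun j => by linarith [hm j]
  have hn0 : (0 : ℝ) < n := by exact_mod_cast hn
  have hN0 : 0 ≤ N := hN.nonneg fun j => div_nonneg (hm j) (hml j).le
  obtain ⟨D, hD⟩ := exists_isDiag f (fun j => (√(m j + l))⁻¹) (K := (√l)⁻¹) fun j => by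
    rw [abs_of_nonneg (by positivity)]
    exact inv_anti₀ (Real.sqrt_pos.2 hl) (Real.sqrt_le_sqrt (by linarith [hm j]))
  have hmC : ∀ j, |√(m j + l)| ≤ √(‖C‖ + l) := fun j => by
    rw [abs_of_nonneg (Real.sqrt_nonneg _)]
    refine Real.sqrt_le_sqrt (add_le_add_left ?_ l)
    have h1 := C.le_opNorm (f j)
    rwa [hCm.apply_basis, norm_smul, f.orthonormal.1, mul_one, mul_one,
      Real.norm_of_nonneg (hm j)] at h1
  obtain ⟨E, hE⟩ := exists_isDiag f (fun j => √(m j + l)) hmC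
  have hDE : ∀ h, D (E h) = h := fun h => ext_inner_hilbertBasis f fun j => by
    rw [hD, hE, ← mul_assoc, inv_mul_cancel₀ (Real.sqrt_pos.2 (hml j)).ne', one_mul]
  have hDR : ∀ z, ‖D (w z)‖ ^ 2 ≤ R / l := fun z => by
    have h1 := hD.norm_le (K := (√l)⁻¹) (by positivity) (fun j => by
      rw [abs_of_nonneg (by positivity)]
      exact inv_anti₀ (Real.sqrt_pos.2 hl) (Real.sqrt_le_sqrt (by linarith [hm j]))) (w z)
    calc ‖D (w z)‖ ^ 2 ≤ ((√l)⁻¹ * ‖w z‖) ^ 2 := pow_le_pow_left₀ (norm_nonneg _) h1 2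
      _ = ‖w z‖ ^ 2 / l := by rw [mul_pow, inv_pow, Real.sq_sqrt hl.le]; ring
      _ ≤ R / l := by gcongr; exact hR z
  have hτ : ∫ z, ‖D (w z)‖ ^ 2 ∂μ = N := integral_norm_sq_diag μ hw hR hC hCm hD (by
    refine hN.congr_fun fun j => ?_
    rw [inv_pow, Real.sq_sqrt (hml j).le, inv_mul_eq_div])
  -- With deviation n/2, variance proxy (R/l) N and increments bounded by 2R/l, this θ is admissible
  -- and makes the variance term at most half of θ n/2. The exponent left is -θ n/4 ≤ -L.
  set θ := l / (4 * R * (1 + N)) with hθ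
  have hθ0 : 0 < θ := by positivity
  have key := measure_covariance_dev_le μ (D.continuous.comp_stronglyMeasurable hw) hDR hτ.le
    hθ0.le (by
      have : θ * (2 * (R / l)) = 1 / (2 * (1 + N)) := by rw [hθ]; field_simp; ring
      rw [this]
      exact div_le_one_of_le₀ (by linarith) (by linarith)) n (n / 2)
  refine (measure_mono ?_).trans (key.trans (ENNReal.ofReal_le_ofReal ?_))
  · rintro z ⟨h, hz⟩
    -- D and E are (C + l)^(∓1/2). Testing the whitened deviation at E h gives C - C_z ≤ (C + l)/2,
    -- that is C ≤ 2 C_z + l.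
    refine ⟨E h, E h, ?_⟩
    have e1 : ∀ v, inner ℝ (E h) (D v) = inner ℝ h v := fun v => by
      rw [← hD.inner_left, hDE]
    have e2 : ‖E h‖ * ‖E h‖ = inner ℝ h (C h) + l * ‖h‖ ^ 2 := by
      rw [← sq]
      have h1 := hE.hasSum_sq h
      have h2 := (hCm.add_smul_id l).hasSum_inner h
      rw [h1.unique (h2.congr_fun fun j => by rw [Real.sq_sqrt (hml j).le]), add_apply, smul_apply,
        ContinuousLinearMap.id_apply, inner_add_left, real_inner_smul_left,
        real_inner_self_eq_norm_sq, real_inner_comm]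
    simp only [e1, e2, hC]
    rw [inner_empCov] at hz
    have e3 : ∑ i, inner ℝ h (w (z i)) * inner ℝ h (w (z i)) =
        n * ((n : ℝ)⁻¹ * ∑ t, inner ℝ (w (z t)) h * inner ℝ (w (z t)) h) := by
      rw [mul_inv_cancel_left₀ hn0.ne']
      simp only [real_inner_comm h]
    rw [e3, lt_abs]
    right
    set q := (n : ℝ)⁻¹ * ∑ t, inner ℝ (w (z t)) h * inner ℝ (w (z t)) h
    nlinarith
  · have h1 : n * θ ^ 2 * (R / l * N) ≤ θ * n / 4 := by
      have : n * θ ^ 2 * (R / l * N) = θ * n / 4 * (N / (1 + N)) := by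
        rw [sq, hθ]; field_simp
      rw [this]
      exact mul_le_of_le_one_right (by positivity)
        (div_le_one_of_le₀ (by linarith) (by linarith))
    have h2 : L ≤ θ * n / 4 := by
      rw [hθ, div_mul_eq_mul_div, div_div, le_div_iff₀ (by positivity)]
      linarith
    gcongr
    linarith

include hw hR hC in
/-- Operator norm deviation of the empirical covariance. -/
theorem measure_norm_covariance_sub_le {n : ℕ} (hn : 1 ≤ n) {L : ℝ} (hL0 : 0 ≤ L) (hR0 : 0 < R) :
    Measure.pi (fun _ : Fin n => μ) {z | ∃ h, 4 * R * √(L / n) * ‖h‖ <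
        ‖C h - empCov (fun i => w (z i)) h‖} ≤ ENNReal.ofReal (2 * Real.exp (-L)) := by
  have hn0 : (0 : ℝ) < n := by exact_mod_cast hn
  have hτ : ∫ z, ‖w z‖ ^ 2 ∂μ ≤ R := by
    have := norm_integral_le_of_norm_le_const (μ := μ) (f := fun z => ‖w z‖ ^ 2) (C := R)
      (Filter.Eventually.of_forall fun z => by
        rw [Real.norm_of_nonneg (sq_nonneg _)]; exact hR z)
    simpa using (le_abs_self _).trans this
  have hdev : ∀ (z : Fin n → Z) (h h' : H), inner ℝ h' (C h - empCov (fun i => w (z i)) h) =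
      -(n : ℝ)⁻¹ * (∑ i, inner ℝ h' (w (z i)) * inner ℝ h (w (z i)) -
          n * ∫ z, inner ℝ h' (w z) * inner ℝ h (w z) ∂μ) := by
    intro z h h'
    rw [inner_sub_right, inner_empCov, hC]
    simp only [real_inner_comm h, real_inner_comm h']
    field_simp
    ring
  -- A bound for the bilinear form becomes a norm bound by choosing h' = C h - C_z h.
  have hbd : ∀ (z : Fin n → Z) (h : H) (t : ℝ), (∀ h', |∑ i, inner ℝ h' (w (z i)) *
      inner ℝ h (w (z i)) - n * ∫ z, inner ℝ h' (w z) * inner ℝ h (w z) ∂μ| ≤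
        n * t * (‖h'‖ * ‖h‖)) → ‖C h - empCov (fun i => w (z i)) h‖ ≤ t * ‖h‖ := by
    intro z h t ht
    rcases (norm_nonneg (C h - empCov (fun i => w (z i)) h)).eq_or_lt with h0 | h0
    · rw [← h0]
      have := (abs_nonneg _).trans (ht h)
      rcases (norm_nonneg h).eq_or_lt with h1 | h1
      · rw [← h1, mul_zero]
      · have : 0 ≤ (n * (‖h‖ * ‖h‖)) * t := by linarith
        exact mul_nonneg (nonneg_of_mul_nonneg_right this (by positivity)) h1.le
    · have h1 := hdev z h (C h - empCov (fun i => w (z i)) h)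
      have h2 := ht (C h - empCov (fun i => w (z i)) h)
      rw [real_inner_self_eq_norm_sq] at h1
      have h3 := (le_abs_self _).trans_eq (congrArg abs h1)
      rw [abs_mul, abs_neg, abs_of_pos (inv_pos.2 hn0)] at h3
      have h4 := h3.trans (mul_le_mul_of_nonneg_left h2 (inv_pos.2 hn0).le)
      refine le_of_mul_le_mul_left ?_ h0
      rw [← sq]
      refine h4.trans (le_of_eq ?_)
      field_simp
  -- For L ≤ n the chosen θ gives the exponent -2L + L/4. For L > n the event is empty, since the
  -- deviation never exceeds 2R.
  rcases le_or_gt L n with hLn | hLn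
  · set θ := √(L / n) / (2 * R) with hθ
    have hs : √(L / n) ≤ 1 := Real.sqrt_le_one.2 (div_le_one_of_le₀ hLn hn0.le)
    have hs2 : √(L / n) ^ 2 = L / n := Real.sq_sqrt (by positivity)
    have key := measure_covariance_dev_le μ hw hR hτ (θ := θ) (by positivity) (by
      rw [hθ, div_mul_cancel₀ _ (by positivity)]; exact hs) n (n * (4 * R * √(L / n)))
    refine (measure_mono ?_).trans (key.trans (ENNReal.ofReal_le_ofReal ?_))
    · rintro z ⟨h, hz⟩
      by_contra hcon
      rw [Set.mem_ofPred_eq] at hcon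
      push Not at hcon
      exact hz.not_ge (hbd z h _ fun h' => hcon h' h)
    · have h1 : -(θ * (n * (4 * R * √(L / n)))) + n * θ ^ 2 * (R * R) = -(7 / 4 * L) := by
        have : θ * (n * (4 * R * √(L / n))) = 2 * n * √(L / n) ^ 2 := by
          rw [hθ]; field_simp; ring
        have h3 : n * θ ^ 2 * (R * R) = n * √(L / n) ^ 2 / 4 := by
          rw [hθ]; field_simp; ring
        rw [this, h3, hs2]
        field_simp
        ring
      rw [h1]
      gcongr
      linarith
  · suffices hempty : {z : Fin n → Z | ∃ h, 4 * R * √(L / n) * ‖h‖ <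
        ‖C h - empCov (fun i => w (z i)) h‖} = ∅ by
      rw [hempty, measure_empty]
      exact zero_le
    refine Set.eq_empty_of_forall_notMem fun z ⟨h, hz⟩ => hz.not_ge (hbd z h _ fun h' => ?_)
    have h1 : ∀ x : Z, |inner ℝ h' (w x) * inner ℝ h (w x)| ≤ R * (‖h'‖ * ‖h‖) := fun x => by
      rw [abs_mul]
      calc _ ≤ (‖h'‖ * ‖w x‖) * (‖h‖ * ‖w x‖) :=
            mul_le_mul (abs_real_inner_le_norm _ _) (abs_real_inner_le_norm _ _) (abs_nonneg _)
              (by positivity)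
        _ = ‖w x‖ ^ 2 * (‖h'‖ * ‖h‖) := by ring
        _ ≤ _ := mul_le_mul_of_nonneg_right (hR x) (by positivity)
    have h2 : |∑ i, inner ℝ h' (w (z i)) * inner ℝ h (w (z i))| ≤ n * (R * (‖h'‖ * ‖h‖)) := by
      refine (Finset.abs_sum_le_sum_abs _ _).trans ((Finset.sum_le_sum fun i _ => h1 (z i)).trans ?_)
      simp
    have h3 : |∫ z, inner ℝ h' (w z) * inner ℝ h (w z) ∂μ| ≤ R * (‖h'‖ * ‖h‖) := by
      have := norm_integral_le_of_norm_le_const (μ := μ)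
        (f := fun z => inner ℝ h' (w z) * inner ℝ h (w z)) (C := R * (‖h'‖ * ‖h‖))
        (Filter.Eventually.of_forall fun z => h1 z)
      simpa using this
    have h4 : 1 ≤ √(L / n) := Real.one_le_sqrt.2 ((one_le_div hn0).2 hLn.le)
    refine (abs_sub _ _).trans ?_
    rw [abs_mul, abs_of_pos hn0]
    have h5 := mul_le_mul_of_nonneg_left h3 hn0.le
    have h6 : 0 ≤ n * (R * (‖h'‖ * ‖h‖)) := by positivity
    nlinarith

end Concentration

/-! ### Effective dimension under polynomial eigenvalue decay -/

section EffectiveDimension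

theorem sum_range_inv_sqrt_le (n : ℕ) :
    ∑ i ∈ Finset.range n, (√((i : ℝ) + 1))⁻¹ ≤ 2 * √n := by
  induction n with
  | zero => simp
  | succ n ih =>
    rw [Finset.sum_range_succ]
    have h1 : 0 < √((n : ℝ) + 1) := Real.sqrt_pos.2 (by positivity)
    have h2 : √((n : ℝ) + 1) ^ 2 = n + 1 := Real.sq_sqrt (by positivity)
    have h3 : √(n : ℝ) ^ 2 = n := Real.sq_sqrt (by positivity)
    have h4 : (√((n : ℝ) + 1))⁻¹ ≤ 2 * (√((n : ℝ) + 1) - √n) := by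
      rw [inv_le_iff_one_le_mul₀ h1]
      nlinarith [sq_nonneg (√((n : ℝ) + 1) - √n)]
    push_cast
    linarith

/-- A discrete integral comparison which telescopes. After division by (x + 1)^(1-a) it follows from
log q ≤ q - 1 and 1 + y ≤ exp y. -/
theorem rpow_neg_le_sub {a x : ℝ} (ha : 1 < a) (hx : 0 < x) :
    (a - 1) * (x + 1) ^ (-a) ≤ x ^ (1 - a) - (x + 1) ^ (1 - a) := by
  have hx1 : 0 < x + 1 := by linarith
  have h1 : (x + 1) ^ (-a) = (x + 1) ^ (1 - a) * (x + 1)⁻¹ := by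
    rw [← Real.rpow_neg_one, ← Real.rpow_add hx1]; ring_nf
  have h2 : x ^ (1 - a) = (x + 1) ^ (1 - a) * (x / (x + 1)) ^ (1 - a) := by
    rw [← Real.mul_rpow hx1.le (by positivity), mul_div_cancel₀ _ hx1.ne']
  have h3 : 1 + (a - 1) * (x + 1)⁻¹ ≤ (x / (x + 1)) ^ (1 - a) := by
    have hq : 0 < x / (x + 1) := by positivity
    rw [Real.rpow_def_of_pos hq]
    have h4 := Real.log_le_sub_one_of_pos hq
    have h5 : x / (x + 1) - 1 = -(x + 1)⁻¹ := by field_simp; ring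
    have h6 := Real.add_one_le_exp (Real.log (x / (x + 1)) * (1 - a))
    nlinarith
  rw [h1, h2]
  have := mul_le_mul_of_nonneg_left h3 (Real.rpow_nonneg hx1.le (1 - a))
  linarith

theorem sum_range_rpow_le {a : ℝ} (ha : 1 < a) {m : ℕ} (hm : 1 ≤ m) (n : ℕ) :
    ∑ i ∈ Finset.range n, ((m + i : ℕ) + 1 : ℝ) ^ (-a) ≤ (m : ℝ) ^ (1 - a) / (a - 1) := by
  have ha' : 0 < a - 1 := by linarith
  have key : ∑ i ∈ Finset.range n, ((m + i : ℕ) + 1 : ℝ) ^ (-a) ≤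
      ((m : ℝ) ^ (1 - a) - ((m + n : ℕ) : ℝ) ^ (1 - a)) / (a - 1) := by
    induction n with
    | zero => simp
    | succ n ih =>
      rw [Finset.sum_range_succ]
      have h1 := rpow_neg_le_sub (x := ((m + n : ℕ) : ℝ)) ha (by norm_cast; omega)
      rw [le_div_iff₀ ha'] at ih ⊢
      have h2 : ((m + (n + 1) : ℕ) : ℝ) = ((m + n : ℕ) : ℝ) + 1 := by push_cast; ring
      rw [h2]
      linarith
  refine key.trans ?_
  have : 0 ≤ ((m + n : ℕ) : ℝ) ^ (1 - a) := by positivity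
  gcongr
  linarith

/-- The crude growth √s is chosen because √(m/(i + 1)) summed over i < m is O(m), so the head of the
log-determinant loses no logarithm. -/
theorem log_one_add_mul_rpow_le {a M s : ℝ} (ha : 0 ≤ a) (hM : 0 ≤ M) (hs : 1 ≤ s) :
    Real.log (1 + M * s ^ a) ≤ (M + 2 * a) * √s := by
  have hs0 : 0 < s := by linarith
  have h1 : 1 ≤ s ^ a := Real.one_le_rpow hs ha
  have h2 : 1 + M * s ^ a ≤ (1 + M) * s ^ a := by nlinarith
  have h3 : 1 ≤ √s := Real.one_le_sqrt.2 hs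
  have h4 : Real.log (1 + M) ≤ M := by
    have := Real.log_le_sub_one_of_pos (x := 1 + M) (by linarith); linarith
  have h5 : Real.log s ≤ 2 * √s := by
    have e : Real.log s = 2 * Real.log √s := by rw [Real.log_sqrt hs0.le]; ring
    have := Real.log_le_sub_one_of_pos (x := √s) (by linarith)
    linarith
  calc Real.log (1 + M * s ^ a) ≤ Real.log ((1 + M) * s ^ a) :=
        Real.log_le_log (by positivity) h2
    _ = Real.log (1 + M) + a * Real.log s := by
        rw [Real.log_mul (by positivity) (by positivity), Real.log_rpow hs0]
    _ ≤ M * √s + a * (2 * √s) := by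
        refine add_le_add (h4.trans ?_) (mul_le_mul_of_nonneg_left h5 ha)
        nlinarith
    _ = _ := by ring

/-- Bounds for the log-determinant and the effective dimension under polynomial decay. -/
theorem exists_effectiveDimension_le {a M : ℝ} (ha : 1 < a) (hM : 0 ≤ M) {μ : ℕ → ℝ}
    (hμ0 : ∀ i, 0 ≤ μ i) (hμ : ∀ i : ℕ, μ i ≤ M * ((i : ℝ) + 1) ^ (-a)) :
    ∃ K > 0, ∀ l : ℝ, 0 < l → l ≤ 1 → ∃ ℓ N : ℝ,
      HasSum (fun i => Real.log (1 + μ i / l)) ℓ ∧ HasSum (fun i => μ i / (μ i + l)) N ∧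
      0 ≤ N ∧ N ≤ ℓ ∧ ℓ ≤ K * l ^ (-a⁻¹) := by
  have ha0 : 0 < a := by linarith
  have ha' : 0 < a - 1 := by linarith
  refine ⟨4 * (M + 2 * a) + 2 * M / (a - 1), by positivity, fun l hl hl1 => ?_⟩
  set t := l ^ (-a⁻¹) with ht
  have ht1 : 1 ≤ t := Real.one_le_rpow_of_pos_of_le_one_of_nonpos hl hl1 (by
    have := inv_pos.2 ha0; linarith)
  have ht0 : 0 < t := by linarith
  have hta : t ^ a = l⁻¹ := by
    rw [ht, ← Real.rpow_mul hl.le, neg_mul, inv_mul_cancel₀ ha0.ne', Real.rpow_neg_one]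
  -- The cutoff where i^(-a) falls to the order of l. Below it the square root bound applies; beyond
  -- it log(1 + x) ≤ x and the summable tail again give O(m).
  set m := ⌈t⌉₊ with hm
  have hm1 : 1 ≤ m := Nat.one_le_ceil_iff.2 ht0
  have htm : t ≤ m := Nat.le_ceil t
  have hm2 : (m : ℝ) ≤ 2 * t := by
    have := Nat.ceil_lt_add_one ht0.le
    rw [← hm] at this
    linarith
  have hm0 : (0 : ℝ) < m := by exact_mod_cast hm1
  have hratio : ∀ i : ℕ, μ i / l ≤ M * (m / ((i : ℝ) + 1)) ^ a := by
    intro i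
    have hi : (0 : ℝ) < (i : ℝ) + 1 := by positivity
    rw [Real.div_rpow hm0.le hi.le, div_eq_mul_inv (μ i), ← hta, div_eq_mul_inv,
      ← Real.rpow_neg hi.le, ← mul_assoc, mul_right_comm]
    exact mul_le_mul (hμ i) (Real.rpow_le_rpow ht0.le htm ha0.le) (by positivity) (by positivity)
  have hnn : ∀ i, 0 ≤ μ i / l := fun i => div_nonneg (hμ0 i) hl.le
  have hlog0 : ∀ i, 0 ≤ Real.log (1 + μ i / l) := fun i =>
    Real.log_nonneg (by linarith [hnn i])
  have hhead : ∑ i ∈ Finset.range m, Real.log (1 + μ i / l) ≤ (M + 2 * a) * (2 * m) := by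
    calc ∑ i ∈ Finset.range m, Real.log (1 + μ i / l)
        ≤ ∑ i ∈ Finset.range m, (M + 2 * a) * √m * (√((i : ℝ) + 1))⁻¹ := by
          refine Finset.sum_le_sum fun i hi => ?_
          have hi' : (0 : ℝ) < (i : ℝ) + 1 := by positivity
          have him : (i : ℝ) + 1 ≤ m := by exact_mod_cast Finset.mem_range.1 hi
          calc Real.log (1 + μ i / l) ≤ Real.log (1 + M * (m / ((i : ℝ) + 1)) ^ a) :=
                Real.log_le_log (by linarith [hnn i]) (by linarith [hratio i])
            _ ≤ (M + 2 * a) * √(m / ((i : ℝ) + 1)) :=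
                log_one_add_mul_rpow_le ha0.le hM ((one_le_div hi').2 him)
            _ = _ := by rw [Real.sqrt_div hm0.le, div_eq_mul_inv]; ring
      _ ≤ (M + 2 * a) * √m * (2 * √m) := by
          rw [← Finset.mul_sum]
          exact mul_le_mul_of_nonneg_left (sum_range_inv_sqrt_le m) (by positivity)
      _ = (M + 2 * a) * (2 * √m ^ 2) := by ring
      _ = _ := by rw [Real.sq_sqrt hm0.le]
  have htail : ∀ n, ∑ i ∈ Finset.range n, Real.log (1 + μ (m + i) / l) ≤ M * m / (a - 1) := by
    intro n
    calc ∑ i ∈ Finset.range n, Real.log (1 + μ (m + i) / l)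
        ≤ ∑ i ∈ Finset.range n, M * (m : ℝ) ^ a * ((m + i : ℕ) + 1 : ℝ) ^ (-a) := by
          refine Finset.sum_le_sum fun i _ => ?_
          have hi : (0 : ℝ) < ((m + i : ℕ) : ℝ) + 1 := by positivity
          have h1 := Real.log_le_sub_one_of_pos (x := 1 + μ (m + i) / l) (by linarith [hnn (m + i)])
          have h2 := hratio (m + i)
          rw [Real.div_rpow hm0.le hi.le, div_eq_mul_inv ((m : ℝ) ^ a), ← Real.rpow_neg hi.le,
            ← mul_assoc] at h2
          linarith
      _ ≤ M * (m : ℝ) ^ a * ((m : ℝ) ^ (1 - a) / (a - 1)) := by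
          rw [← Finset.mul_sum]
          exact mul_le_mul_of_nonneg_left (sum_range_rpow_le ha hm1 n) (by positivity)
      _ = M * ((m : ℝ) ^ a * (m : ℝ) ^ (1 - a)) / (a - 1) := by ring
      _ = _ := by rw [← Real.rpow_add hm0]; simp
  have hpart : ∀ n, ∑ i ∈ Finset.range n, Real.log (1 + μ i / l) ≤
      (4 * (M + 2 * a) + 2 * M / (a - 1)) * t := by
    intro n
    have h1 : ∑ i ∈ Finset.range n, Real.log (1 + μ i / l) ≤
        ∑ i ∈ Finset.range (m + n), Real.log (1 + μ i / l) :=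
      Finset.sum_le_sum_of_subset_of_nonneg (Finset.range_subset_range.2 (by omega))
        fun i _ _ => hlog0 i
    rw [Finset.sum_range_add] at h1
    have h2 : (M + 2 * a) * (2 * m) ≤ (M + 2 * a) * (2 * (2 * t)) := by gcongr
    have h3 : M * m / (a - 1) ≤ M * (2 * t) / (a - 1) := by gcongr
    have h4 := htail n
    have e : (4 * (M + 2 * a) + 2 * M / (a - 1)) * t =
      (M + 2 * a) * (2 * (2 * t)) + M * (2 * t) / (a - 1) := by ring
    linarith
  have hsum := summable_of_sum_range_le hlog0 hpart
  have hle : ∀ i, μ i / (μ i + l) ≤ Real.log (1 + μ i / l) := by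
    intro i
    have h1 : 0 < 1 + μ i / l := by linarith [hnn i]
    have h2 := Real.one_sub_inv_le_log_of_pos h1
    refine le_trans (le_of_eq ?_) h2
    have h3 : 1 + μ i / l = (μ i + l) / l := by field_simp; ring
    have h4 : 0 < μ i + l := by linarith [hμ0 i]
    rw [h3]
    field_simp
    ring
  have hn0 : ∀ i, 0 ≤ μ i / (μ i + l) := fun i =>
    div_nonneg (hμ0 i) (by linarith [hμ0 i])
  have hsumN := hsum.of_nonneg_of_le hn0 hle
  exact ⟨_, _, hsum.hasSum, hsumN.hasSum, tsum_nonneg hn0, hsumN.tsum_le_tsum hle hsum,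
    Real.tsum_le_of_sum_range_le hlog0 hpart⟩

end EffectiveDimension

/-! ### Exchanging powers of C for powers of its perturbation -/

section Filter

variable {H : Type*} [NormedAddCommGroup H] [InnerProductSpace ℝ H]
  {ι ι' : Type*} {f : HilbertBasis ι ℝ H} {e : HilbertBasis ι' ℝ H}

/-- Heinz applied to K B; the resulting K^θ is at most K because K ≥ 1 and θ ≤ 1. -/
theorem norm_rpow_le_mul_norm_rpow [TopologicalSpace.SeparableSpace H]
    {a : ι → ℝ} {b : ι' → ℝ} {A B A' B' : H →L[ℝ] H} {θ K : ℝ}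
    (hθ0 : 0 < θ) (hθ1 : θ ≤ 1) (hK : 1 ≤ K) (ha : ∀ i, 0 ≤ a i) (hb : ∀ j, 0 ≤ b j)
    (hA : IsDiag f a A) (hB : IsDiag e b B)
    (hA' : IsDiag f (fun i => a i ^ θ) A') (hB' : IsDiag e (fun j => b j ^ θ) B')
    (hAB : ∀ v, ‖A v‖ ≤ K * ‖B v‖) (v : H) : ‖A' v‖ ≤ K * ‖B' v‖ := by
  have hK0 : 0 ≤ K := by linarith
  have h1 : IsDiag e (fun j => K * b j) (K • B) := fun j v => by
    rw [smul_apply, real_inner_smul_right, hB, mul_assoc]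
  have h2 : IsDiag e (fun j => (K * b j) ^ θ) (K ^ θ • B') := fun j v => by
    simp only [smul_apply, real_inner_smul_right, hB' j v, Real.mul_rpow hK0 (hb j), mul_assoc]
  have h3 := norm_rpow_le_norm_rpow hθ0 hθ1 ha (fun j => mul_nonneg hK0 (hb j)) hA h1 hA' h2
    (fun v => by rw [smul_apply, norm_smul, Real.norm_of_nonneg hK0]; exact hAB v) v
  rw [smul_apply, norm_smul, Real.norm_of_nonneg (Real.rpow_nonneg hK0 _)] at h3
  exact h3.trans (mul_le_mul_of_nonneg_right (Real.rpow_le_self_of_one_le hK hθ1)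
    (norm_nonneg _))

variable {μ : ι → ℝ} {C : H →L[ℝ] H} (hμ0 : ∀ j, 0 ≤ μ j) (hC : IsDiag f μ C)
  {σ : ι' → ℝ} {T : H →L[ℝ] H} (hσ0 : ∀ i, 0 ≤ σ i) (hT : IsDiag e σ T)
  {l : ℝ} (hl : 0 < l)

include hC hT hl in
theorem norm_sqrt_le_of_le {A : ℝ} (hσ0 : ∀ i, 0 ≤ σ i) (hμ0 : ∀ j, 0 ≤ μ j) (hA : 0 ≤ A)
    (h : ∀ v, inner ℝ v (C v) ≤ A * (inner ℝ v (T v) + l * ‖v‖ ^ 2)) {S Q : H →L[ℝ] H}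
    (hS : IsDiag f (fun j => √(μ j)) S) (hQ : IsDiag e (fun i => √(σ i + l)) Q) (v : H) :
    ‖S v‖ ≤ √A * ‖Q v‖ := by
  refine abs_le_of_sq_le_sq' ?_ (by positivity) |>.2
  rw [mul_pow, Real.sq_sqrt hA]
  have h1 : ‖S v‖ ^ 2 = inner ℝ v (C v) := by
    rw [real_inner_comm]
    exact (hS.hasSum_sq v).unique ((hC.hasSum_inner v).congr_fun fun j => by
      rw [Real.sq_sqrt (hμ0 j)])
  have h2 : ‖Q v‖ ^ 2 = inner ℝ v (T v) + l * ‖v‖ ^ 2 := by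
    rw [(hQ.hasSum_sq v).unique (((hT.add_smul_id l).hasSum_inner v).congr_fun fun i => by
      rw [Real.sq_sqrt (by linarith [hσ0 i])]), add_apply, smul_apply,
      ContinuousLinearMap.id_apply, inner_add_left, real_inner_smul_left,
      real_inner_self_eq_norm_sq, real_inner_comm]
  rw [h1, h2]
  exact h v

include hμ0 hC hT hl hσ0 in
-- The form inequality compares square roots, so Heinz with exponent 2ρ reaches ρ ≤ 1/2. This serves
-- small r, where the operator norm deviation is not O(l).
theorem norm_rpow_le_of_le [TopologicalSpace.SeparableSpace H] {A c ρ : ℝ} (hA : 1 ≤ A)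
    (hμc : ∀ j, μ j ≤ c) (hσc : ∀ i, σ i ≤ c)
    (h : ∀ v, inner ℝ v (C v) ≤ A * (inner ℝ v (T v) + l * ‖v‖ ^ 2)) (hρ : 0 < ρ)
    (hρ1 : ρ ≤ 1 / 2) {P Q : H →L[ℝ] H}
    (hP : IsDiag f (fun j => μ j ^ ρ) P) (hQ : IsDiag e (fun i => (σ i + l) ^ ρ) Q) (v : H) :
    ‖P v‖ ≤ √A * ‖Q v‖ := by
  obtain ⟨S, hS⟩ := exists_isDiag f (fun j => √(μ j)) (K := √c) fun j => by
    rw [abs_of_nonneg (Real.sqrt_nonneg _)]; exact Real.sqrt_le_sqrt (hμc j)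
  obtain ⟨S', hS'⟩ := exists_isDiag e (fun i => √(σ i + l)) (K := √(c + l)) fun i => by
    rw [abs_of_nonneg (Real.sqrt_nonneg _)]
    exact Real.sqrt_le_sqrt (by linarith [hσc i])
  have hpow : ∀ x : ℝ, 0 ≤ x → √x ^ (2 * ρ) = x ^ ρ := fun x hx => by
    rw [Real.sqrt_eq_rpow, ← Real.rpow_mul hx]; ring_nf
  refine norm_rpow_le_mul_norm_rpow (A := S) (B := S') (θ := 2 * ρ) (by linarith) (by linarith)
    (Real.one_le_sqrt.2 hA) (fun _ => Real.sqrt_nonneg _) (fun _ => Real.sqrt_nonneg _) hS hS'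
    (fun j v => ?_) (fun i v => ?_)
    (norm_sqrt_le_of_le hC hT hl hσ0 hμ0 (by linarith) h hS hS') v
  · simpa only [hpow _ (hμ0 j)] using hP j v
  · simpa only [hpow _ (add_nonneg (hσ0 i) hl.le)] using hQ i v

include hμ0 hC hT hl hσ0 in
-- Writing C v = (C - T) v + T v compares C with T + l at first order, so Heinz reaches every ρ ≤ 1,
-- at the price of E/l.
theorem norm_rpow_le_of_norm_sub_le [TopologicalSpace.SeparableSpace H] {E ρ : ℝ} (hE : 0 ≤ E)
    (h : ∀ v, ‖C v - T v‖ ≤ E * ‖v‖) (hρ : 0 < ρ) (hρ1 : ρ ≤ 1) {P Q : H →L[ℝ] H}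
    (hP : IsDiag f (fun j => μ j ^ ρ) P) (hQ : IsDiag e (fun i => (σ i + l) ^ ρ) Q) (v : H) :
    ‖P v‖ ≤ (1 + E / l) * ‖Q v‖ := by
  have hpos : ∀ i, 0 < σ i + l := fun i => by linarith [hσ0 i]
  refine norm_rpow_le_mul_norm_rpow hρ hρ1 (by have := div_nonneg hE hl.le; linarith) hμ0
    (fun i => (hpos i).le) hC (hT.add_smul_id l) hP hQ (fun v => ?_) v
  have h1 : ‖T v‖ ≤ 1 * ‖(T + l • ContinuousLinearMap.id ℝ H) v‖ :=
    hT.norm_le_norm (hT.add_smul_id l) zero_le_one (fun i => by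
      rw [abs_of_nonneg (hσ0 i), abs_of_pos (hpos i)]; linarith) v
  have hid : IsDiag e (fun _ => (1 : ℝ)) (ContinuousLinearMap.id ℝ H) := fun i v => by simp
  have h2 : ‖v‖ ≤ l⁻¹ * ‖(T + l • ContinuousLinearMap.id ℝ H) v‖ :=
    hid.norm_le_norm (hT.add_smul_id l) (by positivity) (fun i => by
      rw [abs_one, abs_of_pos (hpos i), inv_mul_eq_div, one_le_div hl]; linarith [hσ0 i]) v
  have h3 : ‖C v‖ ≤ ‖C v - T v‖ + ‖T v‖ := by
    simpa using norm_add_le (C v - T v) (T v)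
  have h4 := h v
  have h5 := mul_le_mul_of_nonneg_left h2 hE
  have e1 : (1 + E / l) * ‖(T + l • ContinuousLinearMap.id ℝ H) v‖ =
    ‖(T + l • ContinuousLinearMap.id ℝ H) v‖ +
      E * (l⁻¹ * ‖(T + l • ContinuousLinearMap.id ℝ H) v‖) := by ring
  linarith

include hμ0 hC hT hσ0 in
/-- A source condition of order `m + ρ` combined with a filter `d(T)`, for a perturbation `T`
of `C`. -/
theorem norm_rpow_comp_le {c ρ A E : ℝ} (hc : 1 ≤ c) (hμc : ∀ j, μ j ≤ c) (hσc : ∀ i, σ i ≤ c)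
    (hρ : 0 < ρ) (hA : 0 ≤ A) (hE : 0 ≤ E) (hdev : ∀ v, ‖C v - T v‖ ≤ E * ‖v‖)
    {P : ℝ → H →L[ℝ] H} (hP : ∀ p, 0 < p → IsDiag f (fun j => μ j ^ p) (P p)) {Q : H →L[ℝ] H}
    {q : ι' → ℝ} (hQ : IsDiag e q Q) (hPQ : ∀ v, ‖P ρ v‖ ≤ A * ‖Q v‖) (m : ℕ)
    {d : ι' → ℝ} {B : H →L[ℝ] H} (hB : IsDiag e d B) {b₀ b₁ : ℝ} (hb0 : 0 ≤ b₀) (hb1 : 0 ≤ b₁)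
    (hd0 : ∀ i, |d i| ≤ b₀) (hd1 : ∀ i, |q i| * (σ i ^ m * |d i|) ≤ b₁) (v : H) :
    ‖P (m + ρ) (B v)‖ ≤ (A * b₁ + m * c ^ (m + ρ) * E * b₀) * ‖v‖ := by
  have hc0 : 0 < c := by linarith
  induction m generalizing d B b₀ with
  | zero =>
    simp only [Nat.cast_zero, zero_add, zero_mul, add_zero, pow_zero, one_mul] at hd1 ⊢
    refine (hPQ _).trans ?_
    rw [mul_assoc]
    refine mul_le_mul_of_nonneg_left ?_ hA
    exact (hQ.comp hB).norm_le hb1 (fun i => by rw [abs_mul]; exact hd1 i) v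
  | succ m ih =>
    have hm0 : 0 < (m : ℝ) + ρ := by positivity
    -- One factor is exchanged: C^(m+1+ρ) B = C^(m+ρ) (C - T) B + C^(m+ρ) (T B). The first term
    -- costs E b₀; the second is the induction hypothesis for the filter σ d(σ), whose sup bound is
    -- c b₀.
    have hP1 : ∀ v, P ((m + 1 : ℕ) + ρ) v = P (m + ρ) (C v) := fun v => by
      refine (hP _ (by positivity)).eq_of_eq ((hP _ hm0).comp hC) (fun j => ?_) v
      rcases (hμ0 j).eq_or_lt with h0 | h0
      · rw [← h0, mul_zero, Real.zero_rpow (by positivity)]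
      · rw [← Real.rpow_add_one h0.ne']
        push_cast
        ring_nf
    have hPn : ∀ v, ‖P (m + ρ) v‖ ≤ c ^ (m + ρ) * ‖v‖ := fun v =>
      (hP _ hm0).norm_le (by positivity) (fun j => by
        rw [abs_of_nonneg (Real.rpow_nonneg (hμ0 j) _)]
        exact Real.rpow_le_rpow (hμ0 j) (hμc j) hm0.le) v
    have h1 := ih (hT.comp hB) (b₀ := c * b₀) (by positivity) (fun i => by
      rw [abs_mul, abs_of_nonneg (hσ0 i)]
      exact mul_le_mul (hσc i) (hd0 i) (abs_nonneg _) hc0.le) (fun i => by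
      rw [abs_mul, abs_of_nonneg (hσ0 i), ← mul_assoc (σ i ^ m), ← pow_succ]
      exact hd1 i)
    have h2 : ‖P (m + ρ) (C (B v) - T (B v))‖ ≤ c ^ (m + ρ) * (E * (b₀ * ‖v‖)) :=
      (hPn _).trans (mul_le_mul_of_nonneg_left ((hdev _).trans
        (mul_le_mul_of_nonneg_left (hB.norm_le hb0 hd0 v) hE)) (by positivity))
    have hpw : c ^ (m + ρ) * c = c ^ ((m + 1 : ℕ) + ρ) := by
      rw [← Real.rpow_add_one hc0.ne']; push_cast; ring_nf
    have h3 : c ^ (m + ρ) ≤ c ^ ((m + 1 : ℕ) + ρ) := by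
      rw [← hpw]; exact le_mul_of_one_le_right (by positivity) hc
    have h4 : c ^ (m + ρ) * (E * (b₀ * ‖v‖)) ≤ c ^ ((m + 1 : ℕ) + ρ) * (E * (b₀ * ‖v‖)) := by
      gcongr
    rw [hP1]
    have e1 : P (m + ρ) (C (B v)) =
        P (m + ρ) (C (B v) - T (B v)) + P (m + ρ) ((T ∘L B) v) := by
      rw [← map_add, ContinuousLinearMap.comp_apply, sub_add_cancel]
    rw [e1]
    refine (norm_add_le _ _).trans ((add_le_add (h2.trans h4) h1).trans (le_of_eq ?_))
    rw [← hpw]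
    push_cast
    ring

/-- B P is the adjoint of P B, so the two have the same bounds. -/
theorem norm_comp_le_of_symm {B P : H →L[ℝ] H} {d : ι' → ℝ} {p : ι → ℝ} (hB : IsDiag e d B)
    (hP : IsDiag f p P) {K : ℝ} (h : ∀ v, ‖P (B v)‖ ≤ K * ‖v‖) (v : H) :
    ‖B (P v)‖ ≤ K * ‖v‖ := by
  have h1 : ‖B (P v)‖ * ‖B (P v)‖ ≤ ‖v‖ * (K * ‖B (P v)‖) := by
    rw [← real_inner_self_eq_norm_mul_norm, hB.inner_left, hP.inner_left]
    exact (real_inner_le_norm _ _).trans (mul_le_mul_of_nonneg_left (h _) (norm_nonneg _))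
  rcases (norm_nonneg (B (P v))).eq_or_lt with h0 | h0
  · rw [← h0]
    exact (norm_nonneg _).trans (h v)
  · exact le_of_mul_le_mul_right (by linarith) h0

end Filter

/-! ### Consequences of the regularization and qualification bounds -/

section Qualification

variable {s ν γ D : ℝ} {g : ℝ → ℝ → ℝ}

/-- Intermediate qualifications. -/
theorem abs_residual_mul_rpow_le {l : ℝ} (hl : 0 < l) (hD : 0 ≤ D)
    (hgD : ∀ σ ∈ Set.Ioc 0 s, |σ * g l σ| ≤ D)
    (hγ : ∀ σ ∈ Set.Ioc 0 s, |1 - σ * g l σ| * σ ^ ν ≤ γ * l ^ ν) {σ : ℝ} (hσ0 : 0 ≤ σ)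
    (hσs : σ ≤ s) {p : ℝ} (hp0 : 0 ≤ p) (hpν : p ≤ ν) :
    |1 - σ * g l σ| * (σ + l) ^ p ≤ 2 ^ ν * (1 + D + |γ|) * l ^ p := by
  have h2 : (2 : ℝ) ^ p ≤ 2 ^ ν := Real.rpow_le_rpow_of_exponent_le one_le_two hpν
  have hq : |1 - σ * g l σ| ≤ 1 + D := by
    rcases hσ0.eq_or_lt with rfl | h0
    · simp [hD]
    · refine (abs_sub _ _).trans ?_
      rw [abs_one]
      linarith [hgD σ ⟨h0, hσs⟩]
  rcases le_total σ l with hσl | hσl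
  -- For σ ≤ l the residual is merely bounded. For σ ≥ l the qualification at ν is used with σ^(p-ν)
  -- ≤ l^(p-ν), as p ≤ ν.
  · calc |1 - σ * g l σ| * (σ + l) ^ p ≤ (1 + D) * (2 * l) ^ p :=
        mul_le_mul hq (Real.rpow_le_rpow (by linarith) (by linarith) hp0) (by positivity)
          (by linarith)
      _ = 2 ^ p * (1 + D) * l ^ p := by rw [Real.mul_rpow zero_le_two hl.le]; ring
      _ ≤ 2 ^ ν * (1 + D + |γ|) * l ^ p := by
        have h3 : 1 + D ≤ 1 + D + |γ| := le_add_of_nonneg_right (abs_nonneg γ)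
        have := abs_nonneg γ
        exact mul_le_mul_of_nonneg_right (mul_le_mul h2 h3 (by positivity) (by positivity))
          (by positivity)
  · have h0 : 0 < σ := by linarith
    calc |1 - σ * g l σ| * (σ + l) ^ p ≤ |1 - σ * g l σ| * (2 * σ) ^ p :=
        mul_le_mul_of_nonneg_left (Real.rpow_le_rpow (by linarith) (by linarith) hp0)
          (abs_nonneg _)
      _ = 2 ^ p * ((|1 - σ * g l σ| * σ ^ ν) * σ ^ (p - ν)) := by
        rw [Real.mul_rpow zero_le_two h0.le, mul_assoc (|1 - σ * g l σ|), ← Real.rpow_add h0]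
        ring_nf
      _ ≤ 2 ^ p * ((|γ| * l ^ ν) * l ^ (p - ν)) := by
        gcongr 2 ^ p * ?_
        refine mul_le_mul ((hγ σ ⟨h0, hσs⟩).trans ?_) ?_ (by positivity) (by positivity)
        · gcongr; exact le_abs_self γ
        · exact Real.rpow_le_rpow_of_nonpos hl hσl (by linarith)
      _ = 2 ^ p * |γ| * l ^ p := by
        rw [mul_assoc |γ|, ← Real.rpow_add hl]; ring_nf
      _ ≤ _ := by
        have := abs_nonneg γ
        gcongr
        linarith

theorem abs_filter_mul_le {B l : ℝ} (hl : 0 < l) (hgD : ∀ σ ∈ Set.Ioc 0 s, |σ * g l σ| ≤ D)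
    (hgB : ∀ σ ∈ Set.Ioc 0 s, |g l σ| ≤ B / l) {σ : ℝ} (hσ : σ ∈ Set.Ioc 0 s) :
    |g l σ| * (σ + l) ≤ D + B := by
  have h1 := hgD σ hσ
  have h2 := hgB σ hσ
  rw [abs_mul, abs_of_pos hσ.1] at h1
  rw [le_div_iff₀ hl] at h2
  linarith

end Qualification

/-! ### Summing bias and variance over the components -/

section ErrorBound

variable {H : Type*} [NormedAddCommGroup H] [InnerProductSpace ℝ H]
  {ι κ : Type*} {e : HilbertBasis ι ℝ H} {σ : ι → ℝ}

/-- Summation of the bias-variance decomposition over all components. -/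
theorem exists_hasSum_norm_sq_le (hσ0 : ∀ i, 0 ≤ σ i) {l τ : ℝ} (hl : 0 < l) (hτ1 : τ ≤ 1 / 2)
    {γ q : ι → ℝ} {N : κ × ι → ℝ} {K : ℝ} (hN0 : ∀ k i, σ i = 0 → N (k, i) = 0)
    (hγ : ∀ i, 0 < σ i → |γ i| * (σ i + l) ≤ K) {S : ℝ}
    (hS : HasSum (fun p : κ × ι => N p ^ 2 / (σ p.2 + l)) S) {D x ξ : κ → H}
    (hD : ∀ k i, inner ℝ (e i) (D k) = q i * inner ℝ (e i) (x k) - γ i * N (k, i))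
    {W : H →L[ℝ] H} (hW : IsDiag e (fun i => (σ i + l) ^ τ) W) {B : H →L[ℝ] H}
    (hB : IsDiag e (fun i => (σ i + l) ^ τ * q i) B) {A V : ℝ}
    (hBx : ∀ k, ‖B (x k)‖ ≤ A * ‖ξ k‖) (hξ : Summable fun k => ‖ξ k‖ ^ 2)
    (hV : ∑' k, ‖ξ k‖ ^ 2 ≤ V) :
    ∃ (b : κ → ℝ) (b' : ℝ), (∀ k, ‖W (D k)‖ ^ 2 ≤ b k) ∧ HasSum b b' ∧
      b' ≤ 2 * A ^ 2 * V + 2 * K ^ 2 * l ^ (2 * τ - 1) * S := by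
  have hpos : ∀ i, 0 < σ i + l := fun i => by linarith [hσ0 i]
  have hSk := hS.prod_fiberwise fun k => (hS.summable.prod_factor k).hasSum
  refine ⟨fun k => 2 * A ^ 2 * ‖ξ k‖ ^ 2 + 2 * K ^ 2 * l ^ (2 * τ - 1) *
    ∑' i, N (k, i) ^ 2 / (σ i + l), _, fun k => ?_,
    (hξ.hasSum.mul_left _).add (hSk.mul_left _), ?_⟩
  · have h1 := hB.hasSum_sq (x k)
    have h2 := (hS.summable.prod_factor k).hasSum.mul_left (2 * K ^ 2 * l ^ (2 * τ - 1))
    refine (hasSum_le (fun i => ?_) (hW.hasSum_sq (D k)) ((h1.mul_left 2).add h2)).trans ?_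
    · rw [hD]
      -- Since 2τ - 1 ≤ 0, the weight is at most l^(2τ-1) (σ + l). The remaining factor σ + l turns
      -- the filter into γ(σ + l) ≤ K against the noise weighted by 1/(σ + l).
      have hω : ((σ i + l) ^ τ) ^ 2 ≤ l ^ (2 * τ - 1) * (σ i + l) := by
        have e1 : ((σ i + l) ^ τ) ^ 2 = (σ i + l) ^ (2 * τ - 1) * (σ i + l) := by
          rw [← Real.rpow_add_one (hpos i).ne', ← Real.rpow_natCast,
            ← Real.rpow_mul (hpos i).le]
          push_cast
          ring_nf
        rw [e1]
        exact mul_le_mul_of_nonneg_right (Real.rpow_le_rpow_of_nonpos hl (by linarith [hσ0 i])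
          (by linarith)) (hpos i).le
      have h3 : ((σ i + l) ^ τ) ^ 2 * (γ i * N (k, i)) ^ 2 ≤
          K ^ 2 * l ^ (2 * τ - 1) * (N (k, i) ^ 2 / (σ i + l)) := by
        rcases (hσ0 i).eq_or_lt with h0 | h0
        · rw [hN0 k i h0.symm]; simp
        · have h4 : (γ i * (σ i + l)) ^ 2 ≤ K ^ 2 := by
            rw [← sq_abs, abs_mul, abs_of_pos (hpos i)]
            exact pow_le_pow_left₀ (mul_nonneg (abs_nonneg _) (hpos i).le) (hγ i h0) 2
          have hne := (hpos i).ne'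
          calc ((σ i + l) ^ τ) ^ 2 * (γ i * N (k, i)) ^ 2
              ≤ l ^ (2 * τ - 1) * (σ i + l) * (γ i * N (k, i)) ^ 2 := by gcongr
            _ = (γ i * (σ i + l)) ^ 2 * (l ^ (2 * τ - 1) * (N (k, i) ^ 2 / (σ i + l))) := by
                field_simp
            _ ≤ K ^ 2 * (l ^ (2 * τ - 1) * (N (k, i) ^ 2 / (σ i + l))) := by
                have := hpos i
                gcongr
            _ = _ := by ring
      set ω := (σ i + l) ^ τ
      set X := q i * inner ℝ (e i) (x k)
      have e2 : (ω * q i) ^ 2 * inner ℝ (e i) (x k) ^ 2 = ω ^ 2 * X ^ 2 := by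
        simp only [X]; ring
      rw [e2]
      nlinarith [mul_nonneg (sq_nonneg ω) (sq_nonneg (X + γ i * N (k, i)))]
    · refine add_le_add_left ?_ _
      have := pow_le_pow_left₀ (norm_nonneg _) (hBx k) 2
      rw [mul_pow] at this
      linarith
  · refine add_le_add_left (mul_le_mul_of_nonneg_left hV (by positivity)) _

end ErrorBound

/-! ### Typical samples have high probability -/

section GoodSample

variable {H Y G Z : Type*} [NormedAddCommGroup H] [InnerProductSpace ℝ H] [CompleteSpace H]
  [NormedAddCommGroup Y] [InnerProductSpace ℝ Y] [CompleteSpace Y]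
  [NormedAddCommGroup G] [InnerProductSpace ℝ G] [CompleteSpace G]

/-- The sample is typical: the empirical covariance is close to `C`, and the noise, in the metric
of the regularized empirical covariance, is of the expected size. -/
structure IsGoodSample (J : H →L[ℝ] Y →L[ℝ] G) (obs : Z → H × Y) (C D : H →L[ℝ] H)
    (K M a l L : ℝ) {n : ℕ} (z : Fin n → Z) : Prop where
  cov : ∀ h, inner ℝ h (C h) ≤
    K * L * (inner ℝ h (empCov (fun i => (obs (z i)).1) h) + l * ‖h‖ ^ 2)
  dev : ∀ h, ‖C h - empCov (fun i => (obs (z i)).1) h‖ ≤ K * √(L / n) * ‖h‖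
  dim : (n : ℝ)⁻¹ * ∑ i, ‖D (obs (z i)).1‖ ^ 2 ≤ K * L * l ^ (-a⁻¹)
  noise : (seqFold (fun s z => s.step J (obs z)) n (RidgeState.init H G (n * l)) z).energy ≤
    M ^ 2 * ((seqFold (fun s z => s.step J (obs z)) n (RidgeState.init H G (n * l)) z).P + 2 * L)

variable {X Ω : Type*} [MeasurableSpace X] [MeasurableSpace Ω]
  {J : H →L[ℝ] Y →L[ℝ] G}
  (hJ : ∀ h h' y y', inner ℝ (J h y) (J h' y') = inner ℝ h h' * inner ℝ y y')
  (pX : Measure X) [IsProbabilityMeasure pX] (cond : Kernel X Ω) [IsMarkovKernel cond]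
  {w : X → H} (hw : StronglyMeasurable w) {R : ℝ} (hR0 : 0 < R) (hR : ∀ x, ‖w x‖ ^ 2 ≤ R)
  {C : H →L[ℝ] H}
  (hC : ∀ h h', ∫ z, inner ℝ h (w z.1) * inner ℝ h' (w z.1) ∂(pX ⊗ₘ cond) = inner ℝ h (C h'))
  {f : HilbertBasis ℕ ℝ H} {m : ℕ → ℝ} (hm : ∀ j, 0 ≤ m j) (hCm : IsDiag f m C)
  {ε : X × Ω → Y} (hε : StronglyMeasurable ε) {M : ℝ} (hM0 : 0 < M)
  (hM : ∀ᵐ x ∂pX, (∀ᵐ y ∂cond x, ‖ε (x, y)‖ ≤ M) ∧ ∫ y, ε (x, y) ∂cond x = 0)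

include hJ hw hR0 hR hC hm hCm hε hM0 hM in
-- A union bound over four events, of probabilities 2, 2, 1 and 1 times exp(-L). The hypothesis
-- l^(-1/a) ≤ n l does not involve L, so no lower bound on n in terms of the confidence is required.
theorem measure_not_isGoodSample_le {a K₀ : ℝ} (ha : 0 < a) (hK₀ : 0 < K₀)
    (hdim : ∀ l : ℝ, 0 < l → l ≤ 1 → ∃ N : ℝ,
      HasSum (fun i => m i / (m i + l)) N ∧ 0 ≤ N ∧ N ≤ K₀ * l ^ (-a⁻¹)) :
    ∃ K ≥ 1, ∀ (n : ℕ) (l L : ℝ) (D : H →L[ℝ] H), 1 ≤ n → 0 < l → l ≤ 1 → 1 ≤ L →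
      l ^ (-a⁻¹) ≤ n * l → IsDiag f (fun j => (√(m j + l))⁻¹) D →
      Measure.pi (fun _ : Fin n => pX ⊗ₘ cond)
        {z | ¬ IsGoodSample J (fun z => (w z.1, ε z)) C D K M a l L z} ≤
          ENNReal.ofReal (6 * Real.exp (-L)) := by
  set c := 16 * R * (1 + K₀) + 2 with hc
  have hc2 : 2 ≤ c := by have : 0 ≤ 16 * R * (1 + K₀) := by positivity
                         linarith
  set K := c + 4 * R + (2 * K₀ + R) with hK
  refine ⟨K, by rw [hK]; linarith, fun n l L D hn hl hl1 hL hnl hD => ?_⟩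
  have hn0 : (0 : ℝ) < n := by exact_mod_cast hn
  have hL0 : 0 < L := by linarith
  have hml : ∀ j, 0 < m j + l := fun j => by linarith [hm j]
  obtain ⟨N, hN, hN0, hNK⟩ := hdim l hl hl1
  have ht1 : 1 ≤ l ^ (-a⁻¹) := Real.one_le_rpow_of_pos_of_le_one_of_nonpos hl hl1 (by
    have := inv_pos.2 ha; linarith)
  have hw' : StronglyMeasurable fun z : X × Ω => w z.1 := hw.comp_measurable measurable_fst
  -- The covariance comparison is made at an inflated parameter, which meets its sample size
  -- condition for every L. Afterwards 2 C_z + l' ≤ c L (C_z + l).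
  set l' := c * L * l with hl'
  have hcL : 2 ≤ c * L := by nlinarith
  have hll' : l ≤ l' := by rw [hl']; nlinarith
  have hle : ∀ i, m i / (m i + l') ≤ m i / (m i + l) := fun i =>
    div_le_div_of_nonneg_left (hm i) (hml i) (by linarith)
  have hs' := hN.summable.of_nonneg_of_le
    (fun i => div_nonneg (hm i) (by linarith [hm i])) hle
  have hN' : ∑' i, m i / (m i + l') ≤ N := (hs'.tsum_le_tsum hle hN.summable).trans hN.tsum_eq.le
  have b1 := measure_covariance_gt_le (pX ⊗ₘ cond) hw' (fun z => hR z.1) hC hm hCm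
    (l := l') (L := L) (by linarith) hn hs'.hasSum hR0 (by
      have h1 : 1 + ∑' i, m i / (m i + l') ≤ (1 + K₀) * (n * l) := by nlinarith
      calc 16 * R * (1 + ∑' i, m i / (m i + l')) * L ≤ 16 * R * ((1 + K₀) * (n * l)) * L := by
            gcongr
        _ = (16 * R * (1 + K₀)) * L * (n * l) := by ring
        _ ≤ c * L * (n * l) := by gcongr; rw [hc]; linarith
        _ = n * l' := by rw [hl']; ring)
  have b2 := measure_norm_covariance_sub_le (pX ⊗ₘ cond) hw' (fun z => hR z.1) hC hn hL0.le hR0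
  have hDn : ∀ x, ‖D (w x)‖ ^ 2 ≤ R / l := fun x => by
    have h1 := hD.norm_le (K := (√l)⁻¹) (by positivity) (fun j => by
      rw [abs_of_nonneg (by positivity)]
      exact inv_anti₀ (Real.sqrt_pos.2 hl) (Real.sqrt_le_sqrt (by linarith [hm j]))) (w x)
    calc ‖D (w x)‖ ^ 2 ≤ ((√l)⁻¹ * ‖w x‖) ^ 2 := pow_le_pow_left₀ (norm_nonneg _) h1 2
      _ = ‖w x‖ ^ 2 / l := by rw [mul_pow, inv_pow, Real.sq_sqrt hl.le]; ring
      _ ≤ R / l := by gcongr; exact hR x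
  have b3 := measure_sum_gt_le (pX ⊗ₘ cond) (φ := fun z : X × Ω => ‖D (w z.1)‖ ^ 2)
    ((D.continuous.comp_stronglyMeasurable hw').norm.measurable.pow_const 2)
    (B := R / l) (m := N) (by positivity) (fun z => sq_nonneg _) (fun z => hDn z.1)
    (integral_norm_sq_diag (pX ⊗ₘ cond) hw' (fun z => hR z.1) hC hCm hD (by
      refine hN.congr_fun fun j => ?_
      rw [inv_pow, Real.sq_sqrt (hml j).le, inv_mul_eq_div])).le n L
  have b4 := RidgeState.measure_energy_gt_le (G := G) hJ pX cond hw hε hM0 hM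
    (c := n * l) (by positivity) n L
  refine (measure_mono (t := _ ∪ (_ ∪ (_ ∪ _))) ?_).trans
    ((measure_union_le _ _).trans (add_le_add b1
      ((measure_union_le _ _).trans (add_le_add b2
        ((measure_union_le _ _).trans (add_le_add b3 b4)))))) |>.trans ?_
  · intro z hz
    by_contra hcon
    simp only [Set.mem_union, Set.mem_ofPred_eq, not_or, not_exists, not_lt] at hcon
    obtain ⟨h1, h2, h3, h4⟩ := hcon
    refine hz ⟨fun h => ?_, fun h => (h2 h).trans ?_, ?_, h4⟩
    · refine (h1 h).trans ?_
      have hpos : 0 ≤ inner ℝ h (empCov (fun i => w (z i).1) h) := by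
        rw [inner_empCov]
        exact mul_nonneg (by positivity) (Finset.sum_nonneg fun _ _ => mul_self_nonneg _)
      have hKc : c * L ≤ K * L := by
        gcongr
        rw [hK]; linarith
      calc _ ≤ c * L * inner ℝ h (empCov (fun i => w (z i).1) h) + c * L * l * ‖h‖ ^ 2 := by
            gcongr
        _ = c * L * (inner ℝ h (empCov (fun i => w (z i).1) h) + l * ‖h‖ ^ 2) := by ring
        _ ≤ _ := mul_le_mul_of_nonneg_right hKc (by positivity)
    · gcongr
      rw [hK]; linarith
    · have h5 : (n : ℝ)⁻¹ * ∑ i, ‖D (w (z i).1)‖ ^ 2 ≤ (n : ℝ)⁻¹ * (2 * n * N + R / l * L) := by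
        gcongr
      have h6 : (n : ℝ)⁻¹ * (2 * n * N + R / l * L) = 2 * N + R * L / (n * l) := by
        field_simp
      have h7 : R * L / (n * l) ≤ R * L := div_le_self (by positivity) (ht1.trans hnl)
      have h8 : N ≤ K₀ * L * l ^ (-a⁻¹) := hNK.trans (by
        gcongr
        exact le_mul_of_one_le_right hK₀.le hL)
      have h9 : R * L ≤ R * L * l ^ (-a⁻¹) := le_mul_of_one_le_right (by positivity) ht1
      have h10 : (2 * K₀ + R) * (L * l ^ (-a⁻¹)) ≤ K * (L * l ^ (-a⁻¹)) := by
        gcongr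
        rw [hK]; linarith
      change (n : ℝ)⁻¹ * ∑ i, ‖D (w (z i).1)‖ ^ 2 ≤ _
      linarith
  · rw [← ENNReal.ofReal_add (by positivity) (by positivity),
      ← ENNReal.ofReal_add (by positivity) (by positivity),
      ← ENNReal.ofReal_add (by positivity) (by positivity)]
    refine ENNReal.ofReal_le_ofReal (le_of_eq ?_)
    ring

end GoodSample

/-! ### Size of the noise on a typical sample -/

section Noise

variable {H Y G Z : Type*} [NormedAddCommGroup H] [InnerProductSpace ℝ H] [CompleteSpace H]
  [NormedAddCommGroup Y] [InnerProductSpace ℝ Y] [CompleteSpace Y]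
  [NormedAddCommGroup G] [InnerProductSpace ℝ G] [CompleteSpace G]
  {J : H →L[ℝ] Y →L[ℝ] G}
  (hJ : ∀ h h' y y', inner ℝ (J h y) (J h' y') = inner ℝ h h' * inner ℝ y y')
  {obs : Z → H × Y} {C D : H →L[ℝ] H} {f : HilbertBasis ℕ ℝ H} {μ : ℕ → ℝ}

include hJ in
-- The energy is controlled by the leverage, the leverage by the empirical log-determinant, and this
-- by the population one plus the averaged effective dimension. The additive 2L is absorbed since
-- l^(-1/a) ≥ 1.
theorem IsGoodSample.exists_hasSum_noise (hμ : ∀ j, 0 ≤ μ j) {K M a l L K₁ ℓ : ℝ} {n : ℕ}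
    {z : Fin n → Z} (hn : 1 ≤ n) (hl : 0 < l) (hl1 : l ≤ 1) (hL : 1 ≤ L) (ha : 0 < a)
    (hK₁ : 0 ≤ K₁)
    (hz : IsGoodSample J obs C D K M a l L z) (hD : IsDiag f (fun j => (√(μ j + l))⁻¹) D)
    (hℓ : HasSum (fun j => Real.log (1 + μ j / l)) ℓ) (hℓK : ℓ ≤ K₁ * l ^ (-a⁻¹)) :
    ∃ (s : Set H) (e : HilbertBasis s ℝ H) (σ : s → ℝ) (F : Finset s),
      IsDiag e σ (empCov fun t => (obs (z t)).1) ∧ (∀ i, 0 ≤ σ i) ∧ (∀ i ∉ F, σ i = 0) ∧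
      ∀ {κ : Type _} (u : κ → Y) (B : HilbertBasis (κ × s) ℝ G),
        (∀ p, B p = J (e p.2) (u p.1)) →
        ∃ S, HasSum (fun p : κ × s => inner ℝ (J (e p.2) (u p.1))
            ((n : ℝ)⁻¹ • ∑ t, J (obs (z t)).1 (obs (z t)).2) ^ 2 / (σ p.2 + l)) S ∧
          S ≤ M ^ 2 * (K₁ + K + 2) * L * ((n : ℝ)⁻¹ * l ^ (-a⁻¹)) := by
  obtain ⟨s, e, σ, F, hσ, hσ0, hσF, hP, hsum⟩ := exists_spectral_ridge (obs := obs) hJ hn z hl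
  refine ⟨s, e, σ, F, hσ, hσ0, hσF, fun u B hB => ⟨_, hsum u B hB, ?_⟩⟩
  have h1 := sum_log_le hσ0 hσ F hμ hl hℓ hD
  have h2 := hz.dim
  have ht1 : 1 ≤ l ^ (-a⁻¹) := Real.one_le_rpow_of_pos_of_le_one_of_nonpos hl hl1 (by
    have := inv_pos.2 ha; linarith)
  have h3 : K₁ * l ^ (-a⁻¹) ≤ K₁ * (L * l ^ (-a⁻¹)) := by
    gcongr
    exact le_mul_of_one_le_left (by positivity) hL
  have h4 : L ≤ L * l ^ (-a⁻¹) := le_mul_of_one_le_right (by linarith) ht1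
  set st := seqFold (fun s z => s.step J (obs z)) n (RidgeState.init H G (n * l)) z
  have h5 : st.P + 2 * L ≤ (K₁ + K + 2) * (L * l ^ (-a⁻¹)) := by linarith
  calc (n : ℝ)⁻¹ * st.energy ≤ (n : ℝ)⁻¹ * (M ^ 2 * (st.P + 2 * L)) := by
        gcongr; exact hz.noise
    _ ≤ (n : ℝ)⁻¹ * (M ^ 2 * ((K₁ + K + 2) * (L * l ^ (-a⁻¹)))) := by gcongr
    _ = _ := by ring

end Noise

/-! ### Deterministic error bound on a typical sample -/

section Error

/-- The integer is ⌈r⌉ - 1 rather than the floor, so that the fractional exponent stays positive, as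
Heinz requires. -/
theorem exists_nat_add_eq {r : ℝ} (hr : 0 < r) :
    ∃ (m : ℕ) (ρ : ℝ), 0 < ρ ∧ ρ ≤ 1 ∧ (m : ℝ) + ρ = r ∧ (r ≤ 1 / 2 → ρ ≤ 1 / 2) := by
  have h1 : 1 ≤ ⌈r⌉₊ := Nat.one_le_ceil_iff.2 hr
  have h2 := Nat.le_ceil r
  have h3 := Nat.ceil_lt_add_one hr.le
  refine ⟨⌈r⌉₊ - 1, r - (⌈r⌉₊ - 1 : ℕ), ?_, ?_, by ring, fun h => ?_⟩
  · push_cast [h1]; linarith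
  · push_cast [h1]; linarith
  · have : (0 : ℝ) ≤ (⌈r⌉₊ - 1 : ℕ) := Nat.cast_nonneg _
    linarith

variable {X Y H G : Type*} [NormedAddCommGroup Y] [InnerProductSpace ℝ Y] [CompleteSpace Y]
  [NormedAddCommGroup H] [InnerProductSpace ℝ H] [CompleteSpace H] [RKHS ℝ H X ℝ]
  [NormedAddCommGroup G] [InnerProductSpace ℝ G] [CompleteSpace G] [RKHS ℝ G X Y]
  {J : H →L[ℝ] Y →L[ℝ] G} (hJx : ∀ h y x, J h y x = h x • y)
  (hJk : ∀ x y, J (feature H x) y = RKHS.kerFun G x y)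
  (hJ : ∀ h h' y y', inner ℝ (J h y) (J h' y') = inner ℝ h h' * inner ℝ y y')
  {β : X → ℝ} (hβ : ∀ x, 0 ≤ β x)

theorem le_of_isDiag_empCov {ι : Type*} {e : HilbertBasis ι ℝ H} {σ : ι → ℝ} {n : ℕ} (hn : 1 ≤ n)
    {w : Fin n → H} {s : ℝ} (hw : ∀ t, ‖w t‖ ^ 2 ≤ s) (hσ : IsDiag e σ (empCov w)) (i : ι) :
    σ i ≤ s := by
  have hn0 : (0 : ℝ) < n := by exact_mod_cast hn
  have h1 := inner_empCov w (e i) (e i)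
  rw [hσ, real_inner_self_eq_norm_sq, e.orthonormal.1, one_pow, mul_one] at h1
  have h2 : ∑ t, inner ℝ (w t) (e i) * inner ℝ (w t) (e i) ≤ ∑ _t : Fin n, s := by
    refine Finset.sum_le_sum fun t _ => le_trans ?_ (hw t)
    rw [← sq, ← sq_abs]
    refine pow_le_pow_left₀ (abs_nonneg _) ?_ 2
    simpa [e.orthonormal.1] using abs_real_inner_le_norm (w t) (e i)
  rw [Finset.sum_const, Finset.card_univ, Fintype.card_fin, nsmul_eq_mul] at h2
  rw [h1, inv_mul_le_iff₀ hn0]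
  exact h2

set_option maxHeartbeats 1000000 in
include hJx hJk hJ hβ in
/-- The error of the estimator on a typical sample. -/
theorem exists_error_bound [TopologicalSpace.SeparableSpace H] {C : H →L[ℝ] H}
    {f : HilbertBasis ℕ ℝ H} {μ : ℕ → ℝ} (hμ0 : ∀ j, 0 ≤ μ j) (hC : IsDiag f μ C)
    {P : ℝ → H →L[ℝ] H} (hP : ∀ p, 0 < p → IsDiag f (fun j => μ j ^ p) (P p))
    {c s : ℝ} (hc : 1 ≤ c) (hμc : ∀ j, μ j ≤ c) (hsc : s ≤ c)
    (hw : ∀ x, ‖wFeature H β x‖ ^ 2 ≤ s) {g : ℝ → ℝ → ℝ} {D₀ B₀ γ ν : ℝ} (hD₀ : 0 ≤ D₀)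
    (hgD : ∀ l ∈ Set.Ioc 0 s, ∀ σ ∈ Set.Ioc 0 s, |σ * g l σ| ≤ D₀)
    (hgB : ∀ l ∈ Set.Ioc 0 s, ∀ σ ∈ Set.Ioc 0 s, |g l σ| ≤ B₀ / l)
    (hγ : ∀ l ∈ Set.Ioc 0 s, ∀ σ ∈ Set.Ioc 0 s, |1 - σ * g l σ| * σ ^ ν ≤ γ * l ^ ν)
    {r a : ℝ} (hr : 0 < r) (ha : 0 < a) {κ : Type*} (u : HilbertBasis κ ℝ Y) {fstar : G}
    {ξ : κ → H} (hx : ∀ k, component J (u k) fstar = P r (ξ k))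
    (hξ : Summable fun k => ‖ξ k‖ ^ 2) {K M K₁ : ℝ} (hK : 1 ≤ K) (hK₁ : 0 ≤ K₁) :
    ∃ K' > 0, ∀ (n : ℕ) (z : Fin n → X × Y) (l L ℓ : ℝ) (D : H →L[ℝ] H), 1 ≤ n → 0 < l → l ≤ 1 →
      l ≤ s → 1 ≤ L → (n : ℝ)⁻¹ = l ^ (2 * r + 1 + a⁻¹) →
      IsDiag f (fun j => (√(μ j + l))⁻¹) D → HasSum (fun j => Real.log (1 + μ j / l)) ℓ →
      ℓ ≤ K₁ * l ^ (-a⁻¹) →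
      IsGoodSample J (fun z => (wFeature H β z.1, wResidual β fstar z)) C D K M a l L z →
      ∀ τ, 0 ≤ τ → τ ≤ 1 / 2 → r + τ ≤ ν →
        ∃ (t : Set H) (e : HilbertBasis t ℝ H) (σ : t → ℝ) (W : H →L[ℝ] H) (b : κ → ℝ) (b' : ℝ),
          (∀ i, 0 ≤ σ i) ∧ IsDiag e σ (empCov fun i => wFeature H β (z i).1) ∧
          IsDiag e (fun i => (σ i + l) ^ τ) W ∧
          (∀ k, ‖W (component J (u k) (fstar - estimator G β g l z))‖ ^ 2 ≤ b k) ∧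
          HasSum b b' ∧ b' ≤ K' * L * l ^ (2 * r + 2 * τ) := by
  obtain ⟨m, ρ, hρ0, hρ1, hmρ, hρr⟩ := exists_nat_add_eq hr
  set Kq := 2 ^ ν * (1 + D₀ + |γ|) with hKq
  have hKq0 : 0 < Kq := by positivity
  have hc0 : 0 < c := by linarith
  set KA := K * Kq * (2 + m * c ^ r) with hKA
  set V := ∑' k, ‖ξ k‖ ^ 2 with hV
  have hV0 : 0 ≤ V := tsum_nonneg fun _ => sq_nonneg _
  refine ⟨2 * KA ^ 2 * V + 2 * (D₀ + B₀) ^ 2 * (M ^ 2 * (K₁ + K + 2)) + 1, by positivity, ?_⟩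
  intro n z l L ℓ D hn hl hl1 hls hL hnl hD hℓ hℓK hgood τ hτ0 hτ1 hν
  have hn0 : (0 : ℝ) < n := by exact_mod_cast hn
  have hlmem : l ∈ Set.Ioc 0 s := ⟨hl, hls⟩
  obtain ⟨t, e, σ, F, hσ, hσ0, hσF, hnoise⟩ :=
    hgood.exists_hasSum_noise hJ hμ0 hn hl hl1 hL ha hK₁ hD hℓ hℓK
  obtain ⟨Bt, hBt⟩ := exists_tensorBasis hJk hJ e u
  obtain ⟨S, hS, hSle⟩ := hnoise u Bt hBt
  have hσs : ∀ i, σ i ≤ s := le_of_isDiag_empCov hn (fun i => hw _) hσ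
  have hpos : ∀ i, 0 < σ i + l := fun i => by linarith [hσ0 i]
  have hres : ∀ i p, 0 ≤ p → p ≤ ν → |1 - σ i * g l (σ i)| * (σ i + l) ^ p ≤ Kq * l ^ p :=
    fun i p hp0 hpν => abs_residual_mul_rpow_le hl hD₀ (hgD l hlmem) (hγ l hlmem) (hσ0 i) (hσs i)
      hp0 hpν
  have hexp : ∀ p : ℝ, 0 ≤ p → ∃ W : H →L[ℝ] H, IsDiag e (fun i => (σ i + l) ^ p) W := fun p hp =>
    exists_isDiag e _ (K := (s + l) ^ p) fun i => by
      rw [abs_of_nonneg (Real.rpow_nonneg (hpos i).le _)]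
      exact Real.rpow_le_rpow (hpos i).le (by linarith [hσs i]) hp
  obtain ⟨W, hW⟩ := hexp τ hτ0
  obtain ⟨Q, hQ⟩ := hexp ρ hρ0.le
  have hd0 : ∀ i, |(σ i + l) ^ τ * (1 - σ i * g l (σ i))| ≤ Kq * l ^ τ := fun i => by
    rw [abs_mul, abs_of_nonneg (Real.rpow_nonneg (hpos i).le _), mul_comm]
    exact hres i τ hτ0 (by linarith)
  obtain ⟨B, hB⟩ := exists_isDiag e (fun i => (σ i + l) ^ τ * (1 - σ i * g l (σ i))) hd0
  have hd1 : ∀ i, |(σ i + l) ^ ρ| * (σ i ^ m * |(σ i + l) ^ τ * (1 - σ i * g l (σ i))|) ≤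
      Kq * l ^ (r + τ) := fun i => by
    refine le_trans (le_of_eq_of_le ?_ (mul_le_mul_of_nonneg_left (?_ : (σ i + l) ^ ρ *
      σ i ^ m * (σ i + l) ^ τ ≤ (σ i + l) ^ (r + τ)) (abs_nonneg (1 - σ i * g l (σ i)))))
      (hres i (r + τ) (by linarith) hν)
    · rw [abs_mul, abs_of_nonneg (Real.rpow_nonneg (hpos i).le ρ),
        abs_of_nonneg (Real.rpow_nonneg (hpos i).le τ)]
      ring
    · have h1 : σ i ^ m ≤ (σ i + l) ^ (m : ℝ) := by
        rw [Real.rpow_natCast]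
        exact pow_le_pow_left₀ (hσ0 i) (by linarith) m
      rw [← hmρ, Real.rpow_add (hpos i), Real.rpow_add (hpos i), mul_comm ((σ i + l) ^ (m : ℝ))]
      have := hpos i
      gcongr
  have hsL : 1 ≤ √L := Real.one_le_sqrt.2 hL
  -- From 1/n = l^(2r + 1 + 1/a), discarding the factor l^(1/(2a)) ≤ 1.
  have hdevn : √(L / n) ≤ √L * l ^ (r + 1 / 2) := by
    rw [div_eq_mul_inv, hnl, Real.sqrt_mul (by linarith), Real.sqrt_eq_rpow (l ^ _),
      ← Real.rpow_mul hl.le]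
    refine mul_le_mul_of_nonneg_left (Real.rpow_le_rpow_of_exponent_ge hl hl1 ?_)
      (Real.sqrt_nonneg _)
    have := inv_pos.2 ha
    linarith
  have hdevr : K * √(L / n) ≤ K * (√L * l ^ r) := by
    gcongr
    refine hdevn.trans (mul_le_mul_of_nonneg_left (Real.rpow_le_rpow_of_exponent_ge hl hl1
      (by linarith)) (Real.sqrt_nonneg _))
  have hheinz : ∀ v, ‖P ρ v‖ ≤ 2 * K * √L * ‖Q v‖ := by
    intro v
    -- For r ≤ 1/2 the form inequality with constant K L is enough. For r > 1/2 the deviation is at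
    -- most K √L l, so E/l ≤ K √L. Both cases lose only √L.
    rcases le_or_gt r (1 / 2) with hr2 | hr2
    · refine (norm_rpow_le_of_le hμ0 hC hσ0 hσ hl (A := K * L) (c := c) (by nlinarith) hμc
        (fun i => (hσs i).trans hsc) hgood.cov hρ0 (hρr hr2) (hP ρ hρ0) hQ v).trans ?_
      refine mul_le_mul_of_nonneg_right ?_ (norm_nonneg _)
      rw [Real.sqrt_mul (by linarith)]
      have hKs : √K ≤ K := Real.sqrt_le_iff.2 ⟨by linarith, by nlinarith⟩
      nlinarith [Real.sqrt_nonneg K]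
    · refine (norm_rpow_le_of_norm_sub_le hμ0 hC hσ0 hσ hl (by positivity) hgood.dev hρ0 hρ1
        (hP ρ hρ0) hQ v).trans ?_
      refine mul_le_mul_of_nonneg_right ?_ (norm_nonneg _)
      have h1 : K * √(L / n) / l ≤ K * √L := by
        rw [div_le_iff₀ hl, mul_assoc]
        gcongr
        refine hdevn.trans (mul_le_mul_of_nonneg_left ?_ (Real.sqrt_nonneg _))
        calc l ^ (r + 1 / 2) ≤ l ^ (1 : ℝ) :=
              Real.rpow_le_rpow_of_exponent_ge hl hl1 (by linarith)
          _ = l := Real.rpow_one l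
      nlinarith
  have hPB : ∀ v, ‖P r (B v)‖ ≤ KA * √L * l ^ (r + τ) * ‖v‖ := by
    intro v
    have h1 := norm_rpow_comp_le hμ0 hC hσ0 hσ hc hμc (fun i => (hσs i).trans hsc) hρ0
      (by positivity) (by positivity) hgood.dev hP hQ hheinz m hB (by positivity) (by positivity)
      hd0 hd1 v
    rw [hmρ] at h1
    refine h1.trans (mul_le_mul_of_nonneg_right ?_ (norm_nonneg _))
    have h2 : m * c ^ r * (K * √(L / n)) * (Kq * l ^ τ) ≤
        m * c ^ r * (K * (√L * l ^ r)) * (Kq * l ^ τ) := by gcongr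
    refine (add_le_add_right h2 _).trans (le_of_eq ?_)
    rw [Real.rpow_add hl, hKA]
    ring
  have hBx : ∀ k, ‖B (component J (u k) fstar)‖ ≤ KA * √L * l ^ (r + τ) * ‖ξ k‖ := fun k => by
    rw [hx]
    exact norm_comp_le_of_symm hB (hP r hr) hPB _
  obtain ⟨b, b', hb, hsum, hb'⟩ := exists_hasSum_norm_sq_le hσ0 hl hτ1
    (γ := fun i => g l (σ i)) (q := fun i => 1 - σ i * g l (σ i))
    (N := fun p : κ × t => inner ℝ (J (e p.2) (u p.1))
        ((n : ℝ)⁻¹ • ∑ t, J (wFeature H β (z t).1) (wResidual β fstar (z t))))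
    (K := D₀ + B₀)
    (fun k i hi => inner_noise_eq_zero hJ z hσ hn fstar (u k) hi)
    (fun i hi => abs_filter_mul_le hl (hgD l hlmem) (hgB l hlmem) ⟨hi, hσs i⟩)
    hS (D := fun k => component J (u k) (fstar - estimator G β g l z))
    (fun k i => inner_component_error hJx hJk hJ hβ z hσ hσF u g l fstar (u k) i)
    hW hB hBx hξ hV.symm.le
  refine ⟨t, e, σ, W, b, b', hσ0, hσ, hW, hb, hsum, hb'.trans ?_⟩
  have hL2 : √L ^ 2 = L := Real.sq_sqrt (by linarith)
  have hl2 : (l ^ (r + τ)) ^ 2 = l ^ (2 * r + 2 * τ) := by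
    rw [← Real.rpow_natCast, ← Real.rpow_mul hl.le]; push_cast; ring_nf
  have h1 : 2 * (KA * √L * l ^ (r + τ)) ^ 2 * V = 2 * KA ^ 2 * V * (L * l ^ (2 * r + 2 * τ)) := by
    rw [mul_pow, mul_pow, hL2, hl2]; ring
  -- The balance that dictates λ: the variance is exactly of the order of the squared bias.
  have h2 : l ^ (2 * τ - 1) * ((n : ℝ)⁻¹ * l ^ (-a⁻¹)) = l ^ (2 * r + 2 * τ) := by
    rw [hnl, ← Real.rpow_add hl, ← Real.rpow_add hl]; ring_nf
  have h3 : 2 * (D₀ + B₀) ^ 2 * l ^ (2 * τ - 1) * S ≤ 2 * (D₀ + B₀) ^ 2 * l ^ (2 * τ - 1) *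
      (M ^ 2 * (K₁ + K + 2) * L * ((n : ℝ)⁻¹ * l ^ (-a⁻¹))) :=
    mul_le_mul_of_nonneg_left hSle (by positivity)
  have h4 : 2 * (D₀ + B₀) ^ 2 * l ^ (2 * τ - 1) *
      (M ^ 2 * (K₁ + K + 2) * L * ((n : ℝ)⁻¹ * l ^ (-a⁻¹))) =
      2 * (D₀ + B₀) ^ 2 * (M ^ 2 * (K₁ + K + 2)) * (L * l ^ (2 * r + 2 * τ)) := by
    rw [← h2]; ring
  have h5 : 0 ≤ L * l ^ (2 * r + 2 * τ) := by positivity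
  linarith

end Error

/-! ### The source condition in components -/

section Source

theorem separableSpace_of_hilbertBasis {H : Type*} [NormedAddCommGroup H] [InnerProductSpace ℝ H]
    {ι : Type*} [Countable ι] (f : HilbertBasis ι ℝ H) : TopologicalSpace.SeparableSpace H := by
  have h1 := ((Set.countable_range f).isSeparable.span (R := ℝ)).closure
  rw [← Submodule.topologicalClosure_coe, f.dense_span, Submodule.top_coe] at h1
  exact TopologicalSpace.isSeparable_univ_iff.1 h1

variable {H Y : Type*} [NormedAddCommGroup H] [InnerProductSpace ℝ H] [CompleteSpace H]
  [NormedAddCommGroup Y] [InnerProductSpace ℝ Y] [CompleteSpace Y]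

/-- An operator and its adjoint have the same Hilbert-Schmidt norm: expand each ‖Co* u_k‖² in the
basis f and apply Bessel in `Y`. -/
theorem IsHilbertSchmidt.summable_norm_adjoint_sq {Co : H →L[ℝ] Y} (hCo : IsHilbertSchmidt Co)
    {ι κ : Type*} (f : HilbertBasis ι ℝ H) (u : HilbertBasis κ ℝ Y) :
    Summable fun k => ‖ContinuousLinearMap.adjoint Co (u k)‖ ^ 2 := by
  classical
  obtain ⟨M, hM⟩ := hCo
  have hinj : Function.Injective f := f.orthonormal.linearIndependent.injective
  have h1 : Summable fun i => ‖Co (f i)‖ ^ 2 := by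
    refine summable_of_sum_le (c := M) (fun i => sq_nonneg _) fun F => ?_
    have hmem : ∀ v : F.image f, (v : H) ∈ Set.range f := fun v => by
      obtain ⟨i, -, hi⟩ := Finset.mem_image.1 v.2
      exact ⟨i, hi⟩
    have hon := f.orthonormal.toSubtypeRange.comp (fun v : F.image f => ⟨(v : H), hmem v⟩)
      fun v v' hv => Subtype.ext (Subtype.mk.inj hv)
    have h2 := hM (F.image f) hon
    rwa [Finset.sum_image fun i _ j _ h => hinj h] at h2
  refine summable_of_sum_le (c := ∑' i, ‖Co (f i)‖ ^ 2) (fun k => sq_nonneg _) fun F => ?_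
  have h2 : HasSum (fun i => ∑ k ∈ F, inner ℝ (f i) (ContinuousLinearMap.adjoint Co (u k)) ^ 2)
      (∑ k ∈ F, ‖ContinuousLinearMap.adjoint Co (u k)‖ ^ 2) :=
    hasSum_sum fun k _ => hasSum_inner_sq f _
  refine hasSum_le (fun i => ?_) h2 h1.hasSum
  have h3 := sum_le_hasSum F (fun _ _ => sq_nonneg _) (hasSum_inner_sq u (Co (f i)))
  refine (Finset.sum_congr rfl fun k _ => ?_).trans_le h3
  rw [ContinuousLinearMap.adjoint_inner_right, real_inner_comm]

variable {X G : Type*} [RKHS ℝ H X ℝ]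
  [NormedAddCommGroup G] [InnerProductSpace ℝ G] [CompleteSpace G] [RKHS ℝ G X Y]
  {J : H →L[ℝ] Y →L[ℝ] G} (hJk : ∀ x y, J (feature H x) y = RKHS.kerFun G x y)

include hJk in
/-- The source condition, component by component. -/
theorem exists_component_source {κ : Type*} (u : HilbertBasis κ ℝ Y) {fstar : G}
    {Cstar : H →L[ℝ] Y} (hCstar : ∀ x, fstar x = Cstar (feature H x)) {C : H →L[ℝ] H}
    (hsymm : ∀ v w, inner ℝ (C v) w = inner ℝ v (C w)) {f : HilbertBasis ℕ ℝ H} {μ : ℕ → ℝ}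
    (hμ : ∀ i, C (f i) = μ i • f i) {r : ℝ} {P : H →L[ℝ] H} (hP : IsDiag f (fun j => μ j ^ r) P)
    (hsource : ∃ Co : H →L[ℝ] Y, IsHilbertSchmidt Co ∧
      Cstar = Co ∘L spectralFun (fun t => t ^ r) C) :
    ∃ ξ : κ → H, (∀ k, component J (u k) fstar = P (ξ k)) ∧ Summable fun k => ‖ξ k‖ ^ 2 := by
  obtain ⟨Co, hHS, hCo⟩ := hsource
  have hcomp : ∀ k, component J (u k) fstar = ContinuousLinearMap.adjoint Cstar (u k) := fun k =>
    RKHS.ext fun x => by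
      rw [← inner_feature, ← inner_feature, component_apply hJk, hCstar,
        ContinuousLinearMap.adjoint_inner_right, real_inner_comm]
  -- If the defining series diverged, `spectralFun` would be 0 by default; then C_* = 0 and ξ = 0
  -- works.
  by_cases hs : Summable fun σ : ℝ =>
      σ ^ r • (C - σ • ContinuousLinearMap.id ℝ H).ker.starProjection
  · refine ⟨fun k => ContinuousLinearMap.adjoint Co (u k), fun k => ?_,
      hHS.summable_norm_adjoint_sq f u⟩
    rw [hcomp]
    refine ext_inner_left ℝ fun h => ?_
    have hPh : spectralFun (fun t => t ^ r) C h = P h := ext_inner_hilbertBasis f fun i => by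
      rw [inner_spectralFun hs hsymm (hμ i), hP]
    rw [ContinuousLinearMap.adjoint_inner_right, hCo, ContinuousLinearMap.comp_apply, hPh,
      ← hP.inner_left, ContinuousLinearMap.adjoint_inner_right]
  · refine ⟨fun _ => 0, fun k => ?_, by simp⟩
    have h0 : spectralFun (fun t => t ^ r) C = 0 := tsum_eq_zero_of_not_summable hs
    rw [hcomp, hCo, h0]
    simp

end Source

/-! ### Change of measure and the weighted residuals -/

section Sampling

variable {X Y H G : Type*} [MeasurableSpace X]
  [NormedAddCommGroup Y] [InnerProductSpace ℝ Y] [CompleteSpace Y]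
  [NormedAddCommGroup H] [InnerProductSpace ℝ H] [CompleteSpace H] [RKHS ℝ H X ℝ]
  [NormedAddCommGroup G] [InnerProductSpace ℝ G] [CompleteSpace G] [RKHS ℝ G X Y]
  (pX qX : Measure X) [IsProbabilityMeasure pX] [IsProbabilityMeasure qX]
  {β : X → ℝ} (hβmeas : Measurable β) (hβ0 : ∀ x, 0 ≤ β x)
  (hq : qX = pX.withDensity fun x => ENNReal.ofReal (β x))

include hβmeas hβ0 hq in
-- The two factors √β combine into the density β of the target law, so the covariance of the
-- weighted features under the source is C_X.
theorem integral_wFeature_mul [MeasurableSpace Y] (cond : Kernel X Y) [IsMarkovKernel cond]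
    (f : HilbertBasis ℕ ℝ H)
    (hk : ∀ t : X, Measurable fun x => scalarKernel H x t) {κ : ℝ}
    (hκ : ∀ x : X, scalarKernel H x x ≤ κ ^ 2) (h h' : H) :
    ∫ z, inner ℝ h (wFeature H β z.1) * inner ℝ h' (wFeature H β z.1) ∂(pX ⊗ₘ cond) =
      inner ℝ h (covOp H qX h') := by
  have hm : Measurable fun x : X => β x * (h x * h' x) :=
    hβmeas.mul ((measurable_eval hk h).mul (measurable_eval hk h'))
  have e1 : ∀ z : X × Y, inner ℝ h (wFeature H β z.1) * inner ℝ h' (wFeature H β z.1) =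
      β z.1 * (h z.1 * h' z.1) := fun z => by
    rw [real_inner_comm, real_inner_comm _ h', inner_wFeature_mul hβ0]
  simp_rw [e1]
  rw [inner_covOp f hk hκ, hq,
    integral_withDensity_eq_integral_toReal_smul hβmeas.ennreal_ofReal
      (Filter.Eventually.of_forall fun x => ENNReal.ofReal_lt_top)]
  have e2 := integral_map (μ := pX ⊗ₘ cond) (φ := Prod.fst) measurable_fst.aemeasurable
    (f := fun x : X => β x * (h x * h' x)) hm.aestronglyMeasurable
  rw [← e2, ← Measure.fst, Measure.fst_compProd]
  refine integral_congr_ae (Filter.Eventually.of_forall fun x => ?_)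
  simp only [ENNReal.toReal_ofReal (hβ0 x), smul_eq_mul, real_inner_comm (feature H x) h,
    inner_feature]

include hβmeas hβ0 hq in
/-- The weighted residuals are bounded and centered. -/
theorem ae_wResidual [MeasurableSpace Y] [BorelSpace Y] [SecondCountableTopology Y]
    (cond : Kernel X Y) [IsMarkovKernel cond] {b : ℝ} (hβb : ∀ x, β x ≤ b) {M : ℝ}
    (hM : ∀ᵐ z ∂(pX ⊗ₘ cond), ‖z.2‖ ≤ M) {fstar : G}
    (hreg : ∀ᵐ x ∂qX, fstar x = ∫ y, y ∂(cond x)) :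
    ∀ᵐ x ∂pX, (∀ᵐ y ∂cond x, ‖wResidual β fstar (x, y)‖ ≤ √b * (2 * |M|) + 1) ∧
      ∫ y, wResidual β fstar (x, y) ∂cond x = 0 := by
  rw [hq, ae_withDensity_iff hβmeas.ennreal_ofReal] at hreg
  filter_upwards [Measure.ae_ae_of_ae_compProd hM, hreg] with x h1 h2
  -- The regression identity is known only almost everywhere for the target law, hence only where β
  -- > 0; where β = 0 the weighted residual vanishes.
  rcases (hβ0 x).eq_or_lt with h0 | h0
  · simp only [wResidual, ← h0, Real.sqrt_zero, zero_smul, norm_zero, integral_zero, and_true]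
    exact Filter.Eventually.of_forall fun y => by positivity
  · have h3 := h2 (ENNReal.ofReal_pos.2 h0).ne'
    have hint : Integrable (fun y : Y => y) (cond x) :=
      Integrable.of_bound (C := M) measurable_id.aestronglyMeasurable h1
    have h4 : ‖fstar x‖ ≤ |M| := by
      rw [h3]
      have := norm_integral_le_of_norm_le_const (μ := cond x) (f := fun y : Y => y) (C := M) h1
      simp only [probReal_univ, mul_one] at this
      exact this.trans (le_abs_self M)
    constructor
    · filter_upwards [h1] with y hy
      rw [wResidual, norm_smul, Real.norm_of_nonneg (Real.sqrt_nonneg _)]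
      have h5 : ‖y - fstar x‖ ≤ 2 * |M| := by
        have := norm_sub_le y (fstar x)
        have := hy.trans (le_abs_self M)
        linarith
      have h6 : √(β x) * ‖y - fstar x‖ ≤ √b * (2 * |M|) :=
        mul_le_mul (Real.sqrt_le_sqrt (hβb x)) h5 (norm_nonneg _) (Real.sqrt_nonneg _)
      exact h6.trans (by linarith)
    · simp only [wResidual]
      rw [integral_smul, integral_sub hint (integrable_const _), h3]
      simp

end Sampling

/-! ### Arithmetic of the regularization parameter -/

section Parameter

variable {a r : ℝ}

theorem regParam_rpow {n : ℕ} (p : ℝ) :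
    regParam a r n ^ p = (n : ℝ) ^ (-(a / (2 * a * r + a + 1)) * p) := by
  rw [regParam, ← Real.rpow_mul (Nat.cast_nonneg n)]

theorem inv_natCast_eq_regParam_rpow (ha : 0 < a) (hr : 0 < r) {n : ℕ} :
    (n : ℝ)⁻¹ = regParam a r n ^ (2 * r + 1 + a⁻¹) := by
  have h : 0 < 2 * a * r + a + 1 := by positivity
  rw [regParam_rpow, ← Real.rpow_neg_one]
  congr 1
  field_simp

theorem regParam_pos {n : ℕ} (hn : 1 ≤ n) : 0 < regParam a r n :=
  Real.rpow_pos_of_pos (by exact_mod_cast hn) _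

theorem regParam_le_one (ha : 0 < a) (hr : 0 < r) {n : ℕ} (hn : 1 ≤ n) : regParam a r n ≤ 1 :=
  Real.rpow_le_one_of_one_le_of_nonpos (by exact_mod_cast hn) (by
    have : 0 < a / (2 * a * r + a + 1) := by positivity
    linarith)

/-- The sample size condition of `measure_not_isGoodSample_le`. Since n = l^(-(2r + 1 + 1/a)), the
right side is l^(-2r - 1/a), and l ≤ 1. -/
theorem regParam_rpow_le (ha : 0 < a) (hr : 0 < r) {n : ℕ} (hn : 1 ≤ n) :
    regParam a r n ^ (-a⁻¹) ≤ n * regParam a r n := by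
  have hl := regParam_pos (a := a) (r := r) hn
  have h1 := inv_natCast_eq_regParam_rpow ha hr (n := n)
  have h2 : (n : ℝ) = regParam a r n ^ (-(2 * r + 1 + a⁻¹)) := by
    rw [Real.rpow_neg hl.le, ← h1, inv_inv]
  rw [h2, ← Real.rpow_add_one hl.ne']
  exact Real.rpow_le_rpow_of_exponent_ge hl (regParam_le_one ha hr hn) (by linarith)

theorem one_le_log_six_div {δ : ℝ} (hδ : 0 < δ) (hδ1 : δ < 1) : 1 ≤ Real.log (6 / δ) := by
  rw [Real.le_log_iff_exp_le (by positivity), le_div_iff₀ hδ]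
  have := Real.exp_one_lt_d9
  nlinarith [Real.exp_pos 1]

/-- 6/δ ≤ 8/δ³ = (2/δ)³. -/
theorem log_six_div_le {δ : ℝ} (hδ : 0 < δ) (hδ1 : δ < 1) :
    Real.log (6 / δ) ≤ 3 * Real.log (2 / δ) := by
  have h1 : 3 * Real.log (2 / δ) = Real.log ((2 / δ) ^ 3) := by
    rw [Real.log_pow]; norm_num
  rw [h1]
  refine Real.log_le_log (by positivity) ?_
  rw [div_pow, div_le_div_iff₀ hδ (by positivity)]
  nlinarith [pow_pos hδ 3, mul_pos hδ hδ]

end Parameter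

end CovShift

end

/-! ### The two convergence rates -/

theorem mainTheorem4
    {X Y H G : Type*} [MeasurableSpace X]
    [NormedAddCommGroup Y] [InnerProductSpace ℝ Y] [CompleteSpace Y]
    [SecondCountableTopology Y] [MeasurableSpace Y] [BorelSpace Y]
    -- the scalar RKHS `H` with kernel `k`, and the vRKHS `G` with kernel `k(x, t) Id_Y`
    [NormedAddCommGroup H] [InnerProductSpace ℝ H] [CompleteSpace H] [RKHS ℝ H X ℝ]
    [NormedAddCommGroup G] [InnerProductSpace ℝ G] [CompleteSpace G] [RKHS ℝ G X Y]
    (hG : ∀ x t : X,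
      RKHS.kernel G x t = CovShift.scalarKernel H x t • ContinuousLinearMap.id ℝ Y)
    (hkmeas : ∀ t : X, Measurable fun x => CovShift.scalarKernel H x t)
    -- source law `p = pX ⊗ κ`, target input law `qX = β pX`
    (pX qX : Measure X) [IsProbabilityMeasure pX] [IsProbabilityMeasure qX]
    (cond : Kernel X Y) [IsMarkovKernel cond]
    (β : X → ℝ) (hβmeas : Measurable β) (hβ0 : ∀ x, 0 ≤ β x)
    (hq : qX = pX.withDensity fun x => ENNReal.ofReal (β x))
    -- boundedness of the kernel, of the weights and of the outputs
    (κ : ℝ) (hκ : ∀ x, CovShift.scalarKernel H x x ≤ κ ^ 2)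
    (b : ℝ) (hb : 0 < b) (hβb : ∀ x, β x ≤ b)
    (M : ℝ) (hM : ∀ᵐ z ∂(pX ⊗ₘ cond), ‖z.2‖ ≤ M)
    -- eigenvalue decay with exponent `a > 1`
    (f : HilbertBasis ℕ ℝ H) (μ : ℕ → ℝ) (hμ0 : ∀ i, 0 < μ i)
    (hμ : ∀ i, CovShift.covOp H qX (f i) = μ i • f i)
    (a : ℝ) (ha : 1 < a)
    (hdecay : ∃ m₁ > 0, ∃ m₂ > 0, ∀ i : ℕ,
      m₁ * ((i : ℝ) + 1) ^ (-a) ≤ μ i ∧ μ i ≤ m₂ * ((i : ℝ) + 1) ^ (-a))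
    -- the regression function `f* = C_* φ(·)`
    (fstar : G) (hreg : ∀ᵐ x ∂qX, fstar x = ∫ y, y ∂(cond x))
    (Cstar : H →L[ℝ] Y) (hCstar : ∀ x, fstar x = Cstar (CovShift.feature H x))
    -- Hölder source condition `C_* = C_o C_X ^ r` with `C_o` Hilbert-Schmidt
    (r : ℝ) (hr : 0 < r)
    (hsource : ∃ Co : H →L[ℝ] Y, CovShift.IsHilbertSchmidt Co ∧
      Cstar = Co ∘L CovShift.spectralFun (fun t => t ^ r) (CovShift.covOp H qX))
    -- regularization family on `[0, s]`, which contains the spectra of the empirical operators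
    (s : ℝ) (hs : b * κ ^ 2 ≤ s) (g : ℝ → ℝ → ℝ) (hg : CovShift.IsRegularizationFamily s g)
    (ν : ℝ) (hν : CovShift.HasQualification s g ν) :
    (r < ν → ∃ c₁ > 0, ∀ n : ℕ, 1 ≤ n → CovShift.regParam a r n ≤ s →
      ∀ δ : ℝ, 0 < δ → δ < 1 →
        Measure.pi (fun _ : Fin n => pX ⊗ₘ cond)
          {z | c₁ * (n : ℝ) ^ (-(a * r / (2 * a * r + a + 1))) * Real.log (2 / δ) <
            ‖fstar - CovShift.estimator G β g (CovShift.regParam a r n) z‖}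
          ≤ ENNReal.ofReal δ) ∧
    (r < ν - 1 / 2 → ∃ c₂ > 0, ∀ n : ℕ, 1 ≤ n → CovShift.regParam a r n ≤ s →
      ∀ δ : ℝ, 0 < δ → δ < 1 →
        Measure.pi (fun _ : Fin n => pX ⊗ₘ cond)
          {z | ENNReal.ofReal (c₂ * (n : ℝ) ^ (-((2 * a * r + a) / (4 * a * r + 2 * a + 2))) *
              Real.log (2 / δ)) <
            eLpNorm
              (fun x => fstar x - CovShift.estimator G β g (CovShift.regParam a r n) z x) 2 qX}
          ≤ ENNReal.ofReal δ) := by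
  obtain ⟨J, hJx, hJk, hJ⟩ := CovShift.exists_tensor (H := H) hG
  have : TopologicalSpace.SeparableSpace H := CovShift.separableSpace_of_hilbertBasis f
  obtain ⟨U, u, -⟩ := exists_hilbertBasis ℝ Y
  have : Countable U := CovShift.countable_of_hilbertBasis u
  obtain ⟨m₁, hm₁, m₂, hm₂, hdec⟩ := hdecay
  obtain ⟨⟨D₀, hD₀, hgD⟩, B₀, hB₀, hgB⟩ := hg
  obtain ⟨hν0, γ, hγ⟩ := hν
  have ha0 : 0 < a := by linarith
  have hμ0' : ∀ j, 0 ≤ μ j := fun j => (hμ0 j).le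
  have hμm : ∀ j, μ j ≤ m₂ := fun j => (hdec j).2.trans
    (mul_le_of_le_one_right hm₂.le (Real.rpow_le_one_of_one_le_of_nonpos
      (le_add_of_nonneg_left (Nat.cast_nonneg j)) (by linarith)))
  have hsymm := CovShift.covOp_symm f hkmeas hκ qX
  have hC : CovShift.IsDiag f μ (CovShift.covOp H qX) := CovShift.IsDiag.of_apply_basis hsymm hμ
  have hpow : ∀ p : ℝ, ∃ P : H →L[ℝ] H, 0 < p → CovShift.IsDiag f (fun j => μ j ^ p) P := by
    intro p
    by_cases hp : 0 < p
    · obtain ⟨P, hP⟩ := CovShift.exists_isDiag f (fun j => μ j ^ p) (K := m₂ ^ p) fun j => by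
        rw [abs_of_nonneg (Real.rpow_nonneg (hμ0' j) _)]
        exact Real.rpow_le_rpow (hμ0' j) (hμm j) hp.le
      exact ⟨P, fun _ => hP⟩
    · exact ⟨0, fun h => absurd h hp⟩
  choose P hP using hpow
  obtain ⟨ξ, hx, hξ⟩ := CovShift.exists_component_source hJk u hCstar hsymm hμ (hP r hr) hsource
  have hws : ∀ x, ‖CovShift.wFeature H β x‖ ^ 2 ≤ b * κ ^ 2 := fun x => by
    rw [CovShift.norm_wFeature_sq hβ0]
    exact mul_le_mul (hβb x) (hκ x) (by rw [← CovShift.norm_feature_sq]; positivity) hb.le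
  obtain ⟨K₁, hK₁, hdim⟩ := CovShift.exists_effectiveDimension_le ha hm₂.le hμ0'
    fun i => (hdec i).2
  have hwm : StronglyMeasurable fun x : X => CovShift.wFeature H β x :=
    hβmeas.sqrt.stronglyMeasurable.smul (CovShift.stronglyMeasurable_feature f hkmeas)
  have hεm : StronglyMeasurable (CovShift.wResidual β fstar) := by
    have h1 : StronglyMeasurable fun x : X => fstar x := by
      simp_rw [hCstar]
      exact Cstar.continuous.comp_stronglyMeasurable
        (CovShift.stronglyMeasurable_feature f hkmeas)
    exact (hβmeas.sqrt.comp measurable_fst).stronglyMeasurable.smul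
      (measurable_snd.stronglyMeasurable.sub (h1.comp_measurable measurable_fst))
  -- The extra 1 in R, like the 1 in the residual bound, secures strict positivity when κ or M
  -- vanishes.
  obtain ⟨K, hK, hgood⟩ := CovShift.measure_not_isGoodSample_le hJ pX cond hwm
    (R := b * κ ^ 2 + 1) (by positivity) (fun x => (hws x).trans (by linarith))
    (CovShift.integral_wFeature_mul pX qX hβmeas hβ0 hq cond f hkmeas hκ) hμ0' hC hεm
    (by positivity) (CovShift.ae_wResidual pX qX hβmeas hβ0 hq cond hβb hM hreg) ha0 hK₁
    fun l hl hl1 => by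
      obtain ⟨ℓ, N, -, hN, hN0, hNℓ, hℓ⟩ := hdim l hl hl1
      exact ⟨N, hN, hN0, hNℓ.trans hℓ⟩
  obtain ⟨K', hK', herr⟩ := CovShift.exists_error_bound hJx hJk hJ hβ0 hμ0' hC hP
    (c := max 1 (max m₂ s)) (le_max_left _ _)
    (fun j => (hμm j).trans ((le_max_left _ _).trans (le_max_right _ _)))
    ((le_max_right _ _).trans (le_max_right _ _)) (fun x => (hws x).trans hs) hD₀.le hgD hgB hγ
    hr ha0 u hx hξ (M := √b * (2 * |M|) + 1) hK hK₁.le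
  -- Common frame of both claims: a set S has measure at most δ if on it the error bound and the
  -- covariance comparison with L = log(6/δ) are contradictory, since then S misses the typical
  -- samples.
  have hmain : ∀ n : ℕ, 1 ≤ n → CovShift.regParam a r n ≤ s → ∀ δ : ℝ, 0 < δ → δ < 1 →
      ∀ τ : ℝ, 0 ≤ τ → τ ≤ 1 / 2 → r + τ ≤ ν → ∀ S : Set (Fin n → X × Y),
      (∀ z ∈ S, ∀ (t : Set H) (e : HilbertBasis t ℝ H) (σ : t → ℝ) (W : H →L[ℝ] H) (c : U → ℝ)
        (c' : ℝ), (∀ i, 0 ≤ σ i) →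
        CovShift.IsDiag e σ (CovShift.empCov fun i => CovShift.wFeature H β (z i).1) →
        CovShift.IsDiag e (fun i => (σ i + CovShift.regParam a r n) ^ τ) W →
        (∀ k, ‖W (CovShift.component J (u k)
          (fstar - CovShift.estimator G β g (CovShift.regParam a r n) z))‖ ^ 2 ≤ c k) →
        HasSum c c' → c' ≤ K' * Real.log (6 / δ) * CovShift.regParam a r n ^ (2 * r + 2 * τ) →
        ¬ ∀ h, inner ℝ h (CovShift.covOp H qX h) ≤ K * Real.log (6 / δ) *
          (inner ℝ h (CovShift.empCov (fun i => CovShift.wFeature H β (z i).1) h) +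
            CovShift.regParam a r n * ‖h‖ ^ 2)) →
      Measure.pi (fun _ : Fin n => pX ⊗ₘ cond) S ≤ ENNReal.ofReal δ := by
    intro n hn hns δ hδ hδ1 τ hτ0 hτ1 hτν S hS
    have hl := CovShift.regParam_pos (a := a) (r := r) hn
    have hl1 := CovShift.regParam_le_one ha0 hr hn
    have hL := CovShift.one_le_log_six_div hδ hδ1
    obtain ⟨D, hD⟩ := CovShift.exists_isDiag f
      (fun j => (√(μ j + CovShift.regParam a r n))⁻¹) (K := (√(CovShift.regParam a r n))⁻¹)
      fun j => by
        rw [abs_of_nonneg (by positivity)]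
        exact inv_anti₀ (Real.sqrt_pos.2 hl) (Real.sqrt_le_sqrt (by linarith [hμ0 j]))
    obtain ⟨ℓ, N, hℓ, -, -, -, hℓK⟩ := hdim _ hl hl1
    refine (measure_mono ?_).trans ((hgood n _ _ D hn hl hl1 hL
      (CovShift.regParam_rpow_le ha0 hr hn) hD).trans (le_of_eq ?_))
    · intro z hz hgz
      obtain ⟨t, e, σ, W, c, c', hσ0, hσ, hW, hc, hsum, hc'⟩ := herr n z _ _ ℓ D hn hl hl1 hns hL
        (CovShift.inv_natCast_eq_regParam_rpow ha0 hr) hD hℓ hℓK hgz τ hτ0 hτ1 hτν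
      exact hS z hz t e σ W c c' hσ0 hσ hW hc hsum hc' hgz.cov
    · rw [Real.exp_neg, Real.exp_log (by positivity), inv_div, mul_div_cancel₀ _ (by norm_num)]
  refine ⟨fun hrν => ⟨3 * √K', by positivity, fun n hn hns δ hδ hδ1 => ?_⟩,
    fun hrν => ⟨3 * √(K * K'), by positivity, fun n hn hns δ hδ hδ1 => ?_⟩⟩
  · have hl := CovShift.regParam_pos (a := a) (r := r) hn
    have hL := CovShift.one_le_log_six_div hδ hδ1
    have hL3 := CovShift.log_six_div_le hδ hδ1
    refine hmain n hn hns δ hδ hδ1 0 le_rfl (by norm_num) (by linarith) _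
      fun z hz t e σ W c c' hσ0 hσ hW hc hsum hc' _ => ?_
    -- For τ = 0 the weight is the identity, and the sum over components is the squared norm in `G`.
    have hWid : ∀ v, W v = v := fun v => CovShift.ext_inner_hilbertBasis e fun i => by
      simp only [hW i v, Real.rpow_zero, one_mul]
    have h1 : ‖fstar - CovShift.estimator G β g (CovShift.regParam a r n) z‖ ^ 2 ≤ c' :=
      hasSum_le (fun k => by simpa only [hWid] using hc k)
        (CovShift.hasSum_norm_component_sq hJk hJ e u _) hsum
    -- As L ≥ 1, the factor L is relaxed to L².
    have h2 : K' * Real.log (6 / δ) * CovShift.regParam a r n ^ (2 * r + 2 * 0) ≤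
        (√K' * Real.log (6 / δ) * CovShift.regParam a r n ^ r) ^ 2 := by
      rw [mul_pow, mul_pow, Real.sq_sqrt hK'.le, ← Real.rpow_natCast (_ ^ r),
        ← Real.rpow_mul hl.le, mul_zero, add_zero, Nat.cast_ofNat, mul_comm r]
      gcongr
      nlinarith
    have h3 := abs_le_of_sq_le_sq' (h1.trans (hc'.trans h2)) (by positivity) |>.2
    have h4 : CovShift.regParam a r n ^ r = (n : ℝ) ^ (-(a * r / (2 * a * r + a + 1))) := by
      rw [CovShift.regParam_rpow]; ring_nf
    rw [Set.mem_ofPred_eq, ← h4] at hz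
    have h5 : √K' * Real.log (6 / δ) * CovShift.regParam a r n ^ r ≤
        √K' * (3 * Real.log (2 / δ)) * CovShift.regParam a r n ^ r := by gcongr
    linarith
  · have hl := CovShift.regParam_pos (a := a) (r := r) hn
    have hL := CovShift.one_le_log_six_div hδ hδ1
    have hL3 := CovShift.log_six_div_le hδ hδ1
    refine hmain n hn hns δ hδ hδ1 (1 / 2) (by norm_num) le_rfl (by linarith) _
      fun z hz t e σ W c c' hσ0 hσ hW hc hsum hc' hcov => ?_
    have hc0 : 0 ≤ c' := hsum.nonneg fun k => (sq_nonneg _).trans (hc k)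
    have hKL : 0 < K * Real.log (6 / δ) := by positivity
    obtain ⟨V, hV⟩ := CovShift.exists_isDiag f (fun j => √(μ j)) (K := √m₂) fun j => by
      rw [abs_of_nonneg (Real.sqrt_nonneg _)]; exact Real.sqrt_le_sqrt (hμm j)
    -- For τ = 1/2 one has ‖W v‖² = ⟪v, (C_z + l) v⟫, so C ≤ K L (C_z + l) converts the empirical
    -- bound into the L² norm. The second factor L is spent here, giving L² and hence L after the
    -- square root.
    have hb : ∀ k, inner ℝ (CovShift.component J (u k)
          (fstar - CovShift.estimator G β g (CovShift.regParam a r n) z))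
        (CovShift.covOp H qX (CovShift.component J (u k)
          (fstar - CovShift.estimator G β g (CovShift.regParam a r n) z))) ≤
        K * Real.log (6 / δ) * c k := by
      intro k
      set v := CovShift.component J (u k)
        (fstar - CovShift.estimator G β g (CovShift.regParam a r n) z)
      have e1 : inner ℝ v (CovShift.empCov (fun i => CovShift.wFeature H β (z i).1) v) +
          CovShift.regParam a r n * ‖v‖ ^ 2 = ‖W v‖ ^ 2 := by
        rw [(hW.hasSum_sq v).unique (((hσ.add_smul_id _).hasSum_inner v).congr_fun fun i => by
          rw [← Real.sqrt_eq_rpow, Real.sq_sqrt (by linarith [hσ0 i])]), add_apply, smul_apply,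
          ContinuousLinearMap.id_apply, inner_add_left, real_inner_smul_left,
          real_inner_self_eq_norm_sq, real_inner_comm]
      refine (hcov v).trans (mul_le_mul_of_nonneg_left ?_ hKL.le)
      rw [e1]
      exact hc k
    have hB : HasSum (fun k => K * Real.log (6 / δ) * c k)
        (√(K * Real.log (6 / δ) * c') ^ 2) := by
      rw [Real.sq_sqrt (by positivity)]
      exact hsum.mul_left _
    have h1 := CovShift.eLpNorm_le_of_component hJk f u hkmeas hκ qX _ hb hB (Real.sqrt_nonneg _)
    simp only [RKHS.coe_sub, Pi.sub_apply] at h1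
    rw [Set.mem_ofPred_eq] at hz
    refine not_lt_of_ge (h1.trans (ENNReal.ofReal_le_ofReal ?_)) hz
    have h2 : K * Real.log (6 / δ) * c' ≤
        (√(K * K') * Real.log (6 / δ) * CovShift.regParam a r n ^ (r + 1 / 2)) ^ 2 := by
      rw [mul_pow, mul_pow, Real.sq_sqrt (by positivity), ← Real.rpow_natCast (_ ^ (r + 1 / 2)),
        ← Real.rpow_mul hl.le]
      refine (mul_le_mul_of_nonneg_left hc' hKL.le).trans (le_of_eq ?_)
      push_cast
      ring_nf
    have h4 : CovShift.regParam a r n ^ (r + 1 / 2) =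
        (n : ℝ) ^ (-((2 * a * r + a) / (4 * a * r + 2 * a + 2))) := by
      rw [CovShift.regParam_rpow]
      congr 1
      have h5 : 0 < 2 * a * r + a + 1 := by positivity
      have h6 : 4 * a * r + 2 * a + 2 = 2 * (2 * a * r + a + 1) := by ring
      rw [h6]
      field_simp
    rw [← h4]
    have h5 : √(K * K') * Real.log (6 / δ) * CovShift.regParam a r n ^ (r + 1 / 2) ≤
        √(K * K') * (3 * Real.log (2 / δ)) * CovShift.regParam a r n ^ (r + 1 / 2) := by gcongr
    have h6 := Real.sqrt_le_left (by positivity) |>.2 h2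
    linarith
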